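/- Let $d\ge 1$, $I=[0,1]^d$, and let $Y_1,Y_2,\dots$ be i.i.d. continuous, centered, (strictly) stationary real random fields on $\mathbf{R}^d$ with covariance $\mathbb{E}\,Y_k(x)Y_k(y)=f(|x-y|)$, such that $$\mathbb{E}\,e^{\lambda Y_k(0)}<\infty\ \text{ for all }\lambda\in\mathbf{R},\qquad \mathbb{E}|Y_k(x)-Y_k(y)|^r\le C_r|x-y|^r\ \text{ for all } r\ge 2,\ x,y\in\mathbf{R}^d,$$ with constants $C_r$ that may depend on $r$, and $f(t)=1+O(t)$ as $t\to0^+$ (in particular $f(0)=1$), $f(t)=O(t^{-\delta})$ as $t\to\infty$ for some $\delta>0$. Let $(a_k)_{k\ge1}$, $(b_k)_{k\ge1}$ be given by one of the following three cases: 1. $a_k=k^{-\alpha}$ for some $1/3<\alpha<1/2$ and $b_k=\exp\big(k^{1-2\alpha}/(1-2\alpha)\big)$; 2. $a_k=k^{-1/2}$ and $b_k=k$; 3. $a_k=(k\log k)^{-1/2}$ and $b_k=\log k$ for $k\ge2$, and $a_1=b_1=0$. Put $X_k(x)=a_kY_k(b_kx)$ and, for $n \ge 0$, $g\in C(I,\mathbf{C})$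 and $\beta\in\mathbf{C}$, $$\mu_n(g;\beta)=\int_I g(x)\,\frac{e^{\beta\sum_{k=1}^nX_k(x)}}{\mathbb{E}\,e^{\beta\sum_{k=1}^nX_k(x)}}\,dx .$$ Then there is an open set $U\subset\mathbf{C}$ containing the interval $(0,\sqrt{2d})$ such that $\mathbb{E}\,e^{\beta\sum_{k=1}^nX_k(x)}$ exists and is nonzero for all $\beta\in U$, $n\ge 0$, $x\in I$; for all $\beta\in U$ and $g\in C(I,\mathbf{C})$ the sequence $(\mu_n(g;\beta))_n$ is a martingale with respect to the $\sigma$-algebras $\sigma(X_1,\dots,X_n)$ (where $X_k$ is restricted to $I$); and: * for every compact $K\subset U$ there is $p>1$ such that for all $\beta\in K$ and all $g\in C(I,\mathbf{C})$ the martingale $\mu_n(g;\beta)$ converges in $L^p(\Omega)$; * for every fixed $g\in C(I,\mathbf{C})$, almost surely the maps $\beta\mapsto\mu_n(g;\beta)$ converge, uniformly on compact subsets of $U$, to an analytic map $\beta\mapsto\mu(g;\beta)$ on $U$. -/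

import Mathlib

open MeasureTheory ProbabilityTheory Filter Topology

noncomputable section

namespace LogChaos

/-- The closed unit cube `I = [0,1]^d` in Euclidean space. -/
def unitCube (d : ℕ) : Set (EuclideanSpace ℝ (Fin d)) :=
  {x | ∀ i, x i ∈ Set.Icc (0 : ℝ) 1}

section Chaos

variable {d : ℕ} {Ω : Type*} [mΩ : MeasurableSpace Ω]

/-- The partial sums `∑_{k=1}^n X_k(x)`; the index `0` is never used. -/
def partialSum (X : ℕ → unitCube d → Ω → ℝ) (n : ℕ) (x : unitCube d) (ω : Ω) : ℝ :=
  ∑ k ∈ Finset.Icc 1 n, X k x ω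

/-- The normalising factor `E exp (β ∑_{k=1}^n X_k(x))`. -/
def normalizer (P : Measure Ω) (X : ℕ → unitCube d → Ω → ℝ) (n : ℕ) (β : ℂ) (x : unitCube d) : ℂ :=
  ∫ ω, Complex.exp (β * (partialSum X n x ω : ℂ)) ∂P

/-- The random variable
`μ_n(f; β) = ∫_I f(x) exp (β ∑_{k=1}^n X_k(x)) / E exp (β ∑_{k=1}^n X_k(x)) dx`. -/
def chaos (P : Measure Ω) (X : ℕ → unitCube d → Ω → ℝ) (n : ℕ) (f : C(unitCube d, ℂ)) (β : ℂ)
    (ω : Ω) : ℂ :=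
  ∫ x : unitCube d, f x * (Complex.exp (β * (partialSum X n x ω : ℂ)) / normalizer P X n β x)
    ∂(Measure.comap Subtype.val volume)

/-- The σ-algebra `σ(X_1, …, X_n)`. -/
abbrev fieldSigma (X : ℕ → unitCube d → Ω → ℝ) (n : ℕ) : MeasurableSpace Ω :=
  ⨆ k ∈ Finset.Icc 1 n, ⨆ x : unitCube d, MeasurableSpace.comap (X k x) inferInstance

/-- The subcritical chaos of the fields `X_k` exists in `L^p` and is analytic in the inverse
temperature, on an open complex neighbourhood `U` of `(0, √(2d))`.

Since `Complex.exp _` is never zero and a Bochner integral of a non-integrable function is `0`,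
the condition on `normalizer` says that `E exp (β ∑ X_k(x))` exists and does not vanish, so that
`chaos` is well defined for every `β ∈ U`. -/
def HasAnalyticSubcriticalChaos (P : Measure Ω) (X : ℕ → unitCube d → Ω → ℝ) : Prop :=
  ∃ U : Set ℂ, IsOpen U ∧
    (∀ t : ℝ, t ∈ Set.Ioo 0 (Real.sqrt (2 * d)) → (t : ℂ) ∈ U) ∧
    (∀ β ∈ U, ∀ n : ℕ, ∀ x : unitCube d, normalizer P X n β x ≠ 0) ∧
    -- the chaos is a martingale
    (∃ ℱ : Filtration ℕ mΩ, (∀ n, ℱ n = fieldSigma X n) ∧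
      ∀ β ∈ U, ∀ f : C(unitCube d, ℂ), Martingale (fun n => chaos P X n f β) ℱ P) ∧
    -- convergence in `L^p`, with the same `p` for all `β ∈ K` and all `f`
    (∀ K : Set ℂ, IsCompact K → K ⊆ U → ∃ p : ℝ, 1 < p ∧
      ∀ β ∈ K, ∀ f : C(unitCube d, ℂ),
        (∀ n, MemLp (chaos P X n f β) (ENNReal.ofReal p) P) ∧
        ∃ M : Ω → ℂ, MemLp M (ENNReal.ofReal p) P ∧
          Tendsto (fun n => eLpNorm (fun ω => chaos P X n f β ω - M ω) (ENNReal.ofReal p) P)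
            atTop (𝓝 0)) ∧
    -- almost sure locally uniform convergence to an analytic function of `β`
    (∀ f : C(unitCube d, ℂ), ∃ M : Ω → ℂ → ℂ, ∀ᵐ ω ∂P,
      AnalyticOnNhd ℂ (M ω) U ∧
      ∀ K : Set ℂ, IsCompact K → K ⊆ U →
        TendstoUniformlyOn (fun n β => chaos P X n f β ω) (M ω) atTop K)

/-- The assumptions on the fields `Y_1, Y_2, …` on `ℝ^d` (`Y 0` is not used): they are i.i.d.,
continuous, centered, stationary, have an isotropic covariance `f(|x-y|)` with
`f(t) = 1 + O(t)` as `t → 0` and `f(t) = O(t^{-δ})` as `t → ∞`, have all exponential moments, and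
satisfy `E |Y_k(x) - Y_k(y)|^r ≤ C_r |x-y|^r` for all `r ≥ 2`.
Laws and independence of random fields refer to the product σ-algebra on functions `ℝ^d → ℝ`. -/
structure IsStationarySequence (P : Measure Ω)
    (Y : ℕ → EuclideanSpace ℝ (Fin d) → Ω → ℝ) : Prop where
  measurable : ∀ k ≥ 1, ∀ x, Measurable (Y k x)
  continuous : ∀ k ≥ 1, ∀ ω, Continuous fun x => Y k x ω
  independent : iIndepFun (fun (k : ℕ+) (ω : Ω) (x : EuclideanSpace ℝ (Fin d)) => Y k x ω) P
  identDistrib : ∀ k ≥ 1, IdentDistrib (fun ω x => Y k x ω) (fun ω x => Y 1 x ω) P P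
  stationary : ∀ k ≥ 1, ∀ h : EuclideanSpace ℝ (Fin d),
    IdentDistrib (fun ω x => Y k (x + h) ω) (fun ω x => Y k x ω) P P
  centered : ∀ k ≥ 1, ∀ x, ∫ ω, Y k x ω ∂P = 0
  exp_moments : ∀ k ≥ 1, ∀ s : ℝ, Integrable (fun ω => Real.exp (s * Y k 0 ω)) P
  covariance : ∃ (f : ℝ → ℝ) (δ : ℝ), 0 < δ ∧
    (∀ k ≥ 1, ∀ x y, ∫ ω, Y k x ω * Y k y ω ∂P = f ‖x - y‖) ∧
    ((fun t => f t - 1) =O[𝓝[≥] 0] fun t => t) ∧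
    (f =O[atTop] fun t => t ^ (-δ))
  regularity : ∀ r : ℝ, 2 ≤ r → ∃ C : ℝ, ∀ k ≥ 1, ∀ x y,
    ∫ ω, |Y k x ω - Y k y ω| ^ r ∂P ≤ C * ‖x - y‖ ^ r

/-- The dilated fields `X_k(x) = a_k Y_k(b_k x)` on the unit cube. -/
def dilatedField (a b : ℕ → ℝ) (Y : ℕ → EuclideanSpace ℝ (Fin d) → Ω → ℝ) (k : ℕ)
    (x : unitCube d) (ω : Ω) : ℝ :=
  a k * Y k (b k • (x : EuclideanSpace ℝ (Fin d))) ω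

end Chaos

end LogChaos

end

/-! Up to a shift of the index, `chaos` is the integral of g(x) W_N(x), where W_N(x) is a product of
independent factors exp(z_k A_k(x)) / φ(z_k) of mean one, with z_k = β a_k and φ the complex moment
generating function of Y_1(0). Hence it is a martingale, and everything follows from one estimate:
near each real t₀ in (0, √(2d)) it is bounded in L^{1+q} for some q > 0, uniformly in N and in β in
a complex disc (`exists_eLpNorm_integral_weight_le`). A maximal inequality then gives convergence in
L^s for s < 1+q (`exists_tendsto_eLpNorm_sub`), and Cauchy's formula turns almost sure convergence
at almost every point of a circle into uniform convergence on the disc of half the radius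
(`ae_exists_tendstoUniformlyOn`).

For the estimate, choose checkpoints n_l at which the sum of the a_k² is between l-1 and l
(`exists_scaleBounds`). Since b_k is the exponential of the partial variance up to a bounded factor,
the fields after n_l are nearly uncorrelated at distance e^{-l}. Over a block [n_j, n_{j+1}) the
product of the factors equals 1 + L_j + R_j, where L_j is the martingale transform of the linear
terms z_k A_k and R_j that of the nonlinear remainders. Expanding block after block
(`weight_eq_sum_blockTerm`) gives W = ∏ (1 + R_i) + ∑_j W_{n_j} L_j ∏_{i>j} (1 + R_i). The second
moments of the R_i are of order a_k⁴ and a_k³ is summable, so the products of the 1 + R_i are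
bounded in L².

In the j-th term the past weight W_{n_j} is independent of the other factors. Their correlation
between x and y is at most a constant times the sum of a_k² |cov_k(x, y)| over the block
(`norm_integral_blockTerm_le`), which is O(e^{-δ(j-l)}) when |x-y| is about e^{-l}. Taking second
moments conditionally on the past (`lintegral_enorm_integral_rpow_le`) leaves the moment of order
(1+q)/2 of a quadratic form in |W_{n_j}| with this kernel. Moreover |W_{n_j}| is at most e^{(Im β)²
j/2 + O(1)} times the positive weight w with parameter Re β.

The quadratic form is controlled by the size-biased moments E[w(x) w(S_l(x))^q], where S_l(x) is the
shell at distance about e^{-l} around x (`lintegral_quadratic_rpow_le`). One application of Hölder's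
inequality, splitting w at the scale l, bounds them by a multiple of e^{-q(d - t²/(2(1-q))) l} for t
≥ Re β (`lintegral_rweight_mul_rpow_le`). The rate is positive when t² < 2d(1-q), which a small q
achieves below √(2d). Together with the decay of the kernel this makes the j-th term exponentially
small in j, and a small Im β uses up only part of the rate. -/

noncomputable section

namespace LogChaos


/-! ### Estimates for the normalised exponentials of one random variable. -/

section SingleVariable

variable {Ω : Type*} [MeasurableSpace Ω] {P : Measure Ω}

lemma _root_.MeasureTheory.MemLp.integrable_sq_norm {E : Type*} [NormedAddCommGroup E] {f : Ω → E}
    (hf : MemLp f 2 P) : Integrable (fun ω => ‖f ω‖ ^ 2) P :=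
  (memLp_two_iff_integrable_sq_norm hf.1).1 hf

/-- A standardised real random variable all of whose exponential moments are finite. -/
structure IsStandardExp (ζ : Ω → ℝ) (P : Measure Ω) : Prop where
  measurable : Measurable ζ
  exp : ∀ s : ℝ, Integrable (fun ω => Real.exp (s * ζ ω)) P
  mean : ∫ ω, ζ ω ∂P = 0
  var : ∫ ω, ζ ω ^ 2 ∂P = 1

namespace IsStandardExp

variable {ζ : Ω → ℝ}

lemma integrableExpSet_eq (h : IsStandardExp ζ P) : integrableExpSet ζ P = Set.univ :=
  Set.eq_univ_of_forall h.exp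

lemma mem_interior (h : IsStandardExp ζ P) (s : ℝ) : s ∈ interior (integrableExpSet ζ P) := by
  simp [h.integrableExpSet_eq]

lemma integrable_cexp (h : IsStandardExp ζ P) (z : ℂ) :
    Integrable (fun ω => Complex.exp (z * ζ ω)) P :=
  integrable_cexp_mul_of_re_mem_interior_integrableExpSet (h.mem_interior _)

/-- Follows from e^{M|a|} ≤ e^{Ma} + e^{-Ma}. These are the dominating functions for the Taylor
remainders of e^{zζ}. -/
lemma integrable_pow_mul_exp_abs (h : IsStandardExp ζ P) (n : ℕ) (M : ℝ) :
    Integrable (fun ω => |ζ ω| ^ n * Real.exp (M * |ζ ω|)) P := by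
  have h1 := (integrable_pow_abs_mul_exp_of_mem_interior_integrableExpSet (h.mem_interior M) n).add
    (integrable_pow_abs_mul_exp_of_mem_interior_integrableExpSet (h.mem_interior (-M)) n)
  have hm := h.measurable
  refine h1.mono' (by fun_prop) (ae_of_all _ fun ω => ?_)
  simp only [Pi.add_apply]
  rw [Real.norm_of_nonneg (by positivity), ← mul_add]
  gcongr
  rcases abs_cases (ζ ω) with ⟨h, _⟩ | ⟨h, _⟩ <;> rw [h]
  · linarith [Real.exp_pos (-M * ζ ω)]
  · rw [mul_neg, ← neg_mul]; linarith [Real.exp_pos (M * ζ ω)]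

lemma integrable (h : IsStandardExp ζ P) : Integrable ζ P :=
  integrable_of_mem_interior_integrableExpSet (h.mem_interior 0)

lemma integrable_ofReal (h : IsStandardExp ζ P) : Integrable (fun ω => (ζ ω : ℂ)) P :=
  h.integrable.ofReal

lemma integrable_sq (h : IsStandardExp ζ P) : Integrable (fun ω => ζ ω ^ 2) P :=
  integrable_pow_of_mem_interior_integrableExpSet (h.mem_interior 0) 2

lemma memLp_two (h : IsStandardExp ζ P) : MemLp ζ 2 P :=
  memLp_of_mem_interior_integrableExpSet (h.mem_interior 0) 2

lemma continuous_complexMGF (h : IsStandardExp ζ P) : Continuous (complexMGF ζ P) := by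
  have : DifferentiableOn ℂ (complexMGF ζ P) Set.univ := by
    have := differentiableOn_complexMGF (X := ζ) (μ := P)
    simpa [h.integrableExpSet_eq] using this
  exact (differentiableOn_univ.1 this).continuous

lemma differentiable_complexMGF (h : IsStandardExp ζ P) : Differentiable ℂ (complexMGF ζ P) := by
  have : DifferentiableOn ℂ (complexMGF ζ P) Set.univ := by
    have := differentiableOn_complexMGF (X := ζ) (μ := P)
    simpa [h.integrableExpSet_eq] using this
  exact differentiableOn_univ.1 this

variable [IsProbabilityMeasure P]

/-- Integrate 1 + tζ ≤ e^{tζ}, with ζ centered. This keeps the complex generating function away from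
zero near the real axis. -/
lemma one_le_mgf (h : IsStandardExp ζ P) (t : ℝ) : 1 ≤ mgf ζ P t := by
  have : ∫ ω, (1 + t * ζ ω) ∂P ≤ mgf ζ P t := by
    refine integral_mono ((integrable_const 1).add (h.integrable.const_mul t)) (h.exp t) fun ω => ?_
    simpa [add_comm] using Real.add_one_le_exp (t * ζ ω)
  rwa [integral_add (integrable_const 1) (h.integrable.const_mul t), integral_const_mul, h.mean,
    mul_zero, integral_const, add_zero, probReal_univ, one_smul] at this

/-- Third order expansion of the moment generating function. -/
lemma exists_norm_complexMGF_sub_le (h : IsStandardExp ζ P) (M : ℝ) :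
    ∃ C, 0 ≤ C ∧ ∀ z : ℂ, ‖z‖ ≤ M → ‖complexMGF ζ P z - 1 - z ^ 2 / 2‖ ≤ C * ‖z‖ ^ 3 := by
  refine ⟨∫ ω, |ζ ω| ^ 3 * Real.exp (M * |ζ ω|) ∂P, integral_nonneg fun ω => by positivity,
    fun z hz => ?_⟩
  have i1 := h.integrable_ofReal
  have i2 : Integrable (fun ω => ((ζ ω ^ 2 : ℝ) : ℂ)) P := h.integrable_sq.ofReal
  have e1 : ∫ ω, ((ζ ω : ℝ) : ℂ) ∂P = 0 := by rw [integral_complex_ofReal, h.mean]; simp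
  have e2 : ∫ ω, ((ζ ω ^ 2 : ℝ) : ℂ) ∂P = 1 := by rw [integral_complex_ofReal, h.var]; simp
  have key : complexMGF ζ P z - 1 - z ^ 2 / 2 = ∫ ω, (Complex.exp (z * ζ ω) -
      ∑ m ∈ Finset.range 3, (z * ζ ω) ^ m / m.factorial) ∂P := by
    have : ∀ ω, Complex.exp (z * ζ ω) - ∑ m ∈ Finset.range 3, (z * ζ ω) ^ m / m.factorial
      = ((Complex.exp (z * ζ ω) - 1) - z * (ζ ω : ℂ)) - (z ^ 2 / 2) * ((ζ ω ^ 2 : ℝ) : ℂ) := by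
      intro ω
      simp [Finset.sum_range_succ, Nat.factorial]; ring
    simp_rw [this]
    have j1 : Integrable (fun ω => Complex.exp (z * ζ ω) - 1) P :=
      (h.integrable_cexp z).sub (integrable_const 1)
    have j2 : Integrable (fun ω => Complex.exp (z * ζ ω) - 1 - z * ζ ω) P :=
      j1.sub (i1.const_mul z)
    rw [integral_sub j2 (i2.const_mul _), integral_sub j1 (i1.const_mul z),
      integral_sub (h.integrable_cexp z) (integrable_const 1),
      integral_const_mul, integral_const_mul, e1, e2]
    simp [complexMGF]
  rw [key, mul_comm, ← integral_const_mul]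
  refine norm_integral_le_of_norm_le ((h.integrable_pow_mul_exp_abs 3 M).const_mul _)
    (ae_of_all _ fun ω => ?_)
  refine (Complex.norm_exp_sub_sum_le_norm_mul_exp _ _).trans ?_
  rw [norm_mul, Complex.norm_real, Real.norm_eq_abs, mul_pow, mul_assoc]
  gcongr

lemma memLp_cexp_sub (h : IsStandardExp ζ P) (z : ℂ) :
    MemLp (fun ω => Complex.exp (z * ζ ω) - 1 - z * ζ ω) 2 P := by
  have hm := h.measurable
  refine ((?_ : MemLp _ 2 P).sub (memLp_const 1)).sub (h.memLp_two.ofReal.const_mul z)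
  rw [memLp_two_iff_integrable_sq_norm (by fun_prop)]
  refine (h.exp (2 * z.re)).congr (ae_of_all _ fun ω => ?_)
  simp [Complex.norm_exp, ← Real.exp_nat_mul]
  ring

omit [IsProbabilityMeasure P] in
lemma exists_integral_cexp_sub_le (h : IsStandardExp ζ P) (M : ℝ) :
    ∃ C, 0 ≤ C ∧ ∀ z : ℂ, ‖z‖ ≤ M →
      ∫ ω, ‖Complex.exp (z * ζ ω) - 1 - z * ζ ω‖ ^ 2 ∂P ≤ C * ‖z‖ ^ 4 := by
  refine ⟨∫ ω, |ζ ω| ^ 4 * Real.exp ((2 * M) * |ζ ω|) ∂P,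
    integral_nonneg fun ω => by positivity, fun z hz => ?_⟩
  rw [mul_comm, ← integral_const_mul]
  refine integral_mono_of_nonneg (ae_of_all _ fun ω => by positivity)
    ((h.integrable_pow_mul_exp_abs 4 (2 * M)).const_mul _) (ae_of_all _ fun ω => ?_)
  have h1 := Complex.norm_exp_sub_sum_le_norm_mul_exp (z * ζ ω) 2
  simp only [Finset.sum_range_succ, Finset.sum_range_zero, zero_add, pow_zero, Nat.factorial_zero,
    Nat.cast_one, div_one, pow_one, Nat.factorial_one] at h1
  rw [← sub_sub, norm_mul, Complex.norm_real, Real.norm_eq_abs] at h1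
  calc ‖Complex.exp (z * ζ ω) - 1 - z * ζ ω‖ ^ 2
      ≤ ((‖z‖ * |ζ ω|) ^ 2 * Real.exp (‖z‖ * |ζ ω|)) ^ 2 := by gcongr
    _ = ‖z‖ ^ 4 * (|ζ ω| ^ 4 * Real.exp ((2 * ‖z‖) * |ζ ω|)) := by
      rw [mul_pow, ← Real.exp_nat_mul]; push_cast; ring_nf
    _ ≤ ‖z‖ ^ 4 * (|ζ ω| ^ 4 * Real.exp (2 * M * |ζ ω|)) := by gcongr

end IsStandardExp

/-- The normalised exponential `e^{za} / φ(z)`. -/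
def site (φ : ℂ → ℂ) (z : ℂ) (a : ℝ) : ℂ := Complex.exp (z * a) / φ z

/-- The nonlinear part of the normalised exponential. -/
def resid (φ : ℂ → ℂ) (z : ℂ) (a : ℝ) : ℂ := site φ z a - 1 - z * a

lemma continuous_site (φ : ℂ → ℂ) (z : ℂ) : Continuous (site φ z) := by
  unfold site; fun_prop

lemma continuous_resid (φ : ℂ → ℂ) (z : ℂ) : Continuous (resid φ z) := by
  unfold resid; have := continuous_site φ z; fun_prop

variable [IsProbabilityMeasure P] {ζ : Ω → ℝ}

/-- Uniform estimates for the normalised exponentials with exponents in a set `D`. -/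
structure SiteBounds (ζ : Ω → ℝ) (P : Measure Ω) (D : Set ℂ) (C : ℝ) : Prop where
  nonneg : 0 ≤ C
  ne_zero : ∀ z ∈ D, complexMGF ζ P z ≠ 0
  lower : ∀ z ∈ D, Real.exp ((z ^ 2).re / 2 - C * ‖z‖ ^ 3) ≤ ‖complexMGF ζ P z‖
  resid_sq : ∀ z ∈ D, ∫ ω, ‖resid (complexMGF ζ P) z (ζ ω)‖ ^ 2 ∂P ≤ C * ‖z‖ ^ 4
  site_sq : ∀ z ∈ D, ∫ ω, ‖site (complexMGF ζ P) z (ζ ω)‖ ^ 2 ∂P ≤ Real.exp (C * ‖z‖ ^ 2)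

namespace IsStandardExp

lemma memLp_site (h : IsStandardExp ζ P) (φ : ℂ → ℂ) (z : ℂ) :
    MemLp (fun ω => site φ z (ζ ω)) 2 P := by
  have := ((h.memLp_cexp_sub z).add (memLp_const 1)).add (h.memLp_two.ofReal.const_mul z)
  refine (this.const_mul (φ z)⁻¹).ae_eq (ae_of_all _ fun ω => ?_)
  simp [site]; ring

lemma memLp_resid (h : IsStandardExp ζ P) (φ : ℂ → ℂ) (z : ℂ) :
    MemLp (fun ω => resid φ z (ζ ω)) 2 P :=
  ((h.memLp_site φ z).sub (memLp_const 1)).sub (h.memLp_two.ofReal.const_mul z)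

omit [IsProbabilityMeasure P] in
lemma integral_site {z : ℂ} (hz : complexMGF ζ P z ≠ 0) :
    ∫ ω, site (complexMGF ζ P) z (ζ ω) ∂P = 1 := by
  simp only [site]
  rw [integral_div]
  exact div_self hz

omit [IsProbabilityMeasure P] in
lemma integral_ofReal_eq_zero (h : IsStandardExp ζ P) : ∫ ω, (ζ ω : ℂ) ∂P = 0 := by
  rw [integral_complex_ofReal, h.mean]; simp

lemma integral_resid (h : IsStandardExp ζ P) {z : ℂ} (hz : complexMGF ζ P z ≠ 0) :
    ∫ ω, resid (complexMGF ζ P) z (ζ ω) ∂P = 0 := by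
  simp only [resid]
  have i := (h.memLp_site (complexMGF ζ P) z).integrable (by norm_num)
  have j : Integrable (fun ω => site (complexMGF ζ P) z (ζ ω) - 1) P := i.sub (integrable_const 1)
  rw [integral_sub j (h.integrable_ofReal.const_mul z),
    integral_sub i (integrable_const 1), integral_site hz, integral_const_mul]
  rw [h.integral_ofReal_eq_zero]; simp

/-- Upper bound for the moment generating function. -/
lemma exists_mgf_le (h : IsStandardExp ζ P) (M : ℝ) :
    ∃ C, 0 ≤ C ∧ ∀ t : ℝ, |t| ≤ M → mgf ζ P t ≤ Real.exp (t ^ 2 / 2 + C * |t| ^ 3) := by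
  obtain ⟨C, hC, h1⟩ := h.exists_norm_complexMGF_sub_le M
  refine ⟨C, hC, fun t ht => ?_⟩
  have h2 := h1 t (by simpa using ht)
  rw [complexMGF_ofReal] at h2
  have h3 : mgf ζ P t - 1 - t ^ 2 / 2 ≤ C * |t| ^ 3 := by
    refine (le_abs_self _).trans ?_
    rw [← Real.norm_eq_abs, ← Complex.norm_real]
    simpa using h2
  linarith [Real.add_one_le_exp (t ^ 2 / 2 + C * |t| ^ 3)]

/-- The generating function and e^{z²/2} differ by O(|z|³) on bounded sets, and the latter has
modulus e^{Re(z²)/2}. The lower bound `c` turns this additive error into a multiplicative one, and 1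
+ x ≤ e^x moves it into the exponent. -/
lemma exists_exp_le_norm_complexMGF (h : IsStandardExp ζ P) {D : Set ℂ} {M c : ℝ} (hM0 : 0 ≤ M)
    (hM : ∀ z ∈ D, ‖z‖ ≤ M) (hc : 0 < c) (hD : ∀ z ∈ D, c ≤ ‖complexMGF ζ P z‖) :
    ∃ K, 0 ≤ K ∧ ∀ z ∈ D,
      Real.exp ((z ^ 2).re / 2 - K * ‖z‖ ^ 3) ≤ ‖complexMGF ζ P z‖ := by
  obtain ⟨C₁, hC₁, h1⟩ := h.exists_norm_complexMGF_sub_le M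
  refine ⟨(C₁ + M * Real.exp (M ^ 2)) / c, by positivity, fun z hz => ?_⟩
  have hz' := hM z hz
  have e1 := Complex.norm_exp_sub_sum_le_norm_mul_exp (z ^ 2 / 2) 2
  simp only [Finset.sum_range_succ, Finset.sum_range_zero, zero_add, pow_zero,
    Nat.factorial_zero, Nat.cast_one, div_one, pow_one, Nat.factorial_one] at e1
  have e2 : ‖z ^ 2 / 2‖ = ‖z‖ ^ 2 / 2 := by simp
  rw [e2] at e1
  have e3 : (‖z‖ ^ 2 / 2) ^ 2 * Real.exp (‖z‖ ^ 2 / 2) ≤ M * Real.exp (M ^ 2) * ‖z‖ ^ 3 := by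
    have : (‖z‖ ^ 2 / 2) ^ 2 ≤ M * ‖z‖ ^ 3 := by
      calc (‖z‖ ^ 2 / 2) ^ 2 = ‖z‖ * ‖z‖ ^ 3 / 4 := by ring
        _ ≤ ‖z‖ * ‖z‖ ^ 3 := by
          have : 0 ≤ ‖z‖ * ‖z‖ ^ 3 := by positivity
          linarith
        _ ≤ M * ‖z‖ ^ 3 := by gcongr
    calc _ ≤ M * ‖z‖ ^ 3 * Real.exp (M ^ 2) := by
          gcongr
          have : ‖z‖ ^ 2 ≤ M ^ 2 := by gcongr
          linarith [sq_nonneg ‖z‖]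
      _ = _ := by ring
  have e4 : ‖Complex.exp (z ^ 2 / 2)‖ = Real.exp ((z ^ 2).re / 2) := by
    rw [Complex.norm_exp]; simp
  have e5 : Real.exp ((z ^ 2).re / 2) ≤ ‖complexMGF ζ P z‖ + (C₁ + M * Real.exp (M ^ 2)) * ‖z‖ ^ 3 := by
    rw [← e4]
    have : Complex.exp (z ^ 2 / 2) = complexMGF ζ P z + ((Complex.exp (z ^ 2 / 2) - (1 + z ^ 2 / 2)) -
      (complexMGF ζ P z - 1 - z ^ 2 / 2)) := by ring
    rw [this]
    refine (norm_add_le _ _).trans ?_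
    have := norm_sub_le (Complex.exp (z ^ 2 / 2) - (1 + z ^ 2 / 2)) (complexMGF ζ P z - 1 - z ^ 2 / 2)
    nlinarith [h1 z hz']
  have e6 : (C₁ + M * Real.exp (M ^ 2)) * ‖z‖ ^ 3 ≤
      ‖complexMGF ζ P z‖ * ((C₁ + M * Real.exp (M ^ 2)) / c * ‖z‖ ^ 3) := by
    calc _ = c * ((C₁ + M * Real.exp (M ^ 2)) / c * ‖z‖ ^ 3) := by field_simp
      _ ≤ _ := by gcongr; exact hD z hz
  rw [Real.exp_sub, div_le_iff₀ (Real.exp_pos _)]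
  calc _ ≤ ‖complexMGF ζ P z‖ * ((C₁ + M * Real.exp (M ^ 2)) / c * ‖z‖ ^ 3 + 1) := by linarith
    _ ≤ _ := by gcongr; exact Real.add_one_le_exp _

lemma memLp_one_add_mul (h : IsStandardExp ζ P) (z : ℂ) :
    MemLp (fun ω => 1 + z * (ζ ω : ℂ)) 2 P := by
  have h1 : MemLp (fun ω => z * (ζ ω : ℂ)) 2 P := h.memLp_two.ofReal.const_mul z
  have h2 : MemLp (fun _ : Ω => (1 : ℂ)) 2 P := memLp_const 1
  exact h2.add h1

/-- The remainder times φ(z) is (e^{zζ} - 1 - zζ) + (1 - φ(z))(1 + zζ). Both terms are of order |z|²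
in L², the second because ζ is centered. -/
lemma exists_integral_resid_sq_le (h : IsStandardExp ζ P) {D : Set ℂ} {M c : ℝ} (hM0 : 0 ≤ M)
    (hM : ∀ z ∈ D, ‖z‖ ≤ M) (hc : 0 < c) (hD : ∀ z ∈ D, c ≤ ‖complexMGF ζ P z‖) :
    ∃ K, 0 ≤ K ∧ ∀ z ∈ D,
      ∫ ω, ‖resid (complexMGF ζ P) z (ζ ω)‖ ^ 2 ∂P ≤ K * ‖z‖ ^ 4 := by
  obtain ⟨C₁, hC₁, h1⟩ := h.exists_norm_complexMGF_sub_le M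
  obtain ⟨C₂, hC₂, h2⟩ := h.exists_integral_cexp_sub_le M
  have hne : ∀ z ∈ D, complexMGF ζ P z ≠ 0 := fun z hz => norm_pos_iff.1 (hc.trans_le (hD z hz))
  refine ⟨(2 * C₂ + 2 * ((1 / 2 + C₁ * M) ^ 2 * (2 + 2 * M ^ 2))) / c ^ 2, by positivity,
    fun z hz => ?_⟩
  have hz' := hM z hz
  have d1 : ‖1 - complexMGF ζ P z‖ ≤ (1 / 2 + C₁ * M) * ‖z‖ ^ 2 := by
    have : 1 - complexMGF ζ P z = -(complexMGF ζ P z - 1 - z ^ 2 / 2) - z ^ 2 / 2 := by ring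
    rw [this]
    refine (norm_sub_le _ _).trans ?_
    rw [norm_neg]
    have e2 : ‖z ^ 2 / 2‖ = ‖z‖ ^ 2 / 2 := by simp
    have : C₁ * ‖z‖ ^ 3 ≤ C₁ * M * ‖z‖ ^ 2 := by
      calc C₁ * ‖z‖ ^ 3 = C₁ * ‖z‖ * ‖z‖ ^ 2 := by ring
        _ ≤ _ := by gcongr
    linarith [h1 z hz']
  have iu := (h.memLp_cexp_sub z).integrable_sq_norm
  have hlin := h.memLp_one_add_mul z
  have il := hlin.integrable_sq_norm
  have hlb : ∫ ω, ‖1 + z * (ζ ω : ℂ)‖ ^ 2 ∂P ≤ 2 + 2 * M ^ 2 := by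
    have : ∫ ω, ‖1 + z * (ζ ω : ℂ)‖ ^ 2 ∂P ≤ ∫ ω, (2 + 2 * ‖z‖ ^ 2 * ζ ω ^ 2) ∂P := by
      refine integral_mono il ((integrable_const 2).add (h.integrable_sq.const_mul _)) fun ω => ?_
      have := norm_add_le 1 (z * (ζ ω : ℂ))
      rw [norm_mul, Complex.norm_real, norm_one] at this
      have h3 : ‖ζ ω‖ ^ 2 = ζ ω ^ 2 := by simp
      simp only
      rw [← h3]
      nlinarith [norm_nonneg (1 + z * (ζ ω : ℂ)), sq_nonneg (1 - ‖z‖ * ‖ζ ω‖)]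
    rw [integral_add (integrable_const 2) (h.integrable_sq.const_mul _), integral_const_mul,
      h.var] at this
    simp only [integral_const, probReal_univ, smul_eq_mul, one_mul, mul_one] at this
    have : ‖z‖ ^ 2 ≤ M ^ 2 := by gcongr
    linarith
  have pt : ∀ ω, ‖resid (complexMGF ζ P) z (ζ ω)‖ ^ 2 ≤
      (2 * ‖Complex.exp (z * ζ ω) - 1 - z * ζ ω‖ ^ 2 +
        2 * ‖1 - complexMGF ζ P z‖ ^ 2 * ‖1 + z * (ζ ω : ℂ)‖ ^ 2) / c ^ 2 := by
    intro ω
    have : resid (complexMGF ζ P) z (ζ ω) = ((Complex.exp (z * ζ ω) - 1 - z * ζ ω) +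
        (1 - complexMGF ζ P z) * (1 + z * (ζ ω : ℂ))) / complexMGF ζ P z := by
      have := hne z hz
      simp only [resid, site]; field_simp; ring
    rw [this, norm_div, div_pow]
    gcongr
    · refine (pow_le_pow_left₀ (norm_nonneg _) (norm_add_le _ _) 2).trans ?_
      rw [norm_mul]
      nlinarith [sq_nonneg (‖Complex.exp (z * ζ ω) - 1 - z * ζ ω‖ -
        ‖1 - complexMGF ζ P z‖ * ‖1 + z * (ζ ω : ℂ)‖)]
    · exact hD z hz
  have ju : Integrable (fun ω => 2 * ‖Complex.exp (z * ζ ω) - 1 - z * ζ ω‖ ^ 2) P := iu.const_mul 2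
  have jl : Integrable (fun ω => 2 * ‖1 - complexMGF ζ P z‖ ^ 2 * ‖1 + z * (ζ ω : ℂ)‖ ^ 2) P :=
    il.const_mul _
  have jr : Integrable (fun ω => ‖resid (complexMGF ζ P) z (ζ ω)‖ ^ 2) P :=
    (h.memLp_resid (complexMGF ζ P) z).integrable_sq_norm
  have := integral_mono jr ((ju.add jl).div_const (c ^ 2)) pt
  refine this.trans ?_
  simp only [Pi.add_apply]
  rw [integral_div, integral_add ju jl, integral_const_mul, integral_const_mul, div_mul_eq_mul_div]
  refine div_le_div_of_nonneg_right ?_ (by positivity)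
  have := h2 z hz'
  calc _ ≤ 2 * (C₂ * ‖z‖ ^ 4) + 2 * ((1 / 2 + C₁ * M) * ‖z‖ ^ 2) ^ 2 * (2 + 2 * M ^ 2) := by
        gcongr
    _ = _ := by ring

/-- The normalised exponential has mean one, so its second moment is one plus that of its centered
part zζ + `resid`, which is O(|z|²). -/
lemma exists_integral_site_sq_le (h : IsStandardExp ζ P) {D : Set ℂ} {M K₂ : ℝ}
    (hM : ∀ z ∈ D, ‖z‖ ≤ M) (hne : ∀ z ∈ D, complexMGF ζ P z ≠ 0) (hK₂ : 0 ≤ K₂)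
    (hres : ∀ z ∈ D, ∫ ω, ‖resid (complexMGF ζ P) z (ζ ω)‖ ^ 2 ∂P ≤ K₂ * ‖z‖ ^ 4) :
    ∃ K, 0 ≤ K ∧ ∀ z ∈ D,
      ∫ ω, ‖site (complexMGF ζ P) z (ζ ω)‖ ^ 2 ∂P ≤ Real.exp (K * ‖z‖ ^ 2) := by
  refine ⟨2 + 2 * K₂ * M ^ 2, by positivity, fun z hz => ?_⟩
  have hz' := hM z hz
  have m1 : MemLp (fun ω => site (complexMGF ζ P) z (ζ ω) - 1) 2 P := (h.memLp_site (complexMGF ζ P) z).sub (memLp_const 1)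
  have i1 := m1.integrable (by norm_num)
  have i2 := m1.integrable_sq_norm
  have i3 := (h.memLp_resid (complexMGF ζ P) z).integrable_sq_norm
  have e : ∫ ω, ‖site (complexMGF ζ P) z (ζ ω)‖ ^ 2 ∂P = 1 + ∫ ω, ‖site (complexMGF ζ P) z (ζ ω) - 1‖ ^ 2 ∂P := by
    have : ∀ ω, ‖site (complexMGF ζ P) z (ζ ω)‖ ^ 2 =
        1 + 2 * (site (complexMGF ζ P) z (ζ ω) - 1).re + ‖site (complexMGF ζ P) z (ζ ω) - 1‖ ^ 2 := by
      intro ω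
      rw [Complex.sq_norm, Complex.sq_norm, Complex.normSq_apply, Complex.normSq_apply]
      simp; ring
    simp_rw [this]
    have j1 : Integrable (fun ω => 2 * (site (complexMGF ζ P) z (ζ ω) - 1).re) P := i1.re.const_mul 2
    have j2 : Integrable (fun ω => 1 + 2 * (site (complexMGF ζ P) z (ζ ω) - 1).re) P :=
      (integrable_const 1).add j1
    have e0 : ∫ ω, (site (complexMGF ζ P) z (ζ ω) - 1) ∂P = 0 := by
      rw [integral_sub ((h.memLp_site (complexMGF ζ P) z).integrable (by norm_num)) (integrable_const 1),
        integral_site (hne z hz)]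
      simp
    have e1 : ∫ ω, (site (complexMGF ζ P) z (ζ ω) - 1).re ∂P = 0 := by
      have := integral_re i1
      rw [e0] at this
      simpa using this
    rw [integral_add j2 i2, integral_add (integrable_const 1) j1, integral_const_mul, e1]
    simp
  have e2 : ∫ ω, ‖site (complexMGF ζ P) z (ζ ω) - 1‖ ^ 2 ∂P ≤
      ∫ ω, (2 * ‖z‖ ^ 2 * ζ ω ^ 2 + 2 * ‖resid (complexMGF ζ P) z (ζ ω)‖ ^ 2) ∂P := by
    refine integral_mono i2 ((h.integrable_sq.const_mul _).add (i3.const_mul 2)) fun ω => ?_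
    have : site (complexMGF ζ P) z (ζ ω) - 1 = z * ζ ω + resid (complexMGF ζ P) z (ζ ω) := by simp [resid]
    simp only
    rw [this]
    refine (pow_le_pow_left₀ (norm_nonneg _) (norm_add_le _ _) 2).trans ?_
    rw [norm_mul, Complex.norm_real]
    have h3 : ‖ζ ω‖ ^ 2 = ζ ω ^ 2 := by simp
    rw [← h3]
    nlinarith [sq_nonneg (‖z‖ * ‖ζ ω‖ - ‖resid (complexMGF ζ P) z (ζ ω)‖)]
  rw [integral_add (h.integrable_sq.const_mul _) (i3.const_mul 2), integral_const_mul,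
    integral_const_mul, h.var] at e2
  have e3 := hres z hz
  have e4 : 2 * (K₂ * ‖z‖ ^ 4) ≤ 2 * K₂ * M ^ 2 * ‖z‖ ^ 2 := by
    calc 2 * (K₂ * ‖z‖ ^ 4) = 2 * K₂ * ‖z‖ ^ 2 * ‖z‖ ^ 2 := by ring
      _ ≤ _ := by gcongr
  have := Real.add_one_le_exp ((2 + 2 * K₂ * M ^ 2) * ‖z‖ ^ 2)
  rw [e]
  nlinarith

lemma exists_siteBounds (h : IsStandardExp ζ P) {D : Set ℂ} {M c : ℝ} (hM0 : 0 ≤ M)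
    (hM : ∀ z ∈ D, ‖z‖ ≤ M) (hc : 0 < c) (hD : ∀ z ∈ D, c ≤ ‖complexMGF ζ P z‖) :
    ∃ C, SiteBounds ζ P D C := by
  have hne : ∀ z ∈ D, complexMGF ζ P z ≠ 0 := fun z hz => norm_pos_iff.1 (hc.trans_le (hD z hz))
  obtain ⟨K₁, hK₁, hlow⟩ := h.exists_exp_le_norm_complexMGF hM0 hM hc hD
  obtain ⟨K₂, hK₂, hres⟩ := h.exists_integral_resid_sq_le hM0 hM hc hD
  obtain ⟨K₃, hK₃, hsite⟩ := h.exists_integral_site_sq_le hM hne hK₂ hres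
  refine ⟨K₁ + K₂ + K₃, by positivity, hne, fun z hz => ?_, fun z hz => ?_, fun z hz => ?_⟩
  · refine le_trans ?_ (hlow z hz)
    gcongr; linarith
  · refine (hres z hz).trans ?_
    gcongr; linarith
  · refine (hsite z hz).trans ?_
    gcongr; linarith

end IsStandardExp

end SingleVariable


/-! ### Products and martingale transforms of independent square integrable variables. -/

section Independence

variable {Ω : Type*} {mΩ : MeasurableSpace Ω} {P : Measure Ω}

/-- The σ-algebra generated by the `m k`, `k ∈ S`. -/
abbrev sigmaOn (m : ℕ → MeasurableSpace Ω) (S : Set ℕ) : MeasurableSpace Ω := ⨆ k ∈ S, m k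

lemma sigmaOn_mono (m : ℕ → MeasurableSpace Ω) {S T : Set ℕ} (h : S ⊆ T) :
    sigmaOn m S ≤ sigmaOn m T := biSup_mono h

lemma le_sigmaOn (m : ℕ → MeasurableSpace Ω) {S : Set ℕ} {k : ℕ} (hk : k ∈ S) :
    m k ≤ sigmaOn m S := le_biSup m hk

lemma sigmaOn_le {m : ℕ → MeasurableSpace Ω} (hm : ∀ k, m k ≤ mΩ) (S : Set ℕ) :
    sigmaOn m S ≤ mΩ := iSup₂_le fun k _ => hm k

/-- `f` is square integrable and depends only on the σ-algebras `m k`, `k ∈ S`. -/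
structure L2On (m : ℕ → MeasurableSpace Ω) (P : Measure Ω) (S : Set ℕ) (f : Ω → ℂ) : Prop where
  meas : Measurable[sigmaOn m S] f
  memLp : MemLp f 2 P

variable {m : ℕ → MeasurableSpace Ω} {S T : Set ℕ} {f g : Ω → ℂ}

lemma L2On.mono (hf : L2On m P S f) (h : S ⊆ T) : L2On m P T f :=
  ⟨hf.meas.mono (sigmaOn_mono m h) le_rfl, hf.memLp⟩

lemma L2On.add (hf : L2On m P S f) (hg : L2On m P S g) : L2On m P S (fun ω => f ω + g ω) :=
  ⟨hf.meas.add hg.meas, hf.memLp.add hg.memLp⟩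

lemma L2On.const [IsFiniteMeasure P] (c : ℂ) : L2On m P S (fun _ => c) :=
  ⟨measurable_const, memLp_const c⟩

lemma L2On.integrable [IsFiniteMeasure P] (hf : L2On m P S f) : Integrable f P :=
  hf.memLp.integrable (by norm_num)

lemma L2On.star (hf : L2On m P S f) : L2On m P S (fun ω => starRingEnd ℂ (f ω)) :=
  ⟨(Complex.continuous_conj.measurable).comp hf.meas, hf.memLp.star⟩

lemma L2On.integrable_mul (hf : L2On m P S f) (hg : L2On m P T g) :
    Integrable (fun ω => f ω * g ω) P := hf.memLp.integrable_mul hg.memLp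

lemma L2On.sum [IsFiniteMeasure P] {ι : Type*} {s : Finset ι} {F : ι → Ω → ℂ}
    (hF : ∀ i ∈ s, L2On m P S (F i)) : L2On m P S (fun ω => ∑ i ∈ s, F i ω) := by
  classical
  induction s using Finset.induction_on with
  | empty => simpa using L2On.const 0
  | insert a s ha ih =>
    simp_rw [Finset.sum_insert ha]
    exact (hF a (by simp)).add (ih fun i hi => hF i (by simp [hi]))

variable (hm : ∀ k, m k ≤ mΩ) (hi : iIndep m P)

include hm hi

lemma indepFun_of_disjoint {β γ : Type*} [MeasurableSpace β] [MeasurableSpace γ]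
    {f : Ω → β} {g : Ω → γ} (hST : Disjoint S T) (hf : Measurable[sigmaOn m S] f)
    (hg : Measurable[sigmaOn m T] g) : IndepFun f g P := by
  rw [IndepFun_iff_Indep]
  exact indep_of_indep_of_le (indep_iSup_of_disjoint hm hi hST)
    (measurable_iff_comap_le.1 hf) (measurable_iff_comap_le.1 hg)

lemma integral_mul_of_disjoint (hST : Disjoint S T) (hf : Measurable[sigmaOn m S] f)
    (hg : Measurable[sigmaOn m T] g) :
    ∫ ω, f ω * g ω ∂P = (∫ ω, f ω ∂P) * ∫ ω, g ω ∂P :=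
  (indepFun_of_disjoint hm hi hST hf hg).integral_fun_mul_eq_mul_integral
    (hf.mono (sigmaOn_le hm S) le_rfl).aestronglyMeasurable
    (hg.mono (sigmaOn_le hm T) le_rfl).aestronglyMeasurable

lemma integral_sq_norm_mul_of_disjoint (hST : Disjoint S T) (hf : Measurable[sigmaOn m S] f)
    (hg : Measurable[sigmaOn m T] g) :
    ∫ ω, ‖f ω * g ω‖ ^ 2 ∂P = (∫ ω, ‖f ω‖ ^ 2 ∂P) * ∫ ω, ‖g ω‖ ^ 2 ∂P := by
  have hφ : Measurable fun z : ℂ => ‖z‖ ^ 2 := by fun_prop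
  simp_rw [norm_mul, mul_pow]
  have h := indepFun_of_disjoint hm hi hST (hφ.comp hf) (hφ.comp hg)
  exact h.integral_fun_mul_eq_mul_integral
    ((hφ.comp hf).mono (sigmaOn_le hm S) le_rfl).aestronglyMeasurable
    ((hφ.comp hg).mono (sigmaOn_le hm T) le_rfl).aestronglyMeasurable

lemma L2On.mul (hST : Disjoint S T) (hf : L2On m P S f) (hg : L2On m P T g) :
    L2On m P (S ∪ T) (fun ω => f ω * g ω) := by
  have hφ : Measurable fun z : ℂ => ‖z‖ ^ 2 := by fun_prop
  have hfm := hf.meas.mono (sigmaOn_mono m (Set.subset_union_left (t := T))) le_rfl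
  have hgm := hg.meas.mono (sigmaOn_mono m (Set.subset_union_right (s := S))) le_rfl
  refine ⟨hfm.mul hgm, ?_⟩
  refine (memLp_two_iff_integrable_sq_norm
    ((hfm.mul hgm).mono (sigmaOn_le hm _) le_rfl).aestronglyMeasurable).2 ?_
  simp only [Pi.mul_apply]
  simp_rw [norm_mul, mul_pow]
  exact (indepFun_of_disjoint hm hi hST (hφ.comp hf.meas) (hφ.comp hg.meas)).integrable_mul
    hf.memLp.integrable_sq_norm hg.memLp.integrable_sq_norm

variable [IsProbabilityMeasure P]

lemma L2On.prod {ι : Type*} {s : Finset ι} {R : ι → Set ℕ} {F : ι → Ω → ℂ}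
    (hR : (s : Set ι).PairwiseDisjoint R) (hF : ∀ i ∈ s, L2On m P (R i) (F i)) :
    L2On m P (⋃ i ∈ s, R i) (fun ω => ∏ i ∈ s, F i ω) ∧
      ∫ ω, ‖∏ i ∈ s, F i ω‖ ^ 2 ∂P = ∏ i ∈ s, ∫ ω, ‖F i ω‖ ^ 2 ∂P := by
  classical
  induction s using Finset.induction_on with
  | empty => exact ⟨by simpa using L2On.const 1, by simp⟩
  | insert a s ha ih =>
    obtain ⟨h1, h2⟩ := ih (hR.subset (by simp)) fun i hi => hF i (by simp [hi])
    have h3 := hF a (by simp)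
    have hd : Disjoint (R a) (⋃ i ∈ s, R i) := by
      rw [Set.disjoint_iUnion₂_right]
      intro i hi
      exact hR (by simp) (by simp [hi]) (fun h => ha (h ▸ hi))
    simp_rw [Finset.prod_insert ha]
    refine ⟨?_, ?_⟩
    · rw [Finset.set_biUnion_insert]
      exact L2On.mul hm hi hd h3 h1
    · rw [integral_sq_norm_mul_of_disjoint hm hi hd h3.meas h1.meas, h2]

lemma L2On.prod_Ico {F : ℕ → Ω → ℂ} (hF : ∀ i, L2On m P {i} (F i)) (a b : ℕ) :
    L2On m P (Set.Ico a b) (fun ω => ∏ i ∈ Finset.Ico a b, F i ω) ∧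
      ∫ ω, ‖∏ i ∈ Finset.Ico a b, F i ω‖ ^ 2 ∂P = ∏ i ∈ Finset.Ico a b, ∫ ω, ‖F i ω‖ ^ 2 ∂P := by
  have := L2On.prod hm hi (s := Finset.Ico a b) (R := fun i => {i}) (F := F)
    (fun i _ j _ h => by simpa using h) fun i _ => hF i
  refine ⟨this.1.mono ?_, this.2⟩
  intro x; simp

lemma integral_finset_prod_of_iIndep {F : ℕ → Ω → ℂ} (hF : ∀ i, Measurable[m i] (F i))
    (s : Finset ℕ) : ∫ ω, ∏ i ∈ s, F i ω ∂P = ∏ i ∈ s, ∫ ω, F i ω ∂P := by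
  classical
  induction s using Finset.induction_on with
  | empty => simp
  | insert a s ha ih =>
    simp_rw [Finset.prod_insert ha]
    rw [← ih]
    refine integral_mul_of_disjoint hm hi (S := {a}) (T := s) (by simpa using ha)
      ((hF a).mono (le_sigmaOn m rfl) le_rfl) ?_
    exact Finset.measurable_prod _ fun i hi => (hF i).mono (le_sigmaOn m hi) le_rfl

omit [IsProbabilityMeasure P] in
lemma lintegral_finset_prod_of_iIndep {F : ℕ → Ω → ENNReal} (hF : ∀ i, Measurable[m i] (F i))
    (s : Finset ℕ) : ∫⁻ ω, ∏ i ∈ s, F i ω ∂P = ∏ i ∈ s, ∫⁻ ω, F i ω ∂P := by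
  refine lintegral_prod_eq_prod_lintegral_of_indepFun s F ?_ fun i => (hF i).mono (hm i) le_rfl
  rw [iIndepFun_iff_iIndep]
  exact iIndep_of_iIndep_of_le hi fun i => measurable_iff_comap_le.1 (hF i)

/-- Orthogonality of the increments of a martingale transform. -/
lemma integral_transform_mul_conj {ξ ξ' v v' : ℕ → Ω → ℂ}
    (hξ : ∀ k, L2On m P {k} (ξ k)) (hξ' : ∀ k, L2On m P {k} (ξ' k))
    (hv : ∀ k, L2On m P {k} (v k)) (hv' : ∀ k, L2On m P {k} (v' k))
    (h0 : ∀ k, ∫ ω, v k ω ∂P = 0) (h0' : ∀ k, ∫ ω, v' k ω ∂P = 0) (a b : ℕ) :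
    ∫ ω, (∑ k ∈ Finset.Ico a b, (∏ i ∈ Finset.Ico a k, ξ i ω) * v k ω) *
        starRingEnd ℂ (∑ k ∈ Finset.Ico a b, (∏ i ∈ Finset.Ico a k, ξ' i ω) * v' k ω) ∂P =
      ∑ k ∈ Finset.Ico a b,
        (∫ ω, (∏ i ∈ Finset.Ico a k, ξ i ω) *
          starRingEnd ℂ (∏ i ∈ Finset.Ico a k, ξ' i ω) ∂P) *
        ∫ ω, v k ω * starRingEnd ℂ (v' k ω) ∂P := by
  rcases le_or_gt b a with hab | hab
  · simp [Finset.Ico_eq_empty_of_le hab]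
  have hU : ∀ {ξ v : ℕ → Ω → ℂ} (_ : ∀ k, L2On m P {k} (ξ k)) (_ : ∀ k, L2On m P {k} (v k))
      (n : ℕ), L2On m P (Set.Ico a n)
        (fun ω => ∑ k ∈ Finset.Ico a n, (∏ i ∈ Finset.Ico a k, ξ i ω) * v k ω) := by
    intro ξ v hξ hv n
    refine L2On.sum fun k hk => ?_
    simp only [Finset.mem_Ico] at hk
    refine (L2On.mul hm hi ?_ (L2On.prod_Ico hm hi hξ a k).1 (hv k)).mono ?_
    · simp
    · intro x
      simp only [Set.union_singleton, Set.mem_insert_iff, Set.mem_Ico]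
      omega
  induction b, hab.le using Nat.le_induction with
  | base => simp
  | succ n hn ih =>
    rcases hn.eq_or_lt with rfl | hn'
    · simp
    have ih := ih hn'
    simp_rw [Finset.sum_Ico_succ_top hn]
    rw [← ih]
    have hd : Disjoint (Set.Ico a n) ({n} : Set ℕ) := by simp
    have A := hU hξ hv n
    have A' := (hU hξ' hv' n).star
    have B := (L2On.prod_Ico hm hi hξ a n).1
    have B' := (L2On.prod_Ico hm hi hξ' a n).1.star
    have V := hv n
    have V' := (hv' n).star
    have BV := L2On.mul hm hi hd B V
    have BV' := L2On.mul hm hi hd B' V'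
    have e0' : ∫ ω, starRingEnd ℂ (v' n ω) ∂P = 0 := by rw [integral_conj, h0']; simp
    set U : Ω → ℂ := fun ω => ∑ k ∈ Finset.Ico a n, (∏ i ∈ Finset.Ico a k, ξ i ω) * v k ω
    set U' : Ω → ℂ := fun ω => starRingEnd ℂ
      (∑ k ∈ Finset.Ico a n, (∏ i ∈ Finset.Ico a k, ξ' i ω) * v' k ω)
    set X : Ω → ℂ := fun ω => ∏ i ∈ Finset.Ico a n, ξ i ω
    set X' : Ω → ℂ := fun ω => starRingEnd ℂ (∏ i ∈ Finset.Ico a n, ξ' i ω)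
    -- The cross terms vanish: each contains one increment of index `n`, centered and independent of
    -- everything with smaller index. Only the diagonal term e3 survives.
    have e1 : ∫ ω, (U ω * X' ω) * starRingEnd ℂ (v' n ω) ∂P = 0 :=
      (integral_mul_of_disjoint hm hi hd (A.meas.mul B'.meas) V'.meas).trans (by rw [e0', mul_zero])
    have e2 : ∫ ω, (X ω * U' ω) * v n ω ∂P = 0 :=
      (integral_mul_of_disjoint hm hi hd (B.meas.mul A'.meas) V.meas).trans (by rw [h0, mul_zero])
    have e3 : ∫ ω, (X ω * X' ω) * (v n ω * starRingEnd ℂ (v' n ω)) ∂P =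
        (∫ ω, X ω * X' ω ∂P) * ∫ ω, v n ω * starRingEnd ℂ (v' n ω) ∂P :=
      integral_mul_of_disjoint hm hi hd (B.meas.mul B'.meas) (V.meas.mul V'.meas)
    have i0 : Integrable (fun ω => U ω * U' ω) P := A.integrable_mul A'
    have i1 : Integrable (fun ω => (U ω * X' ω) * starRingEnd ℂ (v' n ω)) P := by
      simpa only [mul_assoc] using! A.integrable_mul BV'
    have i2 : Integrable (fun ω => (X ω * U' ω) * v n ω) P := by
      have := BV.integrable_mul A'
      refine this.congr (ae_of_all _ fun ω => ?_)
      simp only; ring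
    have i3 : Integrable (fun ω => (X ω * X' ω) * (v n ω * starRingEnd ℂ (v' n ω))) P := by
      have := BV.integrable_mul BV'
      refine this.congr (ae_of_all _ fun ω => ?_)
      simp only; ring
    have : ∀ ω, (U ω + X ω * v n ω) * starRingEnd ℂ
        (∑ k ∈ Finset.Ico a n, (∏ i ∈ Finset.Ico a k, ξ' i ω) * v' k ω +
          (∏ i ∈ Finset.Ico a n, ξ' i ω) * v' n ω) =
        U ω * U' ω + (U ω * X' ω) * starRingEnd ℂ (v' n ω) + (X ω * U' ω) * v n ω +
          (X ω * X' ω) * (v n ω * starRingEnd ℂ (v' n ω)) := by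
      intro ω
      rw [map_add, map_mul]
      simp only [U', X']
      ring
    have j1 : Integrable (fun ω => U ω * U' ω + (U ω * X' ω) * starRingEnd ℂ (v' n ω)) P :=
      i0.add i1
    have j2 : Integrable (fun ω => U ω * U' ω + (U ω * X' ω) * starRingEnd ℂ (v' n ω) +
        (X ω * U' ω) * v n ω) P := j1.add i2
    rw [integral_congr_ae (ae_of_all _ this), integral_add j2 i3, integral_add j1 i2,
      integral_add i0 i1, e1, e2, e3, add_zero, add_zero]

omit hm hi [IsProbabilityMeasure P] in
/-- A Cauchy--Schwarz bound. -/
lemma norm_integral_mul_conj_le {B : ℝ} (hf : MemLp f 2 P) (hg : MemLp g 2 P)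
    (hfB : ∫ ω, ‖f ω‖ ^ 2 ∂P ≤ B) (hgB : ∫ ω, ‖g ω‖ ^ 2 ∂P ≤ B) :
    ‖∫ ω, f ω * starRingEnd ℂ (g ω) ∂P‖ ≤ B := by
  have i1 := hf.integrable_sq_norm
  have i2 := hg.integrable_sq_norm
  have h1 : ‖∫ ω, f ω * starRingEnd ℂ (g ω) ∂P‖ ≤ ∫ ω, (‖f ω‖ ^ 2 + ‖g ω‖ ^ 2) / 2 ∂P := by
    refine norm_integral_le_of_norm_le ((i1.add i2).div_const 2) (ae_of_all _ fun ω => ?_)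
    rw [norm_mul, RCLike.norm_conj]
    nlinarith [sq_nonneg (‖f ω‖ - ‖g ω‖)]
  rw [integral_div, integral_add i1 i2] at h1
  linarith

end Independence


/-! ### The block expansion of a weight and the second moments of its terms. -/

section SiteField

variable {I Ω : Type*} [TopologicalSpace I] {mΩ : MeasurableSpace Ω} {P : Measure Ω}

/-- The σ-algebra generated by the `k`-th field. -/
abbrev siteSigma (A : ℕ → I → Ω → ℝ) (k : ℕ) : MeasurableSpace Ω :=
  ⨆ x, MeasurableSpace.comap (A k x) inferInstance

/-- Independent continuous random fields all of whose one-point laws are that of `ζ`. -/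
structure IsSiteField (P : Measure Ω) (A : ℕ → I → Ω → ℝ) (ζ : Ω → ℝ) : Prop where
  std : IsStandardExp ζ P
  measurable : ∀ k x, Measurable (A k x)
  continuous : ∀ k ω, Continuous fun x => A k x ω
  indep : iIndep (siteSigma A) P
  ident : ∀ k x, IdentDistrib (A k x) ζ P P

variable {A : ℕ → I → Ω → ℝ} {ζ : Ω → ℝ}

omit [TopologicalSpace I] in
lemma measurable_siteSigma (A : ℕ → I → Ω → ℝ) (k : ℕ) (x : I) :
    Measurable[siteSigma A k] (A k x) :=
  Measurable.of_comap_le (le_iSup (fun x => MeasurableSpace.comap (A k x) inferInstance) x)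

namespace IsSiteField

lemma siteSigma_le (h : IsSiteField P A ζ) (k : ℕ) : siteSigma A k ≤ mΩ :=
  iSup_le fun x => measurable_iff_comap_le.1 (h.measurable k x)

lemma integral_comp {E : Type*} [NormedAddCommGroup E] [NormedSpace ℝ E] [MeasurableSpace E]
    [BorelSpace E] (h : IsSiteField P A ζ) {u : ℝ → E} (hu : Measurable u) (k : ℕ) (x : I) :
    ∫ ω, u (A k x ω) ∂P = ∫ ω, u (ζ ω) ∂P :=
  ((h.ident k x).comp hu).integral_eq

lemma memLp_comp {E : Type*} [NormedAddCommGroup E] [MeasurableSpace E]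
    [BorelSpace E] (h : IsSiteField P A ζ) {u : ℝ → E} (hu : Measurable u) {p : ENNReal} {k : ℕ}
    {x : I} (hp : MemLp (fun ω => u (ζ ω)) p P) : MemLp (fun ω => u (A k x ω)) p P :=
  (((h.ident k x).comp hu).memLp_iff).2 hp

lemma l2On_comp (h : IsSiteField P A ζ) {u : ℝ → ℂ} (hu : Measurable u) (k : ℕ)
    (x : I) (hp : MemLp (fun ω => u (ζ ω)) 2 P) :
    L2On (siteSigma A) P {k} (fun ω => u (A k x ω)) :=
  ⟨hu.comp ((measurable_siteSigma A k x).mono (le_sigmaOn _ rfl) le_rfl), h.memLp_comp hu hp⟩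

lemma isStandardExp (h : IsSiteField P A ζ) (k : ℕ) (x : I) : IsStandardExp (A k x) P where
  measurable := h.measurable k x
  exp s := ((((h.ident k x).comp (u := fun y => Real.exp (s * y)) (by fun_prop))).integrable_iff).2
    (h.std.exp s)
  mean := (h.integral_comp measurable_id k x).trans h.std.mean
  var := (h.integral_comp (u := fun y => y ^ 2) (by fun_prop) k x).trans h.std.var

end IsSiteField

/-- The product of the normalised exponentials with indices in `[a, b)`. -/
def weight (φ : ℂ → ℂ) (A : ℕ → I → Ω → ℝ) (z : ℕ → ℂ) (a b : ℕ) (x : I) (ω : Ω) : ℂ :=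
  ∏ i ∈ Finset.Ico a b, site φ (z i) (A i x ω)

/-- The martingale transform of the linear parts over `[a, b)`. -/
def linPart (φ : ℂ → ℂ) (A : ℕ → I → Ω → ℝ) (z : ℕ → ℂ) (a b : ℕ) (x : I) (ω : Ω) : ℂ :=
  ∑ k ∈ Finset.Ico a b, (∏ i ∈ Finset.Ico a k, site φ (z i) (A i x ω)) * (z k * A k x ω)

/-- The martingale transform of the nonlinear parts over `[a, b)`. -/
def resPart (φ : ℂ → ℂ) (A : ℕ → I → Ω → ℝ) (z : ℕ → ℂ) (a b : ℕ) (x : I) (ω : Ω) : ℂ :=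
  ∑ k ∈ Finset.Ico a b, (∏ i ∈ Finset.Ico a k, site φ (z i) (A i x ω)) *
    resid φ (z k) (A k x ω)

/-- The product of the nonlinear parts over the blocks `[n i, n (i + 1))`, `j ≤ i < J`. -/
def resProd (φ : ℂ → ℂ) (A : ℕ → I → Ω → ℝ) (z : ℕ → ℂ) (n : ℕ → ℕ) (j J : ℕ) (x : I) (ω : Ω) : ℂ :=
  ∏ i ∈ Finset.Ico j J, (1 + resPart φ A z (n i) (n (i + 1)) x ω)

/-- The factor of the past weight in the `j`-th term of the block expansion. -/
def blockTerm (φ : ℂ → ℂ) (A : ℕ → I → Ω → ℝ) (z : ℕ → ℂ) (n : ℕ → ℕ) (j J : ℕ) (x : I)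
    (ω : Ω) : ℂ :=
  linPart φ A z (n j) (n (j + 1)) x ω * resProd φ A z n (j + 1) J x ω

section Algebra

omit [TopologicalSpace I]

variable (φ : ℂ → ℂ) (A : ℕ → I → Ω → ℝ) (z : ℕ → ℂ)

/-- Telescoping: adding the index n changes the product by the product so far times `site` - 1, and
`site` - 1 is the sum of the linear term and of `resid`. -/
lemma weight_eq_add (a b : ℕ) (x : I) (ω : Ω) :
    weight φ A z a b x ω = 1 + linPart φ A z a b x ω + resPart φ A z a b x ω := by
  rcases le_or_gt b a with hab | hab
  · simp [weight, linPart, resPart, Finset.Ico_eq_empty_of_le hab]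
  induction b, hab.le using Nat.le_induction with
  | base => simp [weight, linPart, resPart]
  | succ n hn ih =>
    rcases hn.eq_or_lt with rfl | hn'
    · simp [weight, linPart, resPart, resid]
    have ih := ih hn'
    simp only [weight, linPart, resPart] at ih ⊢
    rw [Finset.sum_Ico_succ_top hn, Finset.sum_Ico_succ_top hn, Finset.prod_Ico_succ_top hn]
    have e : site φ (z n) (A n x ω) = 1 + z n * A n x ω + resid φ (z n) (A n x ω) := by
      simp [resid]
    rw [e]
    linear_combination ih

lemma weight_mul_weight {a b c : ℕ} (hab : a ≤ b) (hbc : b ≤ c) (x : I) (ω : Ω) :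
    weight φ A z a b x ω * weight φ A z b c x ω = weight φ A z a c x ω :=
  Finset.prod_Ico_consecutive _ hab hbc

/-- The block expansion of a weight. -/
lemma weight_eq_sum_blockTerm {n : ℕ → ℕ} (hn : Monotone n) (h0 : n 0 = 0) (J : ℕ) (x : I)
    (ω : Ω) : weight φ A z 0 (n J) x ω = resProd φ A z n 0 J x ω +
      ∑ j ∈ Finset.range J, weight φ A z 0 (n j) x ω * blockTerm φ A z n j J x ω := by
  induction J with
  | zero => simp [weight, resProd, h0]
  | succ J ih =>
    have e1 : ∀ j ≤ J, resProd φ A z n j (J + 1) x ω =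
        resProd φ A z n j J x ω * (1 + resPart φ A z (n J) (n (J + 1)) x ω) := fun j hj =>
      Finset.prod_Ico_succ_top hj _
    have e2 : ∑ j ∈ Finset.range J, weight φ A z 0 (n j) x ω * blockTerm φ A z n j (J + 1) x ω =
        (∑ j ∈ Finset.range J, weight φ A z 0 (n j) x ω * blockTerm φ A z n j J x ω) *
          (1 + resPart φ A z (n J) (n (J + 1)) x ω) := by
      rw [Finset.sum_mul]
      refine Finset.sum_congr rfl fun j hj => ?_
      simp only [Finset.mem_range] at hj
      simp only [blockTerm]
      rw [e1 (j + 1) hj]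
      ring
    have e3 : blockTerm φ A z n J (J + 1) x ω = linPart φ A z (n J) (n (J + 1)) x ω := by
      simp [blockTerm, resProd]
    -- The last block weight is 1 + R + L. The factor 1 + R multiplies the expansion up to J, and L
    -- times the whole past weight becomes the new term with j = J.
    rw [Finset.sum_range_succ, e1 0 (Nat.zero_le _), e2, e3,
      ← weight_mul_weight φ A z (Nat.zero_le (n J)) (hn (Nat.le_succ J)) x ω,
      weight_eq_add φ A z (n J) (n (J + 1)), ih]
    ring

end Algebra

section Continuity

variable (φ : ℂ → ℂ) (z : ℕ → ℂ)

lemma IsSiteField.continuous_weight (h : IsSiteField P A ζ) (a b : ℕ) (ω : Ω) :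
    Continuous fun x => weight φ A z a b x ω :=
  continuous_finsetProd _ fun i _ => (continuous_site φ _).comp (h.continuous i ω)

lemma IsSiteField.continuous_linPart (h : IsSiteField P A ζ) (a b : ℕ) (ω : Ω) :
    Continuous fun x => linPart φ A z a b x ω :=
  continuous_finsetSum _ fun k _ => (h.continuous_weight φ z a k ω).mul
    (continuous_const.mul (Complex.continuous_ofReal.comp (h.continuous k ω)))

lemma IsSiteField.continuous_resPart (h : IsSiteField P A ζ) (a b : ℕ) (ω : Ω) :
    Continuous fun x => resPart φ A z a b x ω :=
  continuous_finsetSum _ fun k _ => (h.continuous_weight φ z a k ω).mul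
    ((continuous_resid φ _).comp (h.continuous k ω))

lemma IsSiteField.continuous_resProd (h : IsSiteField P A ζ) (n : ℕ → ℕ) (j J : ℕ) (ω : Ω) :
    Continuous fun x => resProd φ A z n j J x ω :=
  continuous_finsetProd _ fun _ _ => continuous_const.add (h.continuous_resPart φ z _ _ ω)

lemma IsSiteField.continuous_blockTerm (h : IsSiteField P A ζ) (n : ℕ → ℕ) (j J : ℕ) (ω : Ω) :
    Continuous fun x => blockTerm φ A z n j J x ω :=
  (h.continuous_linPart φ z _ _ ω).mul (h.continuous_resProd φ z n _ _ ω)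

end Continuity

section Moments

variable [IsProbabilityMeasure P] {D : Set ℂ} {C : ℝ} {z : ℕ → ℂ}

namespace IsSiteField

variable (h : IsSiteField P A ζ)

include h

lemma l2On_site (φ : ℂ → ℂ) (z : ℂ) (k : ℕ) (x : I) :
    L2On (siteSigma A) P {k} (fun ω => site φ z (A k x ω)) :=
  h.l2On_comp (continuous_site φ z).measurable k x (h.std.memLp_site φ z)

lemma l2On_resid (φ : ℂ → ℂ) (z : ℂ) (k : ℕ) (x : I) :
    L2On (siteSigma A) P {k} (fun ω => resid φ z (A k x ω)) :=
  h.l2On_comp (continuous_resid φ z).measurable k x (h.std.memLp_resid φ z)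

omit [IsProbabilityMeasure P] in
lemma l2On_mul (z : ℂ) (k : ℕ) (x : I) :
    L2On (siteSigma A) P {k} (fun ω => z * (A k x ω : ℂ)) :=
  h.l2On_comp (u := fun y => z * (y : ℂ)) (by fun_prop) k x (h.std.memLp_two.ofReal.const_mul z)

lemma l2On_weight (φ : ℂ → ℂ) (z : ℕ → ℂ) (a b : ℕ) (x : I) :
    L2On (siteSigma A) P (Set.Ico a b) (weight φ A z a b x) :=
  (L2On.prod_Ico h.siteSigma_le h.indep (fun i => h.l2On_site φ (z i) i x) a b).1

lemma integral_sq_norm_weight_le (hb : SiteBounds ζ P D C) (hz : ∀ k, z k ∈ D) (a b : ℕ) (x : I) :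
    ∫ ω, ‖weight (complexMGF ζ P) A z a b x ω‖ ^ 2 ∂P ≤
      Real.exp (C * ∑ k ∈ Finset.Ico a b, ‖z k‖ ^ 2) := by
  have := (L2On.prod_Ico h.siteSigma_le h.indep
    (fun i => h.l2On_site (complexMGF ζ P) (z i) i x) a b).2
  simp only [weight]
  rw [this, Finset.mul_sum, Real.exp_sum]
  refine Finset.prod_le_prod (fun i _ => integral_nonneg fun ω => by positivity) fun i _ => ?_
  rw [h.integral_comp (u := fun y => ‖site (complexMGF ζ P) (z i) y‖ ^ 2)
    (((continuous_site _ _).norm.pow 2).measurable)]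
  exact hb.site_sq _ (hz i)

lemma l2On_transform (φ : ℂ → ℂ) {z : ℕ → ℂ} {v : ℕ → Ω → ℂ} (x : I)
    (hv : ∀ k, L2On (siteSigma A) P {k} (v k)) (a b : ℕ) :
    L2On (siteSigma A) P (Set.Ico a b)
      (fun ω => ∑ k ∈ Finset.Ico a b, (∏ i ∈ Finset.Ico a k, site φ (z i) (A i x ω)) * v k ω) := by
  refine L2On.sum fun k hk => ?_
  simp only [Finset.mem_Ico] at hk
  refine (L2On.mul h.siteSigma_le h.indep ?_ (h.l2On_weight φ z a k x) (hv k)).mono ?_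
  · simp
  · intro x
    simp only [Set.union_singleton, Set.mem_insert_iff, Set.mem_Ico]
    omega

lemma l2On_linPart (φ : ℂ → ℂ) (z : ℕ → ℂ) (a b : ℕ) (x : I) :
    L2On (siteSigma A) P (Set.Ico a b) (linPart φ A z a b x) :=
  h.l2On_transform φ x (fun k => h.l2On_mul (z k) k x) a b

lemma l2On_resPart (φ : ℂ → ℂ) (z : ℕ → ℂ) (a b : ℕ) (x : I) :
    L2On (siteSigma A) P (Set.Ico a b) (resPart φ A z a b x) :=
  h.l2On_transform φ x (fun k => h.l2On_resid φ (z k) k x) a b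

omit [IsProbabilityMeasure P] in
lemma integral_mul_eq_zero (z : ℂ) (k : ℕ) (x : I) : ∫ ω, z * (A k x ω : ℂ) ∂P = 0 := by
  rw [integral_const_mul, (h.isStandardExp k x).integral_ofReal_eq_zero, mul_zero]

lemma integral_resid_eq_zero (hb : SiteBounds ζ P D C) {z : ℂ} (hz : z ∈ D) (k : ℕ) (x : I) :
    ∫ ω, resid (complexMGF ζ P) z (A k x ω) ∂P = 0 := by
  rw [h.integral_comp (continuous_resid _ _).measurable]
  exact h.std.integral_resid (hb.ne_zero z hz)

/-- The covariance of the linear parts. -/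
lemma norm_integral_linPart_le (hb : SiteBounds ζ P D C) (hz : ∀ k, z k ∈ D) (a b : ℕ)
    (x y : I) :
    ‖∫ ω, linPart (complexMGF ζ P) A z a b x ω *
        starRingEnd ℂ (linPart (complexMGF ζ P) A z a b y ω) ∂P‖ ≤
      Real.exp (C * ∑ k ∈ Finset.Ico a b, ‖z k‖ ^ 2) *
        ∑ k ∈ Finset.Ico a b, ‖z k‖ ^ 2 * |∫ ω, A k x ω * A k y ω ∂P| := by
  simp only [linPart]
  rw [integral_transform_mul_conj h.siteSigma_le h.indep
    (fun k => h.l2On_site (complexMGF ζ P) (z k) k x)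
    (fun k => h.l2On_site (complexMGF ζ P) (z k) k y) (fun k => h.l2On_mul (z k) k x)
    (fun k => h.l2On_mul (z k) k y) (fun k => h.integral_mul_eq_zero _ k x)
    (fun k => h.integral_mul_eq_zero _ k y), Finset.mul_sum]
  refine norm_sum_le_of_le _ fun k hk => ?_
  simp only [Finset.mem_Ico] at hk
  rw [norm_mul]
  have hw : ∀ y, ∫ ω, ‖weight (complexMGF ζ P) A z a k y ω‖ ^ 2 ∂P ≤
      Real.exp (C * ∑ k ∈ Finset.Ico a b, ‖z k‖ ^ 2) := fun y => by
    refine (h.integral_sq_norm_weight_le hb hz a k y).trans ?_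
    have := hb.nonneg
    gcongr
    exact hk.2.le
  have e : ∫ ω, z k * (A k x ω : ℂ) * starRingEnd ℂ (z k * (A k y ω : ℂ)) ∂P =
      ((‖z k‖ ^ 2 * ∫ ω, A k x ω * A k y ω ∂P : ℝ) : ℂ) := by
    rw [← integral_const_mul, ← integral_complex_ofReal]
    refine integral_congr_ae (ae_of_all _ fun ω => ?_)
    simp only [map_mul, Complex.conj_ofReal, Complex.ofReal_mul]
    rw [← Complex.normSq_eq_norm_sq, Complex.normSq_eq_conj_mul_self]
    ring
  rw [e, Complex.norm_real, Real.norm_eq_abs, abs_mul, abs_of_nonneg (sq_nonneg ‖z k‖)]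
  refine mul_le_mul_of_nonneg_right ?_ (by positivity)
  exact norm_integral_mul_conj_le (h.l2On_weight _ z a k x).memLp
    (h.l2On_weight _ z a k y).memLp (hw x) (hw y)

/-- The increments of the transform are orthogonal. Each contributes the second moment of a partial
weight, bounded through the sum of the |z k|² over the block, times that of a remainder, of order |z
k|⁴. -/
lemma integral_sq_norm_resPart_le (hb : SiteBounds ζ P D C) (hz : ∀ k, z k ∈ D) (a b : ℕ)
    (x : I) :
    ∫ ω, ‖resPart (complexMGF ζ P) A z a b x ω‖ ^ 2 ∂P ≤
      Real.exp (C * ∑ k ∈ Finset.Ico a b, ‖z k‖ ^ 2) * C *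
        ∑ k ∈ Finset.Ico a b, ‖z k‖ ^ 4 := by
  have h0 : ∀ f : Ω → ℂ, ∫ ω, f ω * starRingEnd ℂ (f ω) ∂P = ((∫ ω, ‖f ω‖ ^ 2 ∂P : ℝ) : ℂ) := by
    intro f
    rw [← integral_complex_ofReal]
    refine integral_congr_ae (ae_of_all _ fun ω => ?_)
    simp only
    rw [Complex.mul_conj, Complex.normSq_eq_norm_sq]
  have h1 : ‖((∫ ω, ‖resPart (complexMGF ζ P) A z a b x ω‖ ^ 2 ∂P : ℝ) : ℂ)‖ ≤
      Real.exp (C * ∑ k ∈ Finset.Ico a b, ‖z k‖ ^ 2) * C *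
        ∑ k ∈ Finset.Ico a b, ‖z k‖ ^ 4 := by
    rw [← h0]
    simp only [resPart]
    rw [integral_transform_mul_conj h.siteSigma_le h.indep
      (fun k => h.l2On_site (complexMGF ζ P) (z k) k x)
      (fun k => h.l2On_site (complexMGF ζ P) (z k) k x)
      (fun k => h.l2On_resid (complexMGF ζ P) (z k) k x)
      (fun k => h.l2On_resid (complexMGF ζ P) (z k) k x)
      (fun k => h.integral_resid_eq_zero hb (hz k) k x)
      (fun k => h.integral_resid_eq_zero hb (hz k) k x), Finset.mul_sum]
    refine norm_sum_le_of_le _ fun k hk => ?_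
    simp only [Finset.mem_Ico] at hk
    rw [norm_mul, mul_assoc]
    have hw : ∫ ω, ‖weight (complexMGF ζ P) A z a k x ω‖ ^ 2 ∂P ≤
        Real.exp (C * ∑ k ∈ Finset.Ico a b, ‖z k‖ ^ 2) := by
      refine (h.integral_sq_norm_weight_le hb hz a k x).trans ?_
      have := hb.nonneg
      gcongr
      exact hk.2.le
    have hr : ∫ ω, ‖resid (complexMGF ζ P) (z k) (A k x ω)‖ ^ 2 ∂P ≤ C * ‖z k‖ ^ 4 := by
      rw [h.integral_comp (u := fun y => ‖resid (complexMGF ζ P) (z k) y‖ ^ 2)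
        (((continuous_resid _ _).norm.pow 2).measurable)]
      exact hb.resid_sq _ (hz k)
    refine mul_le_mul ?_ ?_ (norm_nonneg _) (Real.exp_pos _).le
    · exact norm_integral_mul_conj_le (h.l2On_weight _ z a k x).memLp
        (h.l2On_weight _ z a k x).memLp hw hw
    · exact norm_integral_mul_conj_le (h.l2On_resid _ (z k) k x).memLp
        (h.l2On_resid _ (z k) k x).memLp hr hr
  rw [Complex.norm_real] at h1
  exact (le_abs_self _).trans h1

lemma integral_resPart (hb : SiteBounds ζ P D C) (hz : ∀ k, z k ∈ D) (a b : ℕ) (x : I) :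
    ∫ ω, resPart (complexMGF ζ P) A z a b x ω ∂P = 0 := by
  change ∫ ω, ∑ k ∈ Finset.Ico a b, weight (complexMGF ζ P) A z a k x ω *
    resid (complexMGF ζ P) (z k) (A k x ω) ∂P = 0
  rw [integral_finsetSum _ fun k _ => (h.l2On_weight _ z a k x).integrable_mul
    (h.l2On_resid _ (z k) k x)]
  refine Finset.sum_eq_zero fun k _ => ?_
  refine (integral_mul_of_disjoint h.siteSigma_le h.indep (S := Set.Ico a k) (T := {k}) (by simp)
    (h.l2On_weight _ z a k x).meas (h.l2On_resid _ (z k) k x).meas).trans ?_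
  rw [h.integral_resid_eq_zero hb (hz k) k x, mul_zero]

/-- The cross term vanishes because `resPart` is centered, and 1 + x ≤ e^x. The exponential form
makes the bounds of successive blocks multiply well. -/
lemma integral_sq_norm_one_add_resPart_le (hb : SiteBounds ζ P D C) (hz : ∀ k, z k ∈ D)
    (a b : ℕ) (x : I) :
    ∫ ω, ‖1 + resPart (complexMGF ζ P) A z a b x ω‖ ^ 2 ∂P ≤
      Real.exp (Real.exp (C * ∑ k ∈ Finset.Ico a b, ‖z k‖ ^ 2) * C *
        ∑ k ∈ Finset.Ico a b, ‖z k‖ ^ 4) := by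
  have hR := h.l2On_resPart (complexMGF ζ P) z a b x
  have i1 := hR.integrable
  have i2 := hR.memLp.integrable_sq_norm
  set R := resPart (complexMGF ζ P) A z a b x
  have : ∀ ω, ‖1 + R ω‖ ^ 2 = 1 + 2 * (R ω).re + ‖R ω‖ ^ 2 := by
    intro ω
    rw [Complex.sq_norm, Complex.sq_norm, Complex.normSq_apply, Complex.normSq_apply]
    simp; ring
  simp_rw [this]
  have j1 : Integrable (fun ω => 2 * (R ω).re) P := i1.re.const_mul 2
  have j2 : Integrable (fun ω => 1 + 2 * (R ω).re) P := (integrable_const 1).add j1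
  have e1 : ∫ ω, (R ω).re ∂P = 0 := by
    have := integral_re i1
    rw [h.integral_resPart hb hz] at this
    simpa using this
  rw [integral_add j2 i2, integral_add (integrable_const 1) j1, integral_const_mul, e1]
  have := h.integral_sq_norm_resPart_le hb hz a b x
  simp only [integral_const, probReal_univ, smul_eq_mul, mul_one, mul_zero, add_zero]
  linarith [Real.add_one_le_exp (Real.exp (C * ∑ k ∈ Finset.Ico a b, ‖z k‖ ^ 2) * C *
        ∑ k ∈ Finset.Ico a b, ‖z k‖ ^ 4)]

variable {n : ℕ → ℕ} (hn : Monotone n)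

include hn

lemma l2On_resProd (φ : ℂ → ℂ) (z : ℕ → ℂ) (j J : ℕ) (x : I) :
    L2On (siteSigma A) P (Set.Ico (n j) (n J)) (resProd φ A z n j J x) ∧
      ∫ ω, ‖resProd φ A z n j J x ω‖ ^ 2 ∂P =
        ∏ i ∈ Finset.Ico j J, ∫ ω, ‖1 + resPart φ A z (n i) (n (i + 1)) x ω‖ ^ 2 ∂P := by
  have := L2On.prod h.siteSigma_le h.indep (s := Finset.Ico j J)
    (R := fun i => Set.Ico (n i) (n (i + 1)))
    (F := fun i ω => 1 + resPart φ A z (n i) (n (i + 1)) x ω)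
    (fun i _ k _ hik => hn.pairwise_disjoint_on_Ico_succ hik)
    fun i _ => (L2On.const 1).add (h.l2On_resPart φ z _ _ x)
  refine ⟨this.1.mono ?_, this.2⟩
  intro y
  simp only [Finset.mem_Ico, Set.mem_iUnion, Set.mem_Ico, exists_prop, forall_exists_index, and_imp]
  intro i h1 h2 h3 h4
  exact ⟨(hn h1).trans h3, h4.trans_le (hn h2)⟩

/-- Blocks are independent, so the second moments multiply and the exponents add up to at most a
fixed multiple of `B₄`. The bound is thus uniform in the number of blocks. -/
lemma integral_sq_norm_resProd_le (hb : SiteBounds ζ P D C) (hz : ∀ k, z k ∈ D) {B₂ B₄ : ℝ}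
    (hB₂ : ∀ j, ∑ k ∈ Finset.Ico (n j) (n (j + 1)), ‖z k‖ ^ 2 ≤ B₂)
    (hB₄ : ∀ a b, ∑ k ∈ Finset.Ico a b, ‖z k‖ ^ 4 ≤ B₄) (j J : ℕ) (x : I) :
    ∫ ω, ‖resProd (complexMGF ζ P) A z n j J x ω‖ ^ 2 ∂P ≤
      Real.exp (Real.exp (C * B₂) * C * B₄) := by
  have hC := hb.nonneg
  rw [(h.l2On_resProd hn _ z j J x).2]
  calc _ ≤ ∏ i ∈ Finset.Ico j J, Real.exp (Real.exp (C * B₂) * C *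
        ∑ k ∈ Finset.Ico (n i) (n (i + 1)), ‖z k‖ ^ 4) := by
        refine Finset.prod_le_prod (fun i _ => integral_nonneg fun ω => by positivity) fun i _ => ?_
        refine (h.integral_sq_norm_one_add_resPart_le hb hz _ _ x).trans ?_
        gcongr
        exact hB₂ i
    _ ≤ _ := by
        rw [← Real.exp_sum, ← Finset.mul_sum]
        gcongr
        rcases le_or_gt j J with hjJ | hjJ
        · have : ∀ J, j ≤ J → ∑ i ∈ Finset.Ico j J, ∑ k ∈ Finset.Ico (n i) (n (i + 1)), ‖z k‖ ^ 4 =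
              ∑ k ∈ Finset.Ico (n j) (n J), ‖z k‖ ^ 4 := by
            intro J hJ
            induction J, hJ using Nat.le_induction with
            | base => simp
            | succ J hJ ih =>
              rw [Finset.sum_Ico_succ_top hJ, ih, Finset.sum_Ico_consecutive _ (hn hJ)
                (hn (Nat.le_succ J))]
          rw [this J hjJ]
          exact hB₄ _ _
        · rw [Finset.Ico_eq_empty_of_le hjJ.le, Finset.sum_empty]
          exact (Finset.sum_nonneg fun k _ => by positivity).trans (hB₄ 0 0)

lemma l2On_blockTerm (φ : ℂ → ℂ) (z : ℕ → ℂ) (j J : ℕ) (x : I) :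
    L2On (siteSigma A) P (Set.Ici (n j)) (blockTerm φ A z n j J x) := by
  refine (L2On.mul h.siteSigma_le h.indep ?_ (h.l2On_linPart φ z (n j) (n (j + 1)) x)
    (h.l2On_resProd hn φ z (j + 1) J x).1).mono ?_
  · rw [Set.disjoint_left]; intro k hk hk'; exact absurd hk.2 (not_lt.2 hk'.1)
  · rintro k (hk | hk)
    · exact hk.1
    · exact (hn (Nat.le_succ j)).trans hk.1

/-- The linear part lives on the block j and the product on later blocks, so the correlation
factorises. Decorrelation in space comes from the first factor alone; for the second, Cauchy–Schwarz
is enough. -/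
lemma norm_integral_blockTerm_le (hb : SiteBounds ζ P D C) (hz : ∀ k, z k ∈ D) {B₂ B₄ : ℝ}
    (hB₂ : ∀ j, ∑ k ∈ Finset.Ico (n j) (n (j + 1)), ‖z k‖ ^ 2 ≤ B₂)
    (hB₄ : ∀ a b, ∑ k ∈ Finset.Ico a b, ‖z k‖ ^ 4 ≤ B₄) (j J : ℕ) (x y : I) :
    ‖∫ ω, blockTerm (complexMGF ζ P) A z n j J x ω *
        starRingEnd ℂ (blockTerm (complexMGF ζ P) A z n j J y ω) ∂P‖ ≤
      Real.exp (C * B₂) * Real.exp (Real.exp (C * B₂) * C * B₄) *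
        ∑ k ∈ Finset.Ico (n j) (n (j + 1)), ‖z k‖ ^ 2 * |∫ ω, A k x ω * A k y ω ∂P| := by
  have hC := hb.nonneg
  have hd : Disjoint (Set.Ico (n j) (n (j + 1))) (Set.Ico (n (j + 1)) (n J)) := by
    rw [Set.disjoint_left]; intro k hk hk'; exact absurd hk.2 (not_lt.2 hk'.1)
  have e : ∫ ω, blockTerm (complexMGF ζ P) A z n j J x ω *
        starRingEnd ℂ (blockTerm (complexMGF ζ P) A z n j J y ω) ∂P =
      (∫ ω, linPart (complexMGF ζ P) A z (n j) (n (j + 1)) x ω *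
        starRingEnd ℂ (linPart (complexMGF ζ P) A z (n j) (n (j + 1)) y ω) ∂P) *
      ∫ ω, resProd (complexMGF ζ P) A z n (j + 1) J x ω *
        starRingEnd ℂ (resProd (complexMGF ζ P) A z n (j + 1) J y ω) ∂P := by
    refine Eq.trans ?_ (integral_mul_of_disjoint h.siteSigma_le h.indep hd
      ((h.l2On_linPart _ z _ _ x).meas.mul (h.l2On_linPart _ z _ _ y).star.meas)
      ((h.l2On_resProd hn _ z _ J x).1.meas.mul (h.l2On_resProd hn _ z _ J y).1.star.meas))
    refine integral_congr_ae (ae_of_all _ fun ω => ?_)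
    simp only [blockTerm, map_mul]
    ring
  rw [e, norm_mul]
  have h1 := h.norm_integral_linPart_le hb hz (n j) (n (j + 1)) x y
  have h2 := norm_integral_mul_conj_le (h.l2On_resProd hn _ z (j + 1) J x).1.memLp
    (h.l2On_resProd hn _ z (j + 1) J y).1.memLp
    (h.integral_sq_norm_resProd_le hn hb hz hB₂ hB₄ (j + 1) J x)
    (h.integral_sq_norm_resProd_le hn hb hz hB₂ hB₄ (j + 1) J y)
  have h3 : 0 ≤ ∑ k ∈ Finset.Ico (n j) (n (j + 1)), ‖z k‖ ^ 2 * |∫ ω, A k x ω * A k y ω ∂P| :=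
    Finset.sum_nonneg fun k _ => by positivity
  calc _ ≤ (Real.exp (C * B₂) *
        ∑ k ∈ Finset.Ico (n j) (n (j + 1)), ‖z k‖ ^ 2 * |∫ ω, A k x ω * A k y ω ∂P|) *
        Real.exp (Real.exp (C * B₂) * C * B₄) := by
        refine mul_le_mul (h1.trans ?_) h2 (norm_nonneg _) (by positivity)
        gcongr
        exact hB₂ j
    _ = _ := by ring

end IsSiteField

end Moments

end SiteField


/-! ### Powers and two-point functions of real normalised exponentials. -/

section RealSite

variable {Ω : Type*} [MeasurableSpace Ω] {P : Measure Ω} [IsProbabilityMeasure P] {ζ : Ω → ℝ}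

/-- The exponential `e^{sa}` divided by the moment generating function of `ζ`. -/
def rsite (ζ : Ω → ℝ) (P : Measure Ω) (s a : ℝ) : ℝ := Real.exp (s * a) / mgf ζ P s

lemma continuous_rsite (ζ : Ω → ℝ) (P : Measure Ω) (s : ℝ) : Continuous (rsite ζ P s) := by
  unfold rsite; fun_prop

namespace IsStandardExp

lemma mgf_pos' (h : IsStandardExp ζ P) (s : ℝ) : 0 < mgf ζ P s :=
  zero_lt_one.trans_le (h.one_le_mgf s)

lemma rsite_pos (h : IsStandardExp ζ P) (s a : ℝ) : 0 < rsite ζ P s a :=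
  div_pos (Real.exp_pos _) (h.mgf_pos' s)

omit [IsProbabilityMeasure P] in
lemma integrable_rsite (h : IsStandardExp ζ P) (s : ℝ) : Integrable (fun ω => rsite ζ P s (ζ ω)) P :=
  (h.exp s).div_const _

lemma integral_rsite (h : IsStandardExp ζ P) (s : ℝ) : ∫ ω, rsite ζ P s (ζ ω) ∂P = 1 := by
  simp only [rsite]
  rw [integral_div]
  exact div_self (h.mgf_pos' s).ne'

/-- A power of an exponential tilt is a tilt with multiplied parameter, up to a constant. Since
tilts have mean one, this constant is the moment of order r. -/
lemma rsite_rpow (h : IsStandardExp ζ P) (s a r : ℝ) :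
    rsite ζ P s a ^ r = mgf ζ P (r * s) / mgf ζ P s ^ r * rsite ζ P (r * s) a := by
  have h1 := h.mgf_pos' s
  have h2 := h.mgf_pos' (r * s)
  simp only [rsite]
  rw [Real.div_rpow (Real.exp_pos _).le h1.le, ← Real.exp_mul,
    show s * a * r = r * s * a by ring]
  generalize mgf ζ P (r * s) = m at h2 ⊢
  field_simp

omit [IsProbabilityMeasure P] in
lemma ofReal_rsite (s a : ℝ) : ((rsite ζ P s a : ℝ) : ℂ) = site (complexMGF ζ P) s a := by
  simp only [rsite, site]
  rw [complexMGF_ofReal]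
  push_cast
  rfl

/-- Two-point bound for normalised exponentials of real exponent. -/
lemma integral_rsite_mul_le {D : Set ℂ} {C M : ℝ} (hb : SiteBounds ζ P D C) {s : ℝ}
    (hs : (s : ℂ) ∈ D) (hsM : |s| ≤ M) {X Y : Ω → ℝ} (hX : IsStandardExp X P)
    (hY : IsStandardExp Y P) (hXζ : IdentDistrib X ζ P P) (hYζ : IdentDistrib Y ζ P P)
    (hζ : IsStandardExp ζ P) :
    ∫ ω, rsite ζ P s (X ω) * rsite ζ P s (Y ω) ∂P ≤
      Real.exp (s ^ 2 * |∫ ω, X ω * Y ω ∂P| + (1 + C + C * M) * |s| ^ 3) := by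
  set ρ : ℝ → ℝ := fun y => rsite ζ P s y - 1 - s * y with hρ
  have hρc : Continuous ρ := by have := continuous_rsite ζ P s; fun_prop
  have hnorm : ∀ y, ‖resid (complexMGF ζ P) s y‖ ^ 2 = ρ y ^ 2 := by
    intro y
    have : resid (complexMGF ζ P) s y = ((ρ y : ℝ) : ℂ) := by
      simp only [hρ, resid, ← ofReal_rsite]; push_cast; rfl
    rw [this, Complex.norm_real, Real.norm_eq_abs, sq_abs]
  have hC := hb.nonneg
  have key : ∀ {Z : Ω → ℝ}, IsStandardExp Z P → IdentDistrib Z ζ P P →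
      MemLp (fun ω => ρ (Z ω)) 2 P ∧ ∫ ω, ρ (Z ω) ^ 2 ∂P ≤ C * s ^ 4 ∧
        ∫ ω, ρ (Z ω) ∂P = 0 := by
    intro Z hZ hZζ
    have e : ∫ ω, ρ (Z ω) ^ 2 ∂P = ∫ ω, ρ (ζ ω) ^ 2 ∂P :=
      (hZζ.comp (u := fun y => ρ y ^ 2) (by fun_prop)).integral_eq
    have e' : ∫ ω, ρ (Z ω) ∂P = ∫ ω, ρ (ζ ω) ∂P := (hZζ.comp hρc.measurable).integral_eq
    refine ⟨?_, ?_, ?_⟩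
    · refine ((hZζ.comp hρc.measurable).memLp_iff).2 ?_
      rw [memLp_two_iff_integrable_sq_norm (hρc.measurable.comp hζ.measurable).aestronglyMeasurable]
      refine (hζ.memLp_resid (complexMGF ζ P) s).integrable_sq_norm.congr (ae_of_all _ fun ω => ?_)
      simp only [Function.comp]
      rw [hnorm, Real.norm_eq_abs, sq_abs]
    · rw [e]
      have := hb.resid_sq s hs
      simp_rw [hnorm] at this
      rw [Complex.norm_real, Real.norm_eq_abs] at this
      rwa [Even.pow_abs (by decide)] at this
    · rw [e']
      have j : Integrable (fun ω => rsite ζ P s (ζ ω) - 1) P :=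
        (hζ.integrable_rsite s).sub (integrable_const 1)
      rw [integral_sub j (hζ.integrable.const_mul s),
        integral_sub (hζ.integrable_rsite s) (integrable_const 1), hζ.integral_rsite,
        integral_const_mul, hζ.mean]
      simp
  obtain ⟨mX, sX, zX⟩ := key hX hXζ
  obtain ⟨mY, sY, zY⟩ := key hY hYζ
  have iXY : Integrable (fun ω => X ω * Y ω) P := hX.memLp_two.integrable_mul hY.memLp_two
  have iXρ : Integrable (fun ω => X ω * ρ (Y ω)) P := hX.memLp_two.integrable_mul mY
  have iρY : Integrable (fun ω => Y ω * ρ (X ω)) P := hY.memLp_two.integrable_mul mX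
  have iρρ : Integrable (fun ω => ρ (X ω) * ρ (Y ω)) P := mX.integrable_mul mY
  have iX := hX.integrable
  have iY := hY.integrable
  have irX := mX.integrable (by norm_num)
  have irY := mY.integrable (by norm_num)
  have iX2 := hX.integrable_sq
  have iY2 := hY.integrable_sq
  have ir2 : Integrable (fun ω => ρ (X ω) ^ 2) P := by
    simpa using mX.integrable_sq_norm
  have ir2' : Integrable (fun ω => ρ (Y ω) ^ 2) P := by
    simpa using mY.integrable_sq_norm
  have cross : ∀ {U V : Ω → ℝ}, Integrable (fun ω => U ω ^ 2) P → Integrable (fun ω => V ω ^ 2) P →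
      Integrable (fun ω => U ω * V ω) P → ∫ ω, U ω ^ 2 ∂P = 1 → ∫ ω, V ω ^ 2 ∂P ≤ C * s ^ 4 →
      s * ∫ ω, U ω * V ω ∂P ≤ (1 + C) / 2 * |s| ^ 3 := by
    intro U V iU iV iUV hU hV
    rcases eq_or_ne s 0 with rfl | hs0
    · simp
    have hs1 : 0 < |s| := abs_pos.2 hs0
    rw [← integral_const_mul]
    -- Young's inequality with weights balanced for second moments 1 of U and O(s⁴) of V: both
    -- contributions are then of order |s|³.
    have : ∫ ω, s * (U ω * V ω) ∂P ≤ ∫ ω, (|s| ^ 3 / 2 * U ω ^ 2 + 1 / (2 * |s|) * V ω ^ 2) ∂P := by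
      refine integral_mono (iUV.const_mul s) ((iU.const_mul _).add (iV.const_mul _)) fun ω => ?_
      have h1 : s * (U ω * V ω) ≤ |s| * (|U ω| * |V ω|) := by
        rw [← abs_mul, ← abs_mul]; exact le_abs_self _
      have h2 : |s| * (|U ω| * |V ω|) ≤ |s| ^ 3 / 2 * U ω ^ 2 + 1 / (2 * |s|) * V ω ^ 2 := by
        rw [← sq_abs (U ω), ← sq_abs (V ω)]
        have : |s| ^ 3 / 2 * |U ω| ^ 2 + 1 / (2 * |s|) * |V ω| ^ 2 - |s| * (|U ω| * |V ω|) =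
            1 / (2 * |s|) * (|s| ^ 2 * |U ω| - |V ω|) ^ 2 := by
          field_simp; ring
        have h3 : 0 ≤ 1 / (2 * |s|) * (|s| ^ 2 * |U ω| - |V ω|) ^ 2 := by positivity
        linarith
      exact h1.trans h2
    refine this.trans ?_
    rw [integral_add (iU.const_mul _) (iV.const_mul _), integral_const_mul, integral_const_mul, hU]
    have h4 : 1 / (2 * |s|) * ∫ ω, V ω ^ 2 ∂P ≤ 1 / (2 * |s|) * (C * s ^ 4) := by gcongr
    have h5 : 1 / (2 * |s|) * (C * s ^ 4) = C / 2 * |s| ^ 3 := by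
      rw [← Even.pow_abs (by decide : Even 4) s]; field_simp
    linarith
  have c1 := cross iX2 ir2' iXρ hX.var sY
  have c2 := cross iY2 ir2 iρY hY.var sX
  have c3 : ∫ ω, ρ (X ω) * ρ (Y ω) ∂P ≤ C * s ^ 4 := by
    have : ∫ ω, ρ (X ω) * ρ (Y ω) ∂P ≤ ∫ ω, (ρ (X ω) ^ 2 + ρ (Y ω) ^ 2) / 2 ∂P :=
      integral_mono iρρ ((ir2.add ir2').div_const 2) fun ω => by
        simp only
        nlinarith [sq_nonneg (ρ (X ω) - ρ (Y ω))]
    rw [integral_div, integral_add ir2 ir2'] at this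
    linarith
  have expand : ∫ ω, rsite ζ P s (X ω) * rsite ζ P s (Y ω) ∂P =
      1 + s ^ 2 * ∫ ω, X ω * Y ω ∂P + s * ∫ ω, X ω * ρ (Y ω) ∂P + s * ∫ ω, Y ω * ρ (X ω) ∂P +
        ∫ ω, ρ (X ω) * ρ (Y ω) ∂P := by
    have : ∀ ω, rsite ζ P s (X ω) * rsite ζ P s (Y ω) =
        (1 + s * X ω + s * Y ω + ρ (X ω) + ρ (Y ω)) + s ^ 2 * (X ω * Y ω) +
          s * (X ω * ρ (Y ω)) + s * (Y ω * ρ (X ω)) + ρ (X ω) * ρ (Y ω) := by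
      intro ω; simp only [hρ]; ring
    simp_rw [this]
    have k1 : Integrable (fun ω => 1 + s * X ω) P := (integrable_const 1).add (iX.const_mul s)
    have k2 : Integrable (fun ω => 1 + s * X ω + s * Y ω) P := k1.add (iY.const_mul s)
    have k3 : Integrable (fun ω => 1 + s * X ω + s * Y ω + ρ (X ω)) P := k2.add irX
    have k4 : Integrable (fun ω => 1 + s * X ω + s * Y ω + ρ (X ω) + ρ (Y ω)) P := k3.add irY
    have k5 : Integrable (fun ω => (1 + s * X ω + s * Y ω + ρ (X ω) + ρ (Y ω)) +
      s ^ 2 * (X ω * Y ω)) P := k4.add (iXY.const_mul _)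
    have k6 : Integrable (fun ω => (1 + s * X ω + s * Y ω + ρ (X ω) + ρ (Y ω)) +
      s ^ 2 * (X ω * Y ω) + s * (X ω * ρ (Y ω))) P := k5.add (iXρ.const_mul _)
    have k7 : Integrable (fun ω => (1 + s * X ω + s * Y ω + ρ (X ω) + ρ (Y ω)) +
      s ^ 2 * (X ω * Y ω) + s * (X ω * ρ (Y ω)) + s * (Y ω * ρ (X ω))) P :=
      k6.add (iρY.const_mul _)
    rw [integral_add k7 iρρ, integral_add k6 (iρY.const_mul _), integral_add k5 (iXρ.const_mul _),
      integral_add k4 (iXY.const_mul _), integral_add k3 irY, integral_add k2 irX,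
      integral_add k1 (iY.const_mul s), integral_add (integrable_const 1) (iX.const_mul s)]
    simp only [integral_const_mul, hX.mean, hY.mean, zX, zY]
    simp only [integral_const, probReal_univ, smul_eq_mul]
    ring
  rw [expand]
  have f1 : s ^ 2 * ∫ ω, X ω * Y ω ∂P ≤ s ^ 2 * |∫ ω, X ω * Y ω ∂P| := by
    gcongr; exact le_abs_self _
  have f2 : C * s ^ 4 ≤ C * M * |s| ^ 3 := by
    rw [← Even.pow_abs (by decide : Even 4) s]
    calc C * |s| ^ 4 = C * |s| * |s| ^ 3 := by ring
      _ ≤ _ := by gcongr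
  have := Real.add_one_le_exp (s ^ 2 * |∫ ω, X ω * Y ω ∂P| + (1 + C + C * M) * |s| ^ 3)
  linarith

end IsStandardExp

end RealSite


/-- Checkpoints `n l` at which the partial variance is about `l`, together with the covariance
sums needed at distance `e^{-l}`; `c k x y` is the covariance of the `k`-th field. -/
structure ScaleBounds {I : Type*} [PseudoMetricSpace I] (a : ℕ → ℝ) (c : ℕ → I → I → ℝ)
    (n : ℕ → ℕ) (δ B : ℝ) : Prop where
  mono : Monotone n
  zero : n 0 = 0
  nonneg : ∀ k, 0 ≤ a k
  le_one : ∀ k, a k ≤ 1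
  var : ∀ l, ∑ k ∈ Finset.range (n l), a k ^ 2 ≤ l
  cube : ∀ m, ∑ k ∈ Finset.range m, a k ^ 3 ≤ B
  block : ∀ j, ∑ k ∈ Finset.Ico (n j) (n (j + 1)), a k ^ 2 ≤ B
  far : ∀ l j : ℕ, l ≤ j → ∀ x y, Real.exp (-(l + 1)) < dist x y →
    ∑ k ∈ Finset.Ico (n l) (n j), a k ^ 2 * |c k x y| ≤ B
  near : ∀ l j : ℕ, l ≤ j → ∀ x y, (l < j → Real.exp (-(l + 1)) < dist x y) →
    ∑ k ∈ Finset.Ico (n j) (n (j + 1)), a k ^ 2 * |c k x y| ≤ B * Real.exp (-(δ * (j - l)))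

/-- The points at distance about `e^{-l}` from `x`, or at most `e^{-j}` when `l = j`. -/
def shell {I : Type*} [PseudoMetricSpace I] (l j : ℕ) (x : I) : Set I :=
  {y | (l < j → Real.exp (-(l + 1)) < dist x y) ∧ (0 < l → dist x y ≤ Real.exp (-l))}

lemma measurableSet_shell {I : Type*} [PseudoMetricSpace I] [MeasurableSpace I]
    [OpensMeasurableSpace I] (l j : ℕ) (x : I) : MeasurableSet (shell l j x) := by
  have h1 : MeasurableSet {y : I | Real.exp (-(l + 1)) < dist x y} :=
    (isOpen_lt continuous_const (continuous_const.dist continuous_id)).measurableSet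
  have h2 : MeasurableSet {y : I | dist x y ≤ Real.exp (-l)} :=
    (isClosed_le (continuous_const.dist continuous_id) continuous_const).measurableSet
  by_cases hl : l < j <;> by_cases hl' : 0 < l <;>
    simp only [shell, hl, hl', true_imp_iff, false_imp_iff, true_and, and_true,
      Set.ofPred_true, MeasurableSet.univ]
  · exact h1.inter h2
  · exact h1
  · exact h2

/-- If the distance exceeds e^{-j}, take the first exponent whose exponential is below it and step
back by one, except at 0, where the shell has no upper bound on the distance. -/
lemma exists_mem_shell {I : Type*} [PseudoMetricSpace I] (j : ℕ) (x y : I) :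
    ∃ l ≤ j, y ∈ shell l j x := by
  classical
  by_cases hj : dist x y ≤ Real.exp (-j)
  · exact ⟨j, le_rfl, fun h => absurd h (lt_irrefl _), fun _ => hj⟩
  · have hex : ∃ l : ℕ, Real.exp (-l) < dist x y := ⟨j, not_le.1 hj⟩
    rcases Nat.eq_zero_or_pos (Nat.find hex) with h0 | h0
    · refine ⟨0, Nat.zero_le _, fun _ => ?_, fun h => absurd h (lt_irrefl _)⟩
      refine lt_of_le_of_lt ?_ (h0 ▸ Nat.find_spec hex)
      gcongr; simp
    · obtain ⟨l, hl⟩ := Nat.exists_eq_succ_of_ne_zero h0.ne'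
      have hlj : Nat.find hex ≤ j := Nat.find_min' hex (not_le.1 hj)
      refine ⟨l, by omega, fun _ => ?_, fun _ => ?_⟩
      · have := Nat.find_spec hex
        rw [hl] at this
        push_cast at this
        exact this
      · exact not_lt.1 (Nat.find_min hex (m := l) (by omega))

/-! ### Size-biased moments of positive weights. -/

section RealWeight

variable {I Ω : Type*} {mΩ : MeasurableSpace Ω} {P : Measure Ω} {A : ℕ → I → Ω → ℝ} {ζ : Ω → ℝ}

/-- The product of the normalised real exponentials with indices in `[a, b)`. -/
def rweight (ζ : Ω → ℝ) (P : Measure Ω) (A : ℕ → I → Ω → ℝ) (s : ℕ → ℝ) (a b : ℕ) (x : I)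
    (ω : Ω) : ENNReal :=
  ∏ i ∈ Finset.Ico a b, ENNReal.ofReal (rsite ζ P (s i) (A i x ω))

lemma rweight_mul (s : ℕ → ℝ) {a b c : ℕ} (hab : a ≤ b) (hbc : b ≤ c) (x : I) (ω : Ω) :
    rweight ζ P A s a b x ω * rweight ζ P A s b c x ω = rweight ζ P A s a c x ω :=
  Finset.prod_Ico_consecutive _ hab hbc

lemma measurable_sigma_ofReal_rsite (s : ℝ) (k : ℕ) (x : I) :
    Measurable[siteSigma A k] fun ω => ENNReal.ofReal (rsite ζ P s (A k x ω)) :=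
  (ENNReal.measurable_ofReal.comp (continuous_rsite ζ P s).measurable).comp
    (measurable_siteSigma A k x)

lemma measurable_sigma_rweight (s : ℕ → ℝ) (a b : ℕ) (x : I) :
    Measurable[sigmaOn (siteSigma A) (Set.Ico a b)] (rweight ζ P A s a b x) :=
  Finset.measurable_prod _ fun i hi => (measurable_sigma_ofReal_rsite (s i) i x).mono
    (le_sigmaOn _ (by simpa using hi)) le_rfl

variable [TopologicalSpace I]

namespace IsSiteField

lemma measurable_rweight (h : IsSiteField P A ζ) (s : ℕ → ℝ) (a b : ℕ) (x : I) :
    Measurable (rweight ζ P A s a b x) :=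
  (measurable_sigma_rweight s a b x).mono (sigmaOn_le h.siteSigma_le _) le_rfl

lemma measurable_uncurry_rweight [TopologicalSpace.MetrizableSpace I] [SecondCountableTopology I]
    [MeasurableSpace I] [BorelSpace I] (h : IsSiteField P A ζ) (s : ℕ → ℝ) (a b : ℕ) :
    Measurable (Function.uncurry (rweight ζ P A s a b)) := by
  change Measurable fun p : I × Ω => ∏ i ∈ Finset.Ico a b,
    ENNReal.ofReal (rsite ζ P (s i) (A i p.1 p.2))
  refine Finset.measurable_prod _ fun i _ => ?_
  exact ENNReal.measurable_ofReal.comp ((continuous_rsite ζ P (s i)).measurable.comp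
    (measurable_uncurry_of_continuous_of_measurable (h.continuous i) (h.measurable i)))

variable [IsProbabilityMeasure P] (h : IsSiteField P A ζ)

include h

omit [IsProbabilityMeasure P] in
lemma lintegral_mul_of_disjoint {S T : Set ℕ} {f g : Ω → ENNReal} (hST : Disjoint S T)
    (hf : Measurable[sigmaOn (siteSigma A) S] f) (hg : Measurable[sigmaOn (siteSigma A) T] g) :
    ∫⁻ ω, f ω * g ω ∂P = (∫⁻ ω, f ω ∂P) * ∫⁻ ω, g ω ∂P :=
  lintegral_mul_eq_lintegral_mul_lintegral_of_independent_measurableSpace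
    (sigmaOn_le h.siteSigma_le S) (sigmaOn_le h.siteSigma_le T)
    (indep_iSup_of_disjoint h.siteSigma_le h.indep hST) hf hg

lemma lintegral_ofReal_rsite (s : ℝ) (k : ℕ) (x : I) :
    ∫⁻ ω, ENNReal.ofReal (rsite ζ P s (A k x ω)) ∂P = 1 := by
  rw [← ofReal_integral_eq_lintegral_ofReal, h.integral_comp (continuous_rsite ζ P s).measurable,
    h.std.integral_rsite, ENNReal.ofReal_one]
  · exact ((h.ident k x).comp (continuous_rsite ζ P s).measurable).integrable_iff.2
      (h.std.integrable_rsite s)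
  · exact ae_of_all _ fun ω => (h.std.rsite_pos s _).le

lemma lintegral_rweight (s : ℕ → ℝ) (a b : ℕ) (x : I) :
    ∫⁻ ω, rweight ζ P A s a b x ω ∂P = 1 := by
  simp only [rweight]
  rw [lintegral_finset_prod_of_iIndep h.siteSigma_le h.indep
    fun i => measurable_sigma_ofReal_rsite (s i) i x]
  exact Finset.prod_eq_one fun i _ => h.lintegral_ofReal_rsite (s i) i x

lemma lintegral_rweight_rpow (s : ℕ → ℝ) (a b : ℕ) (x : I) {r : ℝ} (hr : 0 ≤ r) :
    ∫⁻ ω, rweight ζ P A s a b x ω ^ r ∂P =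
      ∏ i ∈ Finset.Ico a b, ENNReal.ofReal (mgf ζ P (r * s i) / mgf ζ P (s i) ^ r) := by
  simp only [rweight]
  simp_rw [← ENNReal.prod_rpow_of_nonneg hr]
  rw [lintegral_finset_prod_of_iIndep h.siteSigma_le h.indep
    fun i => (measurable_sigma_ofReal_rsite (s i) i x).pow_const r]
  refine Finset.prod_congr rfl fun i _ => ?_
  have h1 := h.std.mgf_pos' (s i)
  have h2 := h.std.mgf_pos' (r * s i)
  have : ∀ ω, ENNReal.ofReal (rsite ζ P (s i) (A i x ω)) ^ r =
      ENNReal.ofReal (mgf ζ P (r * s i) / mgf ζ P (s i) ^ r) *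
        ENNReal.ofReal (rsite ζ P (r * s i) (A i x ω)) := by
    intro ω
    rw [ENNReal.ofReal_rpow_of_pos (h.std.rsite_pos _ _), h.std.rsite_rpow,
      ENNReal.ofReal_mul (by positivity)]
  simp_rw [this]
  rw [lintegral_const_mul' _ _ ENNReal.ofReal_ne_top, h.lintegral_ofReal_rsite, mul_one]

/-- Only the indices from `p` on occur at both points. The factor at `y` with earlier indices is
independent of the rest and has mean one. -/
lemma lintegral_rweight_mul_rweight (s : ℕ → ℝ) {p m : ℕ} (hpm : p ≤ m) (x y : I) :
    ∫⁻ ω, rweight ζ P A s p m x ω * rweight ζ P A s 0 m y ω ∂P =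
      ∏ i ∈ Finset.Ico p m, ∫⁻ ω, ENNReal.ofReal (rsite ζ P (s i) (A i x ω)) *
        ENNReal.ofReal (rsite ζ P (s i) (A i y ω)) ∂P := by
  have hd : Disjoint (Set.Ico 0 p) (Set.Ico p m) := by
    rw [Set.disjoint_left]; intro k hk hk'; exact absurd hk.2 (not_lt.2 hk'.1)
  have e : ∀ ω, rweight ζ P A s p m x ω * rweight ζ P A s 0 m y ω = rweight ζ P A s 0 p y ω *
      (rweight ζ P A s p m x ω * rweight ζ P A s p m y ω) := by
    intro ω
    rw [← rweight_mul s (Nat.zero_le p) hpm y ω]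
    ring
  simp_rw [e]
  refine (h.lintegral_mul_of_disjoint hd (measurable_sigma_rweight s 0 p y)
    ((measurable_sigma_rweight s p m x).mul (measurable_sigma_rweight s p m y))).trans ?_
  rw [h.lintegral_rweight, one_mul]
  simp only [Pi.mul_apply, rweight, ← Finset.prod_mul_distrib]
  exact lintegral_finset_prod_of_iIndep h.siteSigma_le h.indep
    (fun i => (measurable_sigma_ofReal_rsite (s i) i x).mul
      (measurable_sigma_ofReal_rsite (s i) i y)) _

/-- The size-biased moment of the mass of `S`, bounded by one application of Hölder's inequality. -/
lemma lintegral_rweight_mul_rpow_le [TopologicalSpace.MetrizableSpace I] [SecondCountableTopology I]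
    [MeasurableSpace I] [BorelSpace I] (ν : Measure I) [IsFiniteMeasure ν] (s : ℕ → ℝ) {p m : ℕ}
    (hpm : p ≤ m) (x : I) (S : Set I) {q : ℝ} (hq0 : 0 < q) (hq1 : q < 1) :
    ∫⁻ ω, rweight ζ P A s 0 m x ω * (∫⁻ y in S, rweight ζ P A s 0 m y ω ∂ν) ^ q ∂P ≤
      (∏ i ∈ Finset.Ico 0 p, ENNReal.ofReal
        (mgf ζ P (1 / (1 - q) * s i) / mgf ζ P (s i) ^ (1 / (1 - q)))) ^ (1 - q) *
      (∫⁻ y in S, ∏ i ∈ Finset.Ico p m, ∫⁻ ω, ENNReal.ofReal (rsite ζ P (s i) (A i x ω)) *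
        ENNReal.ofReal (rsite ζ P (s i) (A i y ω)) ∂P ∂ν) ^ q := by
  have hq' : 0 < 1 - q := by linarith
  set r := 1 / (1 - q) with hr
  have hr0 : 0 < r := by positivity
  have hd : Disjoint (Set.Ico 0 p) (Set.Ico p m) := by
    rw [Set.disjoint_left]; intro k hk hk'; exact absurd hk.2 (not_lt.2 hk'.1)
  -- The weight at x is distributed over the two Hölder factors, of exponents 1-q and q. The early
  -- part goes entirely into the first, as a power r with r(1-q) = 1, and the late part appears in
  -- both. The first factor is then a one-point moment of the early part, while the second is linear
  -- in the mass of S and involves only two-point functions from `p` on.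
  set f : Ω → ENNReal := fun ω => rweight ζ P A s 0 p x ω ^ r * rweight ζ P A s p m x ω
  set Z : Ω → ENNReal := fun ω => ∫⁻ y in S, rweight ζ P A s 0 m y ω ∂ν
  have hjm : Measurable (Function.uncurry (rweight ζ P A s 0 m)) :=
    h.measurable_uncurry_rweight s 0 m
  have hZ : Measurable Z := hjm.lintegral_prod_left'
  have hxm := h.measurable_rweight s p m x
  have hf : Measurable f := ((h.measurable_rweight s 0 p x).pow_const r).mul hxm
  have e : ∀ ω, rweight ζ P A s 0 m x ω * Z ω ^ q =
      f ω ^ (1 - q) * (rweight ζ P A s p m x ω * Z ω) ^ q := by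
    intro ω
    simp only [f]
    rw [ENNReal.mul_rpow_of_nonneg _ _ hq'.le, ENNReal.mul_rpow_of_nonneg _ _ hq0.le,
      ← ENNReal.rpow_mul, hr, one_div_mul_cancel hq'.ne', ENNReal.rpow_one, mul_assoc,
      ← mul_assoc (_ ^ (1 - q)), ← ENNReal.rpow_add_of_nonneg _ _ hq'.le hq0.le, sub_add_cancel,
      ENNReal.rpow_one, ← mul_assoc, rweight_mul s (Nat.zero_le p) hpm x ω]
  refine (le_of_eq (lintegral_congr e)).trans ?_
  refine (ENNReal.lintegral_mul_norm_pow_le hf.aemeasurable (hxm.mul hZ).aemeasurable hq'.le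
    hq0.le (by ring)).trans ?_
  refine mul_le_mul' (ENNReal.rpow_le_rpow (le_of_eq ?_) hq'.le)
    (ENNReal.rpow_le_rpow (le_of_eq ?_) hq0.le)
  · refine (h.lintegral_mul_of_disjoint hd ((measurable_sigma_rweight s 0 p x).pow_const r)
      (measurable_sigma_rweight s p m x)).trans ?_
    rw [h.lintegral_rweight, mul_one, h.lintegral_rweight_rpow s 0 p x hr0.le]
  · simp only [Z, Pi.mul_apply]
    have e2 : ∀ ω, rweight ζ P A s p m x ω * ∫⁻ y in S, rweight ζ P A s 0 m y ω ∂ν =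
        ∫⁻ y in S, rweight ζ P A s p m x ω * rweight ζ P A s 0 m y ω ∂ν := fun ω =>
      (lintegral_const_mul _ (hjm.of_uncurry_right)).symm
    simp_rw [e2]
    rw [lintegral_lintegral_swap]
    · refine lintegral_congr fun y => ?_
      exact h.lintegral_rweight_mul_rweight s hpm x y
    · refine Measurable.aemeasurable ?_
      exact (hxm.comp measurable_fst).mul (hjm.comp measurable_swap)

end IsSiteField

end RealWeight


/-- The covariance of the `k`-th field. -/
def siteCov {I Ω : Type*} {mΩ : MeasurableSpace Ω} (P : Measure Ω) (A : ℕ → I → Ω → ℝ) (k : ℕ)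
    (x y : I) : ℝ := ∫ ω, A k x ω * A k y ω ∂P

/-! ### Exponential decay of the size-biased shell moments. -/

section RealMoments

variable {I Ω : Type*} {mΩ : MeasurableSpace Ω} {P : Measure Ω} [IsProbabilityMeasure P]
  {A : ℕ → I → Ω → ℝ} {ζ : Ω → ℝ} [MetricSpace I]

namespace IsSiteField

/-- Each ratio is at most its Gaussian value exp((r²-r)s²/2) up to a cubic error in the exponent.
The squares up to the checkpoint `n l` sum to at most l, and the cubes stay bounded. -/
lemma exists_prod_mgf_le (h : IsSiteField P A ζ) {D : Set ℂ} {Cb : ℝ}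
    (hb : SiteBounds ζ P D Cb) {t₁ r B δ : ℝ} (ht₁ : 0 ≤ t₁) (hr : 1 ≤ r) :
    ∃ E : ℝ, 0 ≤ E ∧ ∀ (a : ℕ → ℝ) (n : ℕ → ℕ), ScaleBounds a (siteCov P A) n δ B → ∀ t : ℝ,
      0 ≤ t → t ≤ t₁ → (∀ k, ((t * a k : ℝ) : ℂ) ∈ D) → ∀ l,
      ∏ i ∈ Finset.Ico 0 (n l), ENNReal.ofReal (mgf ζ P (r * (t * a i)) / mgf ζ P (t * a i) ^ r) ≤
        ENNReal.ofReal (Real.exp ((r ^ 2 - r) / 2 * t₁ ^ 2 * l + E)) := by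
  obtain ⟨Cm, hCm, hm⟩ := h.std.exists_mgf_le (r * t₁)
  have hCb := hb.nonneg
  refine ⟨(Cm * r ^ 3 + r * Cb) * t₁ ^ 3 * |B|, by positivity, fun a n hs t ht htt hD l => ?_⟩
  have one : ∀ i, mgf ζ P (r * (t * a i)) / mgf ζ P (t * a i) ^ r ≤
      Real.exp ((r ^ 2 - r) / 2 * t₁ ^ 2 * a i ^ 2 + (Cm * r ^ 3 + r * Cb) * t₁ ^ 3 * a i ^ 3) := by
    intro i
    have ha := hs.nonneg i
    have ha1 := hs.le_one i
    have h0 : 0 ≤ t * a i := by positivity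
    have hle : t * a i ≤ t₁ * a i := by gcongr
    have hle1 : t₁ * a i ≤ t₁ := mul_le_of_le_one_right ht₁ ha1
    have hpos := h.std.mgf_pos' (t * a i)
    have u1 := hm (r * (t * a i)) (by
      rw [abs_of_nonneg (by positivity)]; gcongr; linarith)
    have u2 := hb.lower _ (hD i)
    rw [complexMGF_ofReal, Complex.norm_real, Complex.norm_real, Real.norm_of_nonneg hpos.le,
      Real.norm_of_nonneg h0, ← Complex.ofReal_pow, Complex.ofReal_re] at u2
    rw [abs_of_nonneg (by positivity)] at u1
    have u3 : Real.exp (((t * a i) ^ 2 / 2 - Cb * (t * a i) ^ 3) * r) ≤ mgf ζ P (t * a i) ^ r := by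
      rw [Real.exp_mul]
      exact Real.rpow_le_rpow (Real.exp_pos _).le u2 (by linarith)
    rw [div_le_iff₀ (by positivity)]
    refine u1.trans (le_trans ?_ (mul_le_mul_of_nonneg_left u3 (Real.exp_pos _).le))
    rw [← Real.exp_add, Real.exp_le_exp]
    have v2 : (t * a i) ^ 2 ≤ t₁ ^ 2 * a i ^ 2 := by rw [← mul_pow]; gcongr
    have v3 : (t * a i) ^ 3 ≤ t₁ ^ 3 * a i ^ 3 := by rw [← mul_pow]; gcongr
    have w2 : (r ^ 2 - r) / 2 * (t * a i) ^ 2 ≤ (r ^ 2 - r) / 2 * (t₁ ^ 2 * a i ^ 2) := by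
      apply mul_le_mul_of_nonneg_left v2; nlinarith
    have w3 : (Cm * r ^ 3 + r * Cb) * (t * a i) ^ 3 ≤
        (Cm * r ^ 3 + r * Cb) * (t₁ ^ 3 * a i ^ 3) := by gcongr
    have : (r * (t * a i)) ^ 2 / 2 + Cm * (r * (t * a i)) ^ 3 = (r ^ 2 - r) / 2 * (t * a i) ^ 2 +
        (Cm * r ^ 3 + r * Cb) * (t * a i) ^ 3 +
        ((t * a i) ^ 2 / 2 - Cb * (t * a i) ^ 3) * r := by ring
    rw [this]
    linarith
  calc _ ≤ ∏ i ∈ Finset.Ico 0 (n l), ENNReal.ofReal (Real.exp ((r ^ 2 - r) / 2 * t₁ ^ 2 * a i ^ 2 +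
        (Cm * r ^ 3 + r * Cb) * t₁ ^ 3 * a i ^ 3)) :=
        Finset.prod_le_prod' fun i _ => ENNReal.ofReal_le_ofReal (one i)
    _ ≤ _ := by
        rw [← ENNReal.ofReal_prod_of_nonneg fun i _ => (Real.exp_pos _).le, ← Real.exp_sum,
          Finset.sum_add_distrib, ← Finset.mul_sum, ← Finset.mul_sum, ← Finset.range_eq_Ico]
        apply ENNReal.ofReal_le_ofReal
        rw [Real.exp_le_exp]
        have : 0 ≤ (r ^ 2 - r) / 2 := by nlinarith
        have h1 := hs.var l
        have h2 := (hs.cube (n l)).trans (le_abs_self B)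
        gcongr

/-- Points of the shell l < j are at distance more than e^{-(l+1)}, where the covariances of the
fields after `n l` have a bounded weighted sum. For l = j the product is empty. -/
lemma exists_prod_two_point_le (h : IsSiteField P A ζ) {D : Set ℂ} {Cb : ℝ}
    (hb : SiteBounds ζ P D Cb) {t₁ B δ : ℝ} (ht₁ : 0 ≤ t₁) :
    ∃ E : ℝ, 0 ≤ E ∧ ∀ (a : ℕ → ℝ) (n : ℕ → ℕ), ScaleBounds a (siteCov P A) n δ B → ∀ t : ℝ,
      0 ≤ t → t ≤ t₁ → (∀ k, ((t * a k : ℝ) : ℂ) ∈ D) → ∀ l j, l ≤ j → ∀ x, ∀ y ∈ shell l j x,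
      ∏ i ∈ Finset.Ico (n l) (n j), ∫⁻ ω, ENNReal.ofReal (rsite ζ P (t * a i) (A i x ω)) *
        ENNReal.ofReal (rsite ζ P (t * a i) (A i y ω)) ∂P ≤ ENNReal.ofReal (Real.exp E) := by
  have hCb := hb.nonneg
  refine ⟨t₁ ^ 2 * |B| + (1 + Cb + Cb * t₁) * t₁ ^ 3 * |B|, by positivity,
    fun a n hs t ht htt hD l j hlj x y hy => ?_⟩
  rcases hlj.eq_or_lt with rfl | hlj'
  · simp only [Finset.Ico_self, Finset.prod_empty]
    rw [← ENNReal.ofReal_one]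
    exact ENNReal.ofReal_le_ofReal (Real.one_le_exp (by positivity))
  have one : ∀ i, ∫⁻ ω, ENNReal.ofReal (rsite ζ P (t * a i) (A i x ω)) *
        ENNReal.ofReal (rsite ζ P (t * a i) (A i y ω)) ∂P ≤
      ENNReal.ofReal (Real.exp (t₁ ^ 2 * (a i ^ 2 * |siteCov P A i x y|) +
        (1 + Cb + Cb * t₁) * t₁ ^ 3 * a i ^ 3)) := by
    intro i
    have ha := hs.nonneg i
    have ha1 := hs.le_one i
    have h0 : 0 ≤ t * a i := by positivity
    have hle : t * a i ≤ t₁ * a i := by gcongr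
    have hle1 : t₁ * a i ≤ t₁ := mul_le_of_le_one_right ht₁ ha1
    have hp := h.std.rsite_pos (t * a i)
    simp_rw [← ENNReal.ofReal_mul (hp _).le]
    have m2 : ∀ x, MemLp (fun ω => rsite ζ P (t * a i) (A i x ω)) 2 P := by
      intro x
      have := (h.l2On_site (complexMGF ζ P) ((t * a i : ℝ) : ℂ) i x).memLp
      simp_rw [← IsStandardExp.ofReal_rsite] at this
      simpa using this.re
    have i2 : Integrable (fun ω => rsite ζ P (t * a i) (A i x ω) *
      rsite ζ P (t * a i) (A i y ω)) P := (m2 x).integrable_mul (m2 y)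
    rw [← ofReal_integral_eq_lintegral_ofReal i2
      (ae_of_all _ fun ω => mul_nonneg (hp _).le (hp _).le)]
    refine ENNReal.ofReal_le_ofReal ?_
    refine (IsStandardExp.integral_rsite_mul_le hb (hD i) (M := t₁) (by
      rw [abs_of_nonneg h0]; linarith) (h.isStandardExp i x) (h.isStandardExp i y) (h.ident i x)
      (h.ident i y) h.std).trans ?_
    rw [Real.exp_le_exp, abs_of_nonneg h0]
    have v2 : (t * a i) ^ 2 ≤ t₁ ^ 2 * a i ^ 2 := by rw [← mul_pow]; gcongr
    have v3 : (t * a i) ^ 3 ≤ t₁ ^ 3 * a i ^ 3 := by rw [← mul_pow]; gcongr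
    rw [mul_assoc _ (t₁ ^ 3), ← mul_assoc (t₁ ^ 2)]
    unfold siteCov
    gcongr
  calc _ ≤ ∏ i ∈ Finset.Ico (n l) (n j), ENNReal.ofReal (Real.exp
        (t₁ ^ 2 * (a i ^ 2 * |siteCov P A i x y|) + (1 + Cb + Cb * t₁) * t₁ ^ 3 * a i ^ 3)) :=
        Finset.prod_le_prod' fun i _ => one i
    _ ≤ _ := by
        rw [← ENNReal.ofReal_prod_of_nonneg fun i _ => (Real.exp_pos _).le, ← Real.exp_sum,
          Finset.sum_add_distrib, ← Finset.mul_sum, ← Finset.mul_sum]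
        apply ENNReal.ofReal_le_ofReal
        rw [Real.exp_le_exp]
        have h1 := (hs.far l j hlj x y (hy.1 hlj')).trans (le_abs_self B)
        have h2 : ∑ i ∈ Finset.Ico (n l) (n j), a i ^ 3 ≤ |B| := by
          refine le_trans ?_ ((hs.cube (n j)).trans (le_abs_self B))
          refine Finset.sum_le_sum_of_subset_of_nonneg ?_ fun i _ _ => pow_nonneg (hs.nonneg i) 3
          intro i; simp
        gcongr

variable [SecondCountableTopology I] [MeasurableSpace I] [BorelSpace I]

/-- The size-biased moment of order `q` of the mass of a shell decays exponentially. -/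
lemma exists_shell_moment_le (h : IsSiteField P A ζ) (ν : Measure I) [IsFiniteMeasure ν]
    {D : Set ℂ} {Cb : ℝ} (hb : SiteBounds ζ P D Cb) {Cν dd : ℝ} (hCν : 0 ≤ Cν)
    (hν : ∀ l j x, ν (shell l j x) ≤ ENNReal.ofReal (Cν * Real.exp (-(dd * l))))
    {t₁ q B δ : ℝ} (ht₁ : 0 ≤ t₁) (hq0 : 0 < q) (hq1 : q < 1) :
    ∃ C : ℝ, 0 ≤ C ∧ ∀ (a : ℕ → ℝ) (n : ℕ → ℕ), ScaleBounds a (siteCov P A) n δ B → ∀ t : ℝ,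
      0 ≤ t → t ≤ t₁ → (∀ k, ((t * a k : ℝ) : ℂ) ∈ D) → ∀ l j, l ≤ j → ∀ x,
      ∫⁻ ω, rweight ζ P A (fun k => t * a k) 0 (n j) x ω *
          (∫⁻ y in shell l j x, rweight ζ P A (fun k => t * a k) 0 (n j) y ω ∂ν) ^ q ∂P ≤
        ENNReal.ofReal (C * Real.exp (-(q * (dd - t₁ ^ 2 / (2 * (1 - q))) * l))) := by
  have hq' : 0 < 1 - q := by linarith
  have hr : 1 ≤ 1 / (1 - q) := by rw [le_div_iff₀ hq']; linarith
  obtain ⟨E₁, hE₁, h1⟩ := h.exists_prod_mgf_le (δ := δ) (B := B) hb ht₁ hr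
  obtain ⟨E₂, hE₂, h2⟩ := h.exists_prod_two_point_le (δ := δ) (B := B) hb ht₁
  refine ⟨Real.exp ((1 - q) * E₁) * (Real.exp E₂ * Cν) ^ q, by positivity,
    fun a n hs t ht htt hD l j hlj x => ?_⟩
  -- The weight is split at `n l`, the scale of the shell: earlier fields are strongly correlated
  -- across it, later ones hardly.
  refine (h.lintegral_rweight_mul_rpow_le ν _ (hs.mono hlj) x (shell l j x) hq0 hq1).trans ?_
  have b1 := h1 a n hs t ht htt hD l
  have b2 : ∫⁻ y in shell l j x, ∏ i ∈ Finset.Ico (n l) (n j),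
      ∫⁻ ω, ENNReal.ofReal (rsite ζ P (t * a i) (A i x ω)) *
        ENNReal.ofReal (rsite ζ P (t * a i) (A i y ω)) ∂P ∂ν ≤
      ENNReal.ofReal (Real.exp E₂ * (Cν * Real.exp (-(dd * l)))) := by
    calc _ ≤ ∫⁻ y in shell l j x, ENNReal.ofReal (Real.exp E₂) ∂ν :=
          setLIntegral_mono' (measurableSet_shell l j x) fun y hy =>
            h2 a n hs t ht htt hD l j hlj x y hy
      _ = ENNReal.ofReal (Real.exp E₂) * ν (shell l j x) := setLIntegral_const _ _
      _ ≤ _ := by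
          rw [ENNReal.ofReal_mul (Real.exp_pos _).le]
          gcongr
          exact hν l j x
  calc _ ≤ ENNReal.ofReal (Real.exp (((1 / (1 - q)) ^ 2 - 1 / (1 - q)) / 2 * t₁ ^ 2 * l + E₁)) ^
          (1 - q) * ENNReal.ofReal (Real.exp E₂ * (Cν * Real.exp (-(dd * l)))) ^ q := by
        gcongr
    _ = _ := by
        rw [ENNReal.ofReal_rpow_of_pos (Real.exp_pos _),
          ENNReal.ofReal_rpow_of_nonneg (by positivity) hq0.le,
          ← ENNReal.ofReal_mul (by positivity)]
        congr 1
        rw [← mul_assoc, Real.mul_rpow (x := Real.exp E₂ * Cν) (by positivity) (by positivity),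
          ← Real.exp_mul, ← Real.exp_mul]
        -- With r = 1/(1-q) one has (r² - r)(1-q) = q/(1-q). The one-point factor thus grows at rate
        -- q t₁²/(2(1-q)) in l, against the decay at rate q·dd coming from the measure of the shell.
        have e1 : (((1 / (1 - q)) ^ 2 - 1 / (1 - q)) / 2 * t₁ ^ 2 * l + E₁) * (1 - q) =
            (1 - q) * E₁ + q * (t₁ ^ 2 / (2 * (1 - q))) * l := by
          field_simp; ring
        have e2 : -(q * (dd - t₁ ^ 2 / (2 * (1 - q))) * l) =
            q * (t₁ ^ 2 / (2 * (1 - q))) * l + -(dd * l) * q := by ring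
        rw [e1, e2, Real.exp_add, Real.exp_add]
        ring

end IsSiteField

end RealMoments


/-! ### Fractional moments of random quadratic forms. -/

lemma ennreal_sum_rpow_le {ι : Type*} (s : Finset ι) (f : ι → ENNReal) {q : ℝ} (hq0 : 0 < q)
    (hq1 : q ≤ 1) : (∑ i ∈ s, f i) ^ q ≤ ∑ i ∈ s, f i ^ q := by
  classical
  induction s using Finset.induction_on with
  | empty => simp [hq0]
  | insert a s ha ih =>
    rw [Finset.sum_insert ha, Finset.sum_insert ha]
    exact (ENNReal.rpow_add_le_add_rpow _ _ hq0.le hq1).trans (by gcongr)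

section KernelMoment

variable {I Ω : Type*} {mΩ : MeasurableSpace Ω} {P : Measure Ω} [SFinite P] [MeasurableSpace I]
  {ν : Measure I} [SFinite ν]

omit [SFinite ν] in
lemma lintegral_mul_kernel_le {w : I → ENNReal} (hw : Measurable w) {k : I → ENNReal}
    {J : Finset ℕ} {S : ℕ → Set I} (hS : ∀ l, MeasurableSet (S l)) {c : ℕ → ENNReal}
    (hk : ∀ y, ∃ l ∈ J, y ∈ S l ∧ k y ≤ c l) :
    ∫⁻ y, w y * k y ∂ν ≤ ∑ l ∈ J, c l * ∫⁻ y in S l, w y ∂ν := by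
  calc ∫⁻ y, w y * k y ∂ν ≤ ∫⁻ y, ∑ l ∈ J, c l * (S l).indicator w y ∂ν := by
        refine lintegral_mono fun y => ?_
        obtain ⟨l, hl, hy, hle⟩ := hk y
        calc w y * k y ≤ c l * (S l).indicator w y := by
              rw [Set.indicator_of_mem hy, mul_comm]; gcongr
          _ ≤ _ := Finset.single_le_sum (f := fun l => c l * (S l).indicator w y)
              (fun _ _ => zero_le) hl
    _ = _ := by
        rw [lintegral_finsetSum _ fun l _ => (hw.indicator (hS l)).const_mul _]
        refine Finset.sum_congr rfl fun l _ => ?_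
        rw [lintegral_const_mul _ (hw.indicator (hS l)), lintegral_indicator (hS l)]

/-- A moment of order `(1 + q) / 2` of a quadratic form is controlled by size-biased moments. -/
lemma lintegral_quadratic_rpow_le {w : I → Ω → ENNReal} (hw : Measurable (Function.uncurry w))
    (hwt : ∀ x ω, w x ω ≠ ⊤)
    {k : I → I → ENNReal} {J : Finset ℕ} {S : ℕ → I → Set I}
    (hS : ∀ l, MeasurableSet {p : I × I | p.2 ∈ S l p.1}) {c : ℕ → ENNReal} {Bk : ENNReal}
    (hkB : ∀ x y, k x y ≤ Bk) (hk : ∀ x y, ∃ l ∈ J, y ∈ S l x ∧ k x y ≤ c l)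
    {q : ℝ} (hq0 : 0 < q) (hq1 : q < 1) :
    ∫⁻ ω, (∫⁻ x, ∫⁻ y, w x ω * w y ω * k x y ∂ν ∂ν) ^ ((1 + q) / 2) ∂P ≤
      Bk ^ ((1 - q) * ((1 + q) / 2)) *
      ((∫⁻ x, ∑ l ∈ J, ∫⁻ ω, w x ω * (∫⁻ y in S l x, w y ω ∂ν) ^ q ∂P ∂ν) ^ ((1 - q) / 2) *
      (∫⁻ x, ∑ l ∈ J, c l ^ q * ∫⁻ ω, w x ω * (∫⁻ y in S l x, w y ω ∂ν) ^ q ∂P ∂ν) ^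
        ((1 + q) / 2)) := by
  have hq' : 0 < 1 - q := by linarith
  have hSx : ∀ l x, MeasurableSet (S l x) := fun l x => measurable_prodMk_left (hS l)
  have hwx : ∀ x, Measurable (w x) := fun x => hw.comp measurable_prodMk_left
  have hwω : ∀ ω, Measurable fun x => w x ω := fun ω => hw.comp measurable_prodMk_right
  set m : ℕ → I → Ω → ENNReal := fun l x ω => ∫⁻ y in S l x, w y ω ∂ν with hm
  have hmm : ∀ l, Measurable fun p : I × Ω => m l p.1 p.2 := by
    intro l
    have e : (fun p : I × Ω => m l p.1 p.2) = fun p : I × Ω =>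
        ∫⁻ y, ({p : I × I | p.2 ∈ S l p.1}.indicator 1 (p.1, y) : ENNReal) * w y p.2 ∂ν := by
      funext p
      simp only [hm]
      rw [← lintegral_indicator (hSx l p.1)]
      refine lintegral_congr fun y => ?_
      by_cases hy : y ∈ S l p.1 <;> simp [Set.indicator, hy]
    rw [e]
    refine Measurable.lintegral_prod_right' (f := fun z : (I × Ω) × I =>
      ({p : I × I | p.2 ∈ S l p.1}.indicator 1 (z.1.1, z.2) : ENNReal) * w z.2 z.1.2) ?_
    refine Measurable.mul ?_ (hw.comp (measurable_snd.prodMk (measurable_snd.comp measurable_fst)))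
    exact (measurable_one.indicator (hS l)).comp
      ((measurable_fst.comp measurable_fst).prodMk measurable_snd)
  set M : Ω → ENNReal := fun ω => ∫⁻ y, w y ω ∂ν with hM
  have hMm : Measurable M := hw.lintegral_prod_left'
  set G : (ℕ → ENNReal) → Ω → ENNReal := fun γ ω => ∫⁻ x, w x ω * ∑ l ∈ J, γ l * m l x ω ^ q ∂ν
    with hG
  have hGi : ∀ γ : ℕ → ENNReal, Measurable (fun p : I × Ω => w p.1 p.2 *
      ∑ l ∈ J, γ l * m l p.1 p.2 ^ q) := fun γ =>
    hw.mul (Finset.measurable_fun_sum _ fun l _ => ((hmm l).pow_const q).const_mul (γ l))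
  have hGm : ∀ γ, Measurable (G γ) := fun γ => (hGi γ).lintegral_prod_left'
  have hGE : ∀ γ, ∫⁻ ω, G γ ω ∂P = ∫⁻ x, ∑ l ∈ J, γ l * ∫⁻ ω, w x ω * m l x ω ^ q ∂P ∂ν := by
    intro γ
    simp only [hG]
    rw [lintegral_lintegral_swap (f := fun ω x => w x ω * ∑ l ∈ J, γ l * m l x ω ^ q)
      ((hGi γ).comp measurable_swap).aemeasurable]
    refine lintegral_congr fun x => ?_
    have hmx : ∀ l, Measurable fun ω => m l x ω := fun l => (hmm l).comp measurable_prodMk_left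
    have h1 : ∀ l, Measurable fun ω => w x ω * m l x ω ^ q := fun l =>
      (hwx x).mul ((hmx l).pow_const q)
    have h2 : ∀ ω, w x ω * ∑ l ∈ J, γ l * m l x ω ^ q =
        ∑ l ∈ J, γ l * (w x ω * m l x ω ^ q) := fun ω => by
      rw [Finset.mul_sum]
      exact Finset.sum_congr rfl fun l _ => by ring
    rw [lintegral_congr h2, lintegral_finsetSum _ fun l _ => (h1 l).const_mul (γ l)]
    exact Finset.sum_congr rfl fun l _ => lintegral_const_mul _ (h1 l)
  -- Write M^{1+q} as the integral of w(x) M^q and cut the inner M into shells around x; the power q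
  -- ≤ 1 is subadditive.
  have hM1 : ∀ ω, M ω ^ (1 + q) ≤ G 1 ω := by
    intro ω
    rw [ENNReal.rpow_add_of_nonneg _ _ zero_le_one hq0.le, ENNReal.rpow_one]
    simp only [hG, hM]
    rw [← lintegral_mul_const _ (hwω ω)]
    refine lintegral_mono fun x => ?_
    gcongr
    have h1 : ∫⁻ y, w y ω ∂ν ≤ ∑ l ∈ J, m l x ω := by
      have := lintegral_mul_kernel_le (ν := ν) (hwω ω) (k := fun _ => 1) (J := J)
        (S := fun l => S l x) (fun l => hSx l x) (c := fun _ => 1) fun y => by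
          obtain ⟨l, hl, hy, _⟩ := hk x y
          exact ⟨l, hl, hy, le_rfl⟩
      simpa using this
    refine (ENNReal.rpow_le_rpow h1 hq0.le).trans ((ennreal_sum_rpow_le _ _ hq0 hq1.le).trans ?_)
    simp
  -- The inner integral D is split as D^{1-q} D^q: the first power is bounded crudely by the total
  -- mass, the second by the shells, which retains the decay of the kernel.
  have hQ : ∀ ω, ∫⁻ x, ∫⁻ y, w x ω * w y ω * k x y ∂ν ∂ν ≤
      Bk ^ (1 - q) * (M ω ^ (1 - q) * G (fun l => c l ^ q) ω) := by
    intro ω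
    simp only [hG]
    rw [← mul_assoc, ← lintegral_const_mul _
      (Measurable.of_uncurry_right (f := fun x ω => w x ω * ∑ l ∈ J, c l ^ q * m l x ω ^ q)
        (hGi fun l => c l ^ q))]
    refine lintegral_mono fun x => ?_
    set Dx : ENNReal := ∫⁻ y, w y ω * k x y ∂ν with hDx
    have e1 : ∫⁻ y, w x ω * w y ω * k x y ∂ν ≤ w x ω * Dx := by
      have hle : ∫⁻ y, w x ω * w y ω * k x y ∂ν = ∫⁻ y, w x ω * (w y ω * k x y) ∂ν :=
        lintegral_congr fun y => mul_assoc _ _ _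
      rw [hle, lintegral_const_mul' _ _ (hwt x ω)]
    have e2 : Dx ≤ Bk * M ω := by
      simp only [hDx, hM]
      rw [← lintegral_const_mul _ (hwω ω)]
      refine lintegral_mono fun y => ?_
      rw [mul_comm]
      gcongr
      exact hkB x y
    have e3 : Dx ^ q ≤ ∑ l ∈ J, c l ^ q * m l x ω ^ q := by
      have := lintegral_mul_kernel_le (ν := ν) (hwω ω) (k := k x) (J := J)
        (S := fun l => S l x) (fun l => hSx l x) (c := c) (hk x)
      refine (ENNReal.rpow_le_rpow this hq0.le).trans
        ((ennreal_sum_rpow_le _ _ hq0 hq1.le).trans (le_of_eq ?_))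
      exact Finset.sum_congr rfl fun l _ => ENNReal.mul_rpow_of_nonneg _ _ hq0.le
    have e4 : Dx = Dx ^ (1 - q) * Dx ^ q := by
      rw [← ENNReal.rpow_add_of_nonneg _ _ hq'.le hq0.le, sub_add_cancel, ENNReal.rpow_one]
    refine e1.trans ?_
    calc w x ω * Dx ≤ w x ω * ((Bk * M ω) ^ (1 - q) * ∑ l ∈ J, c l ^ q * m l x ω ^ q) := by
          rw [e4]; gcongr
      _ = _ := by rw [ENNReal.mul_rpow_of_nonneg _ _ hq'.le]; ring
  have hp : 0 ≤ (1 + q) / 2 := by linarith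
  calc _ ≤ ∫⁻ ω, Bk ^ ((1 - q) * ((1 + q) / 2)) * ((G 1 ω) ^ ((1 - q) / 2) *
        G (fun l => c l ^ q) ω ^ ((1 + q) / 2)) ∂P := by
        refine lintegral_mono fun ω => ?_
        refine (ENNReal.rpow_le_rpow (hQ ω) hp).trans ?_
        rw [ENNReal.mul_rpow_of_nonneg _ _ hp, ENNReal.mul_rpow_of_nonneg _ _ hp,
          ← ENNReal.rpow_mul, ← ENNReal.rpow_mul]
        -- The exponents (1-q)/2 and (1+q)/2 of the two quantities G add up to one, so Hölder's
        -- inequality below leaves only their expectations, which are sums of size-biased moments.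
        have : M ω ^ ((1 - q) * ((1 + q) / 2)) ≤ G 1 ω ^ ((1 - q) / 2) := by
          rw [show (1 - q) * ((1 + q) / 2) = (1 + q) * ((1 - q) / 2) by ring, ENNReal.rpow_mul]
          exact ENNReal.rpow_le_rpow (hM1 ω) (by linarith)
        gcongr
    _ = Bk ^ ((1 - q) * ((1 + q) / 2)) * ∫⁻ ω, (G 1 ω) ^ ((1 - q) / 2) *
        G (fun l => c l ^ q) ω ^ ((1 + q) / 2) ∂P :=
        lintegral_const_mul _ (((hGm 1).pow_const _).mul ((hGm _).pow_const _))
    _ ≤ _ := by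
        gcongr
        refine (ENNReal.lintegral_mul_norm_pow_le (hGm 1).aemeasurable (hGm _).aemeasurable
          (by linarith) hp (by ring)).trans (le_of_eq ?_)
        rw [hGE, hGE]
        simp only [hm, Pi.one_apply, one_mul]

end KernelMoment


/-! ### Kernel decay against shell moments. -/

lemma measurableSet_shell_prod {I : Type*} [PseudoMetricSpace I] [SecondCountableTopology I]
    [MeasurableSpace I] [OpensMeasurableSpace I] (l j : ℕ) :
    MeasurableSet {p : I × I | p.2 ∈ shell l j p.1} := by
  have h1 : MeasurableSet {p : I × I | Real.exp (-(l + 1)) < dist p.1 p.2} :=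
    (isOpen_lt continuous_const (continuous_fst.dist continuous_snd)).measurableSet
  have h2 : MeasurableSet {p : I × I | dist p.1 p.2 ≤ Real.exp (-l)} :=
    (isClosed_le (continuous_fst.dist continuous_snd) continuous_const).measurableSet
  by_cases hl : l < j <;> by_cases hl' : 0 < l <;>
    simp only [shell, hl, hl', true_imp_iff, false_imp_iff, true_and, and_true, Set.mem_ofPred_eq,
      Set.ofPred_true, Set.mem_univ, MeasurableSet.univ]
  · exact h1.inter h2
  · exact h1
  · exact h2

lemma rweight_ne_top {I Ω : Type*} {mΩ : MeasurableSpace Ω} {P : Measure Ω}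
    {A : ℕ → I → Ω → ℝ} {ζ : Ω → ℝ} (s : ℕ → ℝ) (a b : ℕ) (x : I) (ω : Ω) :
    rweight ζ P A s a b x ω ≠ ⊤ :=
  ENNReal.prod_ne_top fun _ _ => ENNReal.ofReal_ne_top

lemma add_one_le_mul_exp {m : ℝ} (hm : 0 < m) (j : ℕ) :
    (j : ℝ) + 1 ≤ (1 + 2 / m) * Real.exp (m * j / 2) := by
  have h1 : m * j / 2 ≤ Real.exp (m * j / 2) := by
    linarith [Real.add_one_le_exp (m * j / 2)]
  have h2 : (1 : ℝ) ≤ Real.exp (m * j / 2) := Real.one_le_exp (by positivity)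
  have h3 : (j : ℝ) = 2 / m * (m * j / 2) := by field_simp
  have h4 : 2 / m * (m * j / 2) ≤ 2 / m * Real.exp (m * j / 2) := by gcongr
  linarith

/-- The exponential rate of decay of the block contributions. -/
def blockRate (dd t₁ q δ : ℝ) : ℝ :=
  min (δ * q) (q * (dd - t₁ ^ 2 / (2 * (1 - q)))) / 2 * ((1 + q) / 2)

/-- Both decays have rate at least `m`, so each term is at most e^{-mj}; absorbing the number j + 1
of terms costs half of the rate. -/
lemma sum_shell_le {j : ℕ} {κ γ m : ℝ} (hm : 0 < m) (hκ : m ≤ κ) (hγ : m ≤ γ) :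
    ∑ l ∈ Finset.range (j + 1), Real.exp (-(γ * (j - l))) * Real.exp (-(κ * l)) ≤
      (1 + 2 / m) * Real.exp (-(m / 2 * j)) := by
  calc ∑ l ∈ Finset.range (j + 1), Real.exp (-(γ * (j - l))) * Real.exp (-(κ * l))
      ≤ ∑ l ∈ Finset.range (j + 1), Real.exp (-(m * j)) := by
        refine Finset.sum_le_sum fun l hl => ?_
        rw [← Real.exp_add]
        refine Real.exp_le_exp.2 ?_
        have h1 : (l : ℝ) ≤ j := by
          exact_mod_cast Nat.lt_succ_iff.1 (Finset.mem_range.1 hl)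
        have h2 : m * (j - l) ≤ γ * (j - l) :=
          mul_le_mul_of_nonneg_right hγ (by linarith)
        have h3 : m * l ≤ κ * l := mul_le_mul_of_nonneg_right hκ (Nat.cast_nonneg l)
        linarith
    _ = (j + 1) * Real.exp (-(m * j)) := by simp
    _ ≤ (1 + 2 / m) * Real.exp (m * j / 2) * Real.exp (-(m * j)) := by
        gcongr
        exact add_one_le_mul_exp hm j
    _ = _ := by
        rw [mul_assoc, ← Real.exp_add]
        congr 2
        ring

section

variable {I Ω : Type*} {mΩ : MeasurableSpace Ω} {P : Measure Ω} [IsProbabilityMeasure P]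
  {A : ℕ → I → Ω → ℝ} {ζ : Ω → ℝ} [MetricSpace I] [SecondCountableTopology I]
  [MeasurableSpace I] [BorelSpace I]

namespace IsSiteField

/-- The kernel is small on coarse shells and the size-biased mass is small on fine ones, so the sum
over shells decays exponentially in j. The constant is chosen before `a` and `n`, which allows
truncated checkpoints later. -/
lemma exists_quadratic_moment_le (h : IsSiteField P A ζ) (ν : Measure I) [IsFiniteMeasure ν]
    {D : Set ℂ} {Cb : ℝ} (hb : SiteBounds ζ P D Cb) {Cν dd : ℝ} (hCν : 0 ≤ Cν)
    (hν : ∀ l j x, ν (shell l j x) ≤ ENNReal.ofReal (Cν * Real.exp (-(dd * l))))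
    {t₁ q B δ Bk : ℝ} (ht₁ : 0 ≤ t₁) (hq0 : 0 < q) (hq1 : q < 1) (hδ : 0 < δ) (hBk : 0 ≤ Bk)
    (hκ : t₁ ^ 2 / (2 * (1 - q)) < dd) :
    ∃ C : ℝ, 0 ≤ C ∧ ∀ (a : ℕ → ℝ) (n : ℕ → ℕ), ScaleBounds a (siteCov P A) n δ B → ∀ t : ℝ,
      0 ≤ t → t ≤ t₁ → (∀ k, ((t * a k : ℝ) : ℂ) ∈ D) → ∀ (j : ℕ) (K : I → I → ENNReal),
      (∀ l ≤ j, ∀ x, ∀ y ∈ shell l j x,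
        K x y ≤ ENNReal.ofReal (Bk * Real.exp (-(δ * (j - l))))) →
      ∫⁻ ω, (∫⁻ x, ∫⁻ y, rweight ζ P A (fun k => t * a k) 0 (n j) x ω *
          rweight ζ P A (fun k => t * a k) 0 (n j) y ω * K x y ∂ν ∂ν) ^ ((1 + q) / 2) ∂P ≤
        ENNReal.ofReal (C * Real.exp (-(blockRate dd t₁ q δ * j))) := by
  obtain ⟨C, hC, H⟩ := h.exists_shell_moment_le (B := B) (δ := δ) ν hb hCν hν ht₁ hq0 hq1
  set κ : ℝ := q * (dd - t₁ ^ 2 / (2 * (1 - q))) with hκd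
  have hκ0 : 0 < κ := mul_pos hq0 (by linarith)
  set m : ℝ := min (δ * q) κ with hm
  have hm0 : 0 < m := lt_min (mul_pos hδ hq0) hκ0
  have hr : ∀ j : ℕ, blockRate dd t₁ q δ * j = m / 2 * j * ((1 + q) / 2) := fun j => by
    rw [blockRate]; ring
  set N : ℝ := (ν Set.univ).toReal with hN
  have hNν : ν Set.univ = ENNReal.ofReal N := (ENNReal.ofReal_toReal (measure_ne_top _ _)).symm
  have hN0 : 0 ≤ N := ENNReal.toReal_nonneg
  set G : ℝ := ∑' l : ℕ, Real.exp (-κ) ^ l with hG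
  have hG1 : Real.exp (-κ) < 1 := (Real.exp_lt_one_iff (x := -κ)).2 (by linarith)
  have hG0 : 0 ≤ G := tsum_nonneg fun l => by positivity
  have hp : 0 ≤ (1 + q) / 2 := by linarith
  have hp' : 0 ≤ (1 - q) / 2 := by linarith
  have hqq : 0 ≤ (1 - q) * ((1 + q) / 2) := by nlinarith
  refine ⟨Bk ^ ((1 - q) * ((1 + q) / 2)) * ((C * G * N) ^ ((1 - q) / 2) *
    (Bk ^ q * C * (1 + 2 / m) * N) ^ ((1 + q) / 2)), by positivity,
    fun a n hs t ht htt hD j K hK => ?_⟩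
  have hKB : ∀ x y, K x y ≤ ENNReal.ofReal Bk := fun x y => by
    obtain ⟨l, hl, hy⟩ := exists_mem_shell j x y
    refine (hK l hl x y hy).trans (ENNReal.ofReal_le_ofReal ?_)
    have hl' : (l : ℝ) ≤ j := by exact_mod_cast hl
    refine mul_le_of_le_one_right hBk (Real.exp_le_one_iff.2 ?_)
    have := mul_nonneg hδ.le (sub_nonneg.2 hl')
    linarith
  refine (lintegral_quadratic_rpow_le (h.measurable_uncurry_rweight (fun k => t * a k) 0 (n j))
    (rweight_ne_top _ _ _) (J := Finset.range (j + 1)) (S := fun l => shell l j)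
    (fun l => measurableSet_shell_prod l j)
    (c := fun l => ENNReal.ofReal (Bk * Real.exp (-(δ * (j - l))))) hKB (fun x y => by
      obtain ⟨l, hl, hy⟩ := exists_mem_shell j x y
      exact ⟨l, Finset.mem_range.2 (by omega), hy, hK l hl x y hy⟩) hq0 hq1).trans ?_
  have hS : ∀ l ∈ Finset.range (j + 1), ∀ x,
      ∫⁻ ω, rweight ζ P A (fun k => t * a k) 0 (n j) x ω *
          (∫⁻ y in shell l j x, rweight ζ P A (fun k => t * a k) 0 (n j) y ω ∂ν) ^ q ∂P ≤
        ENNReal.ofReal (C * Real.exp (-(κ * l))) := fun l hl x =>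
    H a n hs t ht htt hD l j (by have := Finset.mem_range.1 hl; omega) x
  have b1 : ∫⁻ x, ∑ l ∈ Finset.range (j + 1),
      ∫⁻ ω, rweight ζ P A (fun k => t * a k) 0 (n j) x ω *
          (∫⁻ y in shell l j x, rweight ζ P A (fun k => t * a k) 0 (n j) y ω ∂ν) ^ q ∂P ∂ν ≤
        ENNReal.ofReal (C * G * N) := by
    calc _ ≤ ∫⁻ _x, ENNReal.ofReal (C * G) ∂ν := by
          refine lintegral_mono fun x => (Finset.sum_le_sum fun l hl => hS l hl x).trans ?_
          rw [← ENNReal.ofReal_sum_of_nonneg fun l _ => by positivity, ← Finset.mul_sum]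
          refine ENNReal.ofReal_le_ofReal (mul_le_mul_of_nonneg_left ?_ hC)
          have e : ∀ l : ℕ, Real.exp (-(κ * l)) = Real.exp (-κ) ^ l := fun l => by
            rw [← Real.exp_nat_mul]; congr 1; ring
          simp_rw [e]
          exact (summable_geometric_of_lt_one (Real.exp_pos _).le hG1).sum_le_tsum _
            fun l _ => by positivity
      _ = _ := by
          rw [lintegral_const, hNν, ← ENNReal.ofReal_mul (by positivity)]
  have b2 : ∫⁻ x, ∑ l ∈ Finset.range (j + 1),
      ENNReal.ofReal (Bk * Real.exp (-(δ * (j - l)))) ^ q *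
      ∫⁻ ω, rweight ζ P A (fun k => t * a k) 0 (n j) x ω *
          (∫⁻ y in shell l j x, rweight ζ P A (fun k => t * a k) 0 (n j) y ω ∂ν) ^ q ∂P ∂ν ≤
        ENNReal.ofReal (Bk ^ q * C * (1 + 2 / m) * N * Real.exp (-(m / 2 * j))) := by
    calc _ ≤ ∫⁻ _x, ENNReal.ofReal (Bk ^ q * C * ((1 + 2 / m) * Real.exp (-(m / 2 * j)))) ∂ν := by
          refine lintegral_mono fun x => ?_
          calc _ ≤ ∑ l ∈ Finset.range (j + 1), ENNReal.ofReal (Bk ^ q * C *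
                (Real.exp (-(δ * q * (j - l))) * Real.exp (-(κ * l)))) := by
                refine Finset.sum_le_sum fun l hl => ?_
                refine (mul_le_mul_right (hS l hl x) _).trans (le_of_eq ?_)
                rw [ENNReal.ofReal_rpow_of_nonneg (by positivity) hq0.le,
                  ← ENNReal.ofReal_mul (by positivity),
                  Real.mul_rpow hBk (Real.exp_pos _).le, ← Real.exp_mul]
                congr 1
                rw [show -(δ * ((j : ℝ) - l)) * q = -(δ * q * (j - l)) by ring]
                ring
            _ ≤ _ := by
                rw [← ENNReal.ofReal_sum_of_nonneg fun l _ => by positivity, ← Finset.mul_sum]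
                refine ENNReal.ofReal_le_ofReal (mul_le_mul_of_nonneg_left ?_ (by positivity))
                exact sum_shell_le hm0 (min_le_right _ _) (min_le_left _ _)
      _ = _ := by
          rw [lintegral_const, hNν, ← ENNReal.ofReal_mul (by positivity)]
          congr 1; ring
  calc _ ≤ ENNReal.ofReal Bk ^ ((1 - q) * ((1 + q) / 2)) *
        (ENNReal.ofReal (C * G * N) ^ ((1 - q) / 2) *
        ENNReal.ofReal (Bk ^ q * C * (1 + 2 / m) * N * Real.exp (-(m / 2 * j))) ^
          ((1 + q) / 2)) := by gcongr
    _ = _ := by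
        rw [ENNReal.ofReal_rpow_of_nonneg hBk hqq,
          ENNReal.ofReal_rpow_of_nonneg (by positivity) hp',
          ENNReal.ofReal_rpow_of_nonneg (by positivity) hp,
          ← ENNReal.ofReal_mul (by positivity), ← ENNReal.ofReal_mul (by positivity),
          Real.mul_rpow (x := Bk ^ q * C * (1 + 2 / m) * N) (by positivity) (Real.exp_pos _).le,
          ← Real.exp_mul, hr]
        congr 1
        rw [show -(m / 2 * (j : ℝ)) * ((1 + q) / 2) = -(m / 2 * j * ((1 + q) / 2)) by ring]
        ring

end IsSiteField

end


/-! ### Decoupling the past weight from the later fields. -/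

section Decoupling

variable {I : Type*} [MeasurableSpace I] {ν : Measure I} [IsFiniteMeasure ν]

lemma integrable_prod_mul_conj {Ω : Type*} [MeasurableSpace Ω] {P : Measure Ω}
    [IsProbabilityMeasure P] {u : I → ℂ} (hu : Measurable u)
    {M : ℝ} (huM : ∀ x, ‖u x‖ ≤ M) {Θ : I → Ω → ℂ} (hΘ : Measurable (Function.uncurry Θ))
    (hΘ2 : ∀ x, MemLp (Θ x) 2 P) {B : ℝ} (hB : ∀ x, ∫ ω, ‖Θ x ω‖ ^ 2 ∂P ≤ B) :
    Integrable (fun p : (I × I) × Ω => u p.1.1 * Θ p.1.1 p.2 * starRingEnd ℂ (u p.1.2 * Θ p.1.2 p.2))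
      ((ν.prod ν).prod P) := by
  have hΘ' : ∀ f : (I × I) × Ω → I, Measurable f → Measurable fun p => Θ (f p) p.2 := fun f hf =>
    hΘ.comp (hf.prodMk measurable_snd)
  have hm : Measurable fun p : (I × I) × Ω =>
      u p.1.1 * Θ p.1.1 p.2 * starRingEnd ℂ (u p.1.2 * Θ p.1.2 p.2) :=
    ((hu.comp (measurable_fst.comp measurable_fst)).mul
      (hΘ' _ (measurable_fst.comp measurable_fst))).mul
      (Complex.continuous_conj.measurable.comp
        ((hu.comp (measurable_snd.comp measurable_fst)).mul
      (hΘ' _ (measurable_snd.comp measurable_fst))))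
  refine ⟨hm.aestronglyMeasurable, ?_⟩
  rw [HasFiniteIntegral, lintegral_prod _ hm.enorm.aemeasurable]
  have hsq : ∀ x, Integrable (fun ω => ‖Θ x ω‖ ^ 2) P := fun x => (hΘ2 x).integrable_sq_norm
  have key : ∀ z : I × I, ∫⁻ ω, ‖u z.1 * Θ z.1 ω * starRingEnd ℂ (u z.2 * Θ z.2 ω)‖ₑ ∂P ≤
      ENNReal.ofReal (M * M * B) := by
    intro z
    have hM : 0 ≤ M := (norm_nonneg _).trans (huM z.1)
    have hi : Integrable (fun ω => M * M * ((‖Θ z.1 ω‖ ^ 2 + ‖Θ z.2 ω‖ ^ 2) / 2)) P :=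
      (((hsq z.1).add (hsq z.2)).div_const 2).const_mul _
    calc _ ≤ ∫⁻ ω, ENNReal.ofReal (M * M * ((‖Θ z.1 ω‖ ^ 2 + ‖Θ z.2 ω‖ ^ 2) / 2)) ∂P := by
          refine lintegral_mono fun ω => ?_
          rw [← ofReal_norm]
          refine ENNReal.ofReal_le_ofReal ?_
          rw [norm_mul, RCLike.norm_conj, norm_mul, norm_mul]
          have h1 : ‖u z.1‖ * ‖u z.2‖ ≤ M * M :=
            mul_le_mul (huM _) (huM _) (norm_nonneg _) hM
          have h2 : ‖Θ z.1 ω‖ * ‖Θ z.2 ω‖ ≤ (‖Θ z.1 ω‖ ^ 2 + ‖Θ z.2 ω‖ ^ 2) / 2 := by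
            nlinarith [sq_nonneg (‖Θ z.1 ω‖ - ‖Θ z.2 ω‖)]
          calc _ = ‖u z.1‖ * ‖u z.2‖ * (‖Θ z.1 ω‖ * ‖Θ z.2 ω‖) := by ring
            _ ≤ _ := mul_le_mul h1 h2 (by positivity) (by positivity)
      _ = ENNReal.ofReal (∫ ω, M * M * ((‖Θ z.1 ω‖ ^ 2 + ‖Θ z.2 ω‖ ^ 2) / 2) ∂P) :=
          (ofReal_integral_eq_lintegral_ofReal hi (ae_of_all _ fun ω => by positivity)).symm
      _ ≤ _ := by
          refine ENNReal.ofReal_le_ofReal ?_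
          rw [integral_const_mul, integral_div, integral_add (hsq z.1) (hsq z.2)]
          refine mul_le_mul_of_nonneg_left ?_ (by positivity)
          linarith [hB z.1, hB z.2]
  calc _ ≤ ∫⁻ _z, ENNReal.ofReal (M * M * B) ∂(ν.prod ν) := lintegral_mono key
    _ < ⊤ := by
      rw [lintegral_const]
      exact ENNReal.mul_lt_top ENNReal.ofReal_lt_top (measure_lt_top _ _)

/-- The second moment of a random integral is controlled by the correlation kernel. -/
lemma lintegral_sq_enorm_integral_le {Ω : Type*} [MeasurableSpace Ω] {P : Measure Ω}
    [IsProbabilityMeasure P] {u : I → ℂ} (hu : Measurable u)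
    {M : ℝ} (huM : ∀ x, ‖u x‖ ≤ M) {Θ : I → Ω → ℂ} (hΘ : Measurable (Function.uncurry Θ))
    (hΘ2 : ∀ x, MemLp (Θ x) 2 P) {B : ℝ} (hB : ∀ x, ∫ ω, ‖Θ x ω‖ ^ 2 ∂P ≤ B)
    {κ : I → I → ENNReal} (hκ : ∀ x y, ‖∫ ω, Θ x ω * starRingEnd ℂ (Θ y ω) ∂P‖ₑ ≤ κ x y) :
    ∫⁻ ω, ‖∫ x, u x * Θ x ω ∂ν‖ₑ ^ 2 ∂P ≤ ∫⁻ x, ∫⁻ y, ‖u x‖ₑ * ‖u y‖ₑ * κ x y ∂ν ∂ν := by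
  have hG := integrable_prod_mul_conj (ν := ν) hu huM hΘ hΘ2 hB
  set S : Ω → ℂ := fun ω => ∫ x, u x * Θ x ω ∂ν with hS
  have hSS : ∀ ω, S ω * starRingEnd ℂ (S ω) = ∫ z : I × I,
      u z.1 * Θ z.1 ω * starRingEnd ℂ (u z.2 * Θ z.2 ω) ∂(ν.prod ν) := fun ω => by
    simp only [hS]
    rw [integral_prod_mul (fun x => u x * Θ x ω) fun y => starRingEnd ℂ (u y * Θ y ω),
      integral_conj]
  have hSi : Integrable (fun ω => S ω * starRingEnd ℂ (S ω)) P :=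
    hG.integral_prod_right.congr (ae_of_all _ fun ω => (hSS ω).symm)
  have hn : ∀ ω, S ω * starRingEnd ℂ (S ω) = ((‖S ω * starRingEnd ℂ (S ω)‖ : ℝ) : ℂ) := fun ω => by
    rw [norm_mul, RCLike.norm_conj, Complex.mul_conj, Complex.normSq_eq_norm_sq]
    push_cast; ring
  have e1 : ∫⁻ ω, ‖S ω‖ₑ ^ 2 ∂P = ‖∫ ω, S ω * starRingEnd ℂ (S ω) ∂P‖ₑ := by
    have : ∫ ω, S ω * starRingEnd ℂ (S ω) ∂P =
        ((∫ ω, ‖S ω * starRingEnd ℂ (S ω)‖ ∂P : ℝ) : ℂ) := by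
      rw [← integral_complex_ofReal]
      exact integral_congr_ae (ae_of_all _ hn)
    rw [this, ← ofReal_norm, Complex.norm_real, Real.norm_of_nonneg
      (integral_nonneg fun ω => norm_nonneg _), ofReal_integral_norm_eq_lintegral_enorm hSi]
    refine lintegral_congr fun ω => ?_
    rw [enorm_mul, RCLike.enorm_conj, sq]
  have e2 : ∫ ω, S ω * starRingEnd ℂ (S ω) ∂P = ∫ z : I × I, u z.1 * starRingEnd ℂ (u z.2) *
      ∫ ω, Θ z.1 ω * starRingEnd ℂ (Θ z.2 ω) ∂P ∂(ν.prod ν) := by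
    rw [integral_congr_ae (ae_of_all _ hSS),
      ← integral_integral_swap (f := fun (z : I × I) (ω : Ω) =>
        u z.1 * Θ z.1 ω * starRingEnd ℂ (u z.2 * Θ z.2 ω)) hG]
    refine integral_congr_ae (ae_of_all _ fun z => ?_)
    simp only
    rw [← integral_const_mul]
    refine integral_congr_ae (ae_of_all _ fun ω => ?_)
    simp only [map_mul]
    ring
  have hκm : Measurable fun z : I × I => ∫ ω, Θ z.1 ω * starRingEnd ℂ (Θ z.2 ω) ∂P := by
    refine StronglyMeasurable.measurable ?_
    refine StronglyMeasurable.integral_prod_right' (f := fun p : (I × I) × Ω =>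
      Θ p.1.1 p.2 * starRingEnd ℂ (Θ p.1.2 p.2)) (Measurable.stronglyMeasurable ?_)
    exact (hΘ.comp ((measurable_fst.comp measurable_fst).prodMk measurable_snd)).mul
      (Complex.continuous_conj.measurable.comp
        (hΘ.comp ((measurable_snd.comp measurable_fst).prodMk measurable_snd)))
  rw [e1, e2]
  refine (enorm_integral_le_lintegral_enorm _).trans ?_
  have hm : Measurable fun z : I × I => u z.1 * starRingEnd ℂ (u z.2) *
      ∫ ω, Θ z.1 ω * starRingEnd ℂ (Θ z.2 ω) ∂P :=
    ((hu.comp measurable_fst).mul (Complex.continuous_conj.measurable.comp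
      (hu.comp measurable_snd))).mul hκm
  rw [lintegral_prod _ hm.enorm.aemeasurable]
  refine lintegral_mono fun x => lintegral_mono fun y => ?_
  simp only [enorm_mul, RCLike.enorm_conj]
  gcongr
  exact hκ x y

lemma lintegral_rpow_le_of_isProbabilityMeasure {Ω : Type*} [MeasurableSpace Ω] {P : Measure Ω}
    [IsProbabilityMeasure P] {f : Ω → ENNReal} (hf : AEMeasurable f P) {p : ℝ} (hp0 : 0 ≤ p)
    (hp1 : p ≤ 1) : ∫⁻ ω, f ω ^ p ∂P ≤ (∫⁻ ω, f ω ∂P) ^ p := by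
  have := ENNReal.lintegral_mul_norm_pow_le (μ := P) hf (aemeasurable_const (b := (1 : ENNReal)))
    hp0 (sub_nonneg.2 hp1) (by ring)
  simpa using this

/-- Decoupling: conditionally on the first of two independent inputs, the `p`-th moment of a
random integral is bounded using the correlation kernel of the second one. -/
lemma lintegral_enorm_integral_rpow_le {Ω Ω₁ Ω₂ : Type*} [MeasurableSpace Ω] {P : Measure Ω}
    [IsProbabilityMeasure P] [MeasurableSpace Ω₁] [MeasurableSpace Ω₂] {X₁ : Ω → Ω₁}
    {X₂ : Ω → Ω₂} (hX₁ : Measurable X₁) (hX₂ : Measurable X₂) (hX : IndepFun X₁ X₂ P)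
    {u : I → Ω₁ → ℂ} (hu : Measurable (Function.uncurry u)) (hub : ∀ ω, ∃ M, ∀ x, ‖u x ω‖ ≤ M)
    {Θ : I → Ω₂ → ℂ} (hΘ : Measurable (Function.uncurry Θ))
    (hΘ2 : ∀ x, MemLp (fun ω => Θ x (X₂ ω)) 2 P) {B : ℝ}
    (hB : ∀ x, ∫ ω, ‖Θ x (X₂ ω)‖ ^ 2 ∂P ≤ B) {κ : I → I → ENNReal}
    (hκ : ∀ x y, ‖∫ ω, Θ x (X₂ ω) * starRingEnd ℂ (Θ y (X₂ ω)) ∂P‖ₑ ≤ κ x y)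
    {p : ℝ} (hp0 : 0 ≤ p) (hp1 : p ≤ 2) :
    ∫⁻ ω, ‖∫ x, u x (X₁ ω) * Θ x (X₂ ω) ∂ν‖ₑ ^ p ∂P ≤
      ∫⁻ ω, (∫⁻ x, ∫⁻ y, ‖u x (X₁ ω)‖ₑ * ‖u y (X₁ ω)‖ₑ * κ x y ∂ν ∂ν) ^ (p / 2) ∂P := by
  have := Measure.isProbabilityMeasure_map (μ := P) hX₁.aemeasurable
  have := Measure.isProbabilityMeasure_map (μ := P) hX₂.aemeasurable
  have hΘx : ∀ x, Measurable (Θ x) := fun x => hΘ.comp measurable_prodMk_left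
  have hux : ∀ ω, Measurable fun x => u x ω := fun ω => hu.comp measurable_prodMk_right
  have hS : Measurable fun z : Ω₁ × Ω₂ => ∫ x, u x z.1 * Θ x z.2 ∂ν := by
    refine StronglyMeasurable.measurable ?_
    refine StronglyMeasurable.integral_prod_right' (f := fun p : (Ω₁ × Ω₂) × I =>
      u p.2 p.1.1 * Θ p.2 p.1.2) (Measurable.stronglyMeasurable ?_)
    exact (hu.comp (measurable_snd.prodMk (measurable_fst.comp measurable_fst))).mul
      (hΘ.comp (measurable_snd.prodMk (measurable_snd.comp measurable_fst)))
  have hS' : Measurable fun z : Ω₁ × Ω₂ => ‖∫ x, u x z.1 * Θ x z.2 ∂ν‖ₑ ^ p :=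
    hS.enorm.pow_const p
  have e1 : ∫⁻ ω, ‖∫ x, u x (X₁ ω) * Θ x (X₂ ω) ∂ν‖ₑ ^ p ∂P =
      ∫⁻ ω₁, ∫⁻ ω₂, ‖∫ x, u x ω₁ * Θ x ω₂ ∂ν‖ₑ ^ p ∂(P.map X₂) ∂(P.map X₁) := by
    rw [← lintegral_map (f := fun z : Ω₁ × Ω₂ => ‖∫ x, u x z.1 * Θ x z.2 ∂ν‖ₑ ^ p)
      (g := fun ω => (X₁ ω, X₂ ω)) hS' (hX₁.prodMk hX₂),
      (indepFun_iff_map_prod_eq_prod_map_map hX₁.aemeasurable hX₂.aemeasurable).1 hX,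
      lintegral_prod _ hS'.aemeasurable]
  rw [e1]
  refine (lintegral_map_le _ _).trans (lintegral_mono fun ω => ?_)
  have hΘ2' : ∀ x, MemLp (Θ x) 2 (P.map X₂) := fun x =>
    (memLp_map_measure_iff (hΘx x).aestronglyMeasurable hX₂.aemeasurable).2 (hΘ2 x)
  have hB' : ∀ x, ∫ ω, ‖Θ x ω‖ ^ 2 ∂(P.map X₂) ≤ B := fun x => by
    rw [integral_map hX₂.aemeasurable ((hΘx x).norm.pow_const 2).aestronglyMeasurable]
    exact hB x
  have hκ' : ∀ x y, ‖∫ ω, Θ x ω * starRingEnd ℂ (Θ y ω) ∂(P.map X₂)‖ₑ ≤ κ x y := fun x y => by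
    have hm : Measurable fun ω => Θ x ω * starRingEnd ℂ (Θ y ω) :=
      (hΘx x).mul (Complex.continuous_conj.measurable.comp (hΘx y))
    rw [integral_map hX₂.aemeasurable hm.aestronglyMeasurable]
    exact hκ x y
  obtain ⟨M, hM⟩ := hub (X₁ ω)
  have hSω : Measurable fun ω₂ => ∫ x, u x (X₁ ω) * Θ x ω₂ ∂ν := hS.comp measurable_prodMk_left
  -- The past is frozen at X₁ ω. Jensen's inequality for the power p/2 ≤ 1 is applied in the second
  -- variable only, so no second moment of the past factor is ever needed.
  calc ∫⁻ ω₂, ‖∫ x, u x (X₁ ω) * Θ x ω₂ ∂ν‖ₑ ^ p ∂(P.map X₂)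
      = ∫⁻ ω₂, (‖∫ x, u x (X₁ ω) * Θ x ω₂ ∂ν‖ₑ ^ 2) ^ (p / 2) ∂(P.map X₂) := by
        refine lintegral_congr fun ω₂ => ?_
        rw [← ENNReal.rpow_natCast, ← ENNReal.rpow_mul]
        congr 1
        push_cast; ring
    _ ≤ (∫⁻ ω₂, ‖∫ x, u x (X₁ ω) * Θ x ω₂ ∂ν‖ₑ ^ 2 ∂(P.map X₂)) ^ (p / 2) :=
        lintegral_rpow_le_of_isProbabilityMeasure (hSω.enorm.pow_const 2).aemeasurable
          (by linarith) (by linarith)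
    _ ≤ _ := by
        gcongr
        exact lintegral_sq_enorm_integral_le (hux _) hM hΘ hΘ2' hB' hκ'

end Decoupling


/-! ### Comparison of complex weights with real ones, and decoupling of site fields. -/

section ComplexWeight

variable {I Ω : Type*} {mΩ : MeasurableSpace Ω} {P : Measure Ω} [IsProbabilityMeasure P]
  {A : ℕ → I → Ω → ℝ} {ζ : Ω → ℝ}

/-- The numerator has modulus e^{Re(z) y}, so only the normalisations differ. Up to cubic terms in
the exponent their ratio is exp(((Re z)² - Re(z²))/2) = exp((Im z)²/2). -/
lemma IsStandardExp.norm_site_le (h : IsStandardExp ζ P) {D : Set ℂ} {Cb : ℝ}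
    (hb : SiteBounds ζ P D Cb) {C M : ℝ}
    (hm : ∀ t : ℝ, |t| ≤ M → mgf ζ P t ≤ Real.exp (t ^ 2 / 2 + C * |t| ^ 3)) (hC : 0 ≤ C) {z : ℂ}
    (hz : z ∈ D) (hzM : |z.re| ≤ M) (y : ℝ) :
    ‖site (complexMGF ζ P) z y‖ ≤
      Real.exp (z.im ^ 2 / 2 + (C + Cb) * ‖z‖ ^ 3) * rsite ζ P z.re y := by
  have h0 := h.mgf_pos' z.re
  have h1 := hb.lower z hz
  have h2 := hm _ hzM
  have h3 : 0 < ‖complexMGF ζ P z‖ := norm_pos_iff.2 (hb.ne_zero z hz)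
  have h4 : (z ^ 2).re = z.re ^ 2 - z.im ^ 2 := by simp [sq]
  have h5 : |z.re| ^ 3 ≤ ‖z‖ ^ 3 := by gcongr; exact Complex.abs_re_le_norm z
  have h6 : mgf ζ P z.re ≤
      Real.exp (z.im ^ 2 / 2 + (C + Cb) * ‖z‖ ^ 3) * ‖complexMGF ζ P z‖ := by
    calc _ ≤ Real.exp (z.re ^ 2 / 2 + C * |z.re| ^ 3) := h2
      _ ≤ Real.exp (z.im ^ 2 / 2 + (C + Cb) * ‖z‖ ^ 3) *
          Real.exp ((z ^ 2).re / 2 - Cb * ‖z‖ ^ 3) := by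
          rw [← Real.exp_add]
          refine Real.exp_le_exp.2 ?_
          have := mul_le_mul_of_nonneg_left h5 hC
          rw [h4]; linarith
      _ ≤ _ := by gcongr
  rw [site, rsite, norm_div, Complex.norm_exp, Complex.re_mul_ofReal, div_le_iff₀ h3]
  calc Real.exp (z.re * y) = Real.exp (z.re * y) / mgf ζ P z.re * mgf ζ P z.re := by
        field_simp
    _ ≤ Real.exp (z.re * y) / mgf ζ P z.re *
        (Real.exp (z.im ^ 2 / 2 + (C + Cb) * ‖z‖ ^ 3) * ‖complexMGF ζ P z‖) := by gcongr
    _ = _ := by ring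

lemma IsStandardExp.exists_enorm_weight_le (hζ : IsStandardExp ζ P) {D : Set ℂ} {Cb : ℝ}
    (hb : SiteBounds ζ P D Cb) (B : ℝ) {R : ℝ} (hR : 0 ≤ R) :
    ∃ E : ℝ, 0 ≤ E ∧ ∀ (a : ℕ → ℝ) (m : ℕ) (v : ℝ), (∀ k, 0 ≤ a k) → (∀ k, a k ≤ 1) →
      (∑ k ∈ Finset.range m, a k ^ 2 ≤ v) → (∑ k ∈ Finset.range m, a k ^ 3 ≤ B) →
      ∀ β : ℂ, ‖β‖ ≤ R → (∀ k, β * a k ∈ D) → ∀ x ω,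
      ‖weight (complexMGF ζ P) A (fun k => β * a k) 0 m x ω‖ₑ ≤
        ENNReal.ofReal (Real.exp (β.im ^ 2 / 2 * v + E)) *
          rweight ζ P A (fun k => β.re * a k) 0 m x ω := by
  obtain ⟨C, hC, hm⟩ := hζ.exists_mgf_le R
  have hCb := hb.nonneg
  refine ⟨(C + Cb) * (R ^ 3 * max B 0), by positivity,
    fun a m v ha ha1 hv h3 β hβ hD x ω => ?_⟩
  have hre : ∀ k, (β * a k).re = β.re * a k := fun k => Complex.re_mul_ofReal _ _
  have him : ∀ k, (β * a k).im = β.im * a k := fun k => Complex.im_mul_ofReal _ _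
  have hn : ∀ k, ‖β * a k‖ ≤ R * a k := fun k => by
    rw [norm_mul, Complex.norm_real, Real.norm_of_nonneg (ha k)]
    exact mul_le_mul_of_nonneg_right hβ (ha k)
  have hsite : ∀ k, ‖site (complexMGF ζ P) (β * a k) (A k x ω)‖ ≤
      Real.exp (β.im ^ 2 / 2 * a k ^ 2 + (C + Cb) * (R ^ 3 * a k ^ 3)) *
        rsite ζ P (β.re * a k) (A k x ω) := fun k => by
    have hzM : |(β * a k).re| ≤ R :=
      (Complex.abs_re_le_norm _).trans ((hn k).trans (mul_le_of_le_one_right hR (ha1 k)))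
    refine (hζ.norm_site_le hb hm hC (hD k) hzM (A k x ω)).trans ?_
    rw [hre, him]
    refine mul_le_mul_of_nonneg_right (Real.exp_le_exp.2 ?_) (hζ.rsite_pos _ _).le
    have : ‖β * a k‖ ^ 3 ≤ R ^ 3 * a k ^ 3 := by
      rw [← mul_pow]
      exact pow_le_pow_left₀ (norm_nonneg _) (hn k) 3
    have := mul_le_mul_of_nonneg_left this (add_nonneg hC hCb)
    have e : (β.im * a k) ^ 2 / 2 = β.im ^ 2 / 2 * a k ^ 2 := by ring
    linarith
  rw [weight, rweight, Nat.Ico_zero_eq_range, ← ofReal_norm, norm_prod,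
    ← ENNReal.ofReal_prod_of_nonneg (fun k _ => (hζ.rsite_pos _ _).le),
    ← ENNReal.ofReal_mul (Real.exp_pos _).le]
  refine ENNReal.ofReal_le_ofReal ((Finset.prod_le_prod (fun _ _ => norm_nonneg _)
    fun k _ => hsite k).trans ?_)
  rw [Finset.prod_mul_distrib, ← Real.exp_sum, Finset.sum_add_distrib, ← Finset.mul_sum,
    ← Finset.mul_sum, ← Finset.mul_sum]
  refine mul_le_mul_of_nonneg_right (Real.exp_le_exp.2 ?_)
    (Finset.prod_nonneg fun k _ => (hζ.rsite_pos _ _).le)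
  have h3' := h3.trans (le_max_left B 0)
  have hs : 0 ≤ β.im ^ 2 / 2 := by positivity
  gcongr

end ComplexWeight

section JointMeasurability

variable {I Ω : Type*} [MetricSpace I] [SecondCountableTopology I]
  [MeasurableSpace I] [BorelSpace I] {mΩ : MeasurableSpace Ω}

/-- Continuity in x and measurability in ω give joint measurability. It is needed for the small
σ-algebra, since the decoupling treats Ω with this σ-algebra as a space of its own. -/
lemma measurable_uncurry_sigmaOn {m : ℕ → MeasurableSpace Ω} {P : Measure Ω} {S : Set ℕ}
    {f : I → Ω → ℂ} (hf : ∀ x, L2On m P S (f x)) (hc : ∀ ω, Continuous fun x => f x ω) :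
    @Measurable (I × Ω) ℂ (@Prod.instMeasurableSpace _ _ _ (sigmaOn m S)) _
      (Function.uncurry f) := by
  let _ : MeasurableSpace Ω := sigmaOn m S
  exact measurable_uncurry_of_continuous_of_measurable hc fun x => (hf x).meas

omit [SecondCountableTopology I] in
lemma continuous_integrable [CompactSpace I] {ν : Measure I} [IsFiniteMeasure ν] {f : I → ℂ}
    (hf : Continuous f) : Integrable f ν :=
  hf.integrable_of_hasCompactSupport (HasCompactSupport.of_compactSpace f)

variable {P : Measure Ω} [IsProbabilityMeasure P] {A : ℕ → I → Ω → ℝ} {ζ : Ω → ℝ}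

/-- Decoupling of a past factor and a future factor of site fields. -/
lemma IsSiteField.lintegral_enorm_integral_mul_rpow_le [CompactSpace I]
    (h : IsSiteField P A ζ) (ν : Measure I)
    [IsFiniteMeasure ν] {S T : Set ℕ} (hST : Disjoint S T) {u Θ : I → Ω → ℂ}
    (hu : ∀ x, L2On (siteSigma A) P S (u x)) (huc : ∀ ω, Continuous fun x => u x ω)
    (hΘ : ∀ x, L2On (siteSigma A) P T (Θ x)) (hΘc : ∀ ω, Continuous fun x => Θ x ω) {B : ℝ}
    (hB : ∀ x, ∫ ω, ‖Θ x ω‖ ^ 2 ∂P ≤ B) {κ : I → I → ENNReal}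
    (hκ : ∀ x y, ‖∫ ω, Θ x ω * starRingEnd ℂ (Θ y ω) ∂P‖ₑ ≤ κ x y)
    {p : ℝ} (hp0 : 0 ≤ p) (hp1 : p ≤ 2) :
    ∫⁻ ω, ‖∫ x, u x ω * Θ x ω ∂ν‖ₑ ^ p ∂P ≤
      ∫⁻ ω, (∫⁻ x, ∫⁻ y, ‖u x ω‖ₑ * ‖u y ω‖ₑ * κ x y ∂ν ∂ν) ^ (p / 2) ∂P := by
  have hub : ∀ ω, ∃ M, ∀ x, ‖u x ω‖ ≤ M := fun ω => by
    obtain ⟨M, hM⟩ := (isCompact_range (huc ω).norm).bddAbove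
    exact ⟨M, fun x => hM ⟨x, rfl⟩⟩
  -- Past and future are both represented by the identity of Ω, with target σ-algebras generated by
  -- the fields of S and of T; these two maps are independent.
  have hS : @Measurable Ω Ω mΩ (sigmaOn (siteSigma A) S) id :=
    measurable_id'' (sigmaOn_le h.siteSigma_le S)
  have hT : @Measurable Ω Ω mΩ (sigmaOn (siteSigma A) T) id :=
    measurable_id'' (sigmaOn_le h.siteSigma_le T)
  have hind : @IndepFun Ω Ω Ω mΩ (sigmaOn (siteSigma A) S) (sigmaOn (siteSigma A) T) id id P := by
    refine @indepFun_of_disjoint Ω mΩ P _ S T h.siteSigma_le h.indep Ω Ω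
      (sigmaOn (siteSigma A) S) (sigmaOn (siteSigma A) T) id id hST ?_ ?_
    · exact @measurable_id _ (sigmaOn (siteSigma A) S)
    · exact @measurable_id _ (sigmaOn (siteSigma A) T)
  exact @lintegral_enorm_integral_rpow_le I _ ν _ Ω Ω Ω mΩ P _ (sigmaOn (siteSigma A) S)
    (sigmaOn (siteSigma A) T) id id hS hT hind u (measurable_uncurry_sigmaOn hu huc) hub Θ
    (measurable_uncurry_sigmaOn hΘ hΘc) (fun x => (hΘ x).memLp) B hB κ hκ p hp0 hp1

end JointMeasurability


lemma eLpNorm_ofReal_le {Ω E : Type*} [NormedAddCommGroup E] {mΩ : MeasurableSpace Ω}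
    {P : Measure Ω} {f : Ω → E}
    {p c : ℝ} (hp : 0 < p) (hc : 0 ≤ c) (h : ∫⁻ ω, ‖f ω‖ₑ ^ p ∂P ≤ ENNReal.ofReal (c ^ p)) :
    eLpNorm f (ENNReal.ofReal p) P ≤ ENNReal.ofReal c := by
  rw [eLpNorm_eq_lintegral_rpow_enorm_toReal (by simpa using hp) ENNReal.ofReal_ne_top,
    ENNReal.toReal_ofReal hp.le]
  refine (ENNReal.rpow_le_rpow h (by positivity)).trans (le_of_eq ?_)
  rw [ENNReal.ofReal_rpow_of_nonneg (by positivity) (by positivity), ← Real.rpow_mul hc,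
    mul_one_div_cancel hp.ne', Real.rpow_one]

lemma lintegral_enorm_rpow_of_eLpNorm {Ω E : Type*} [NormedAddCommGroup E]
    {mΩ : MeasurableSpace Ω} {P : Measure Ω} {f : Ω → E} {p : ℝ} (hp : 0 < p) :
    ∫⁻ ω, ‖f ω‖ₑ ^ p ∂P = eLpNorm f (ENNReal.ofReal p) P ^ p := by
  rw [eLpNorm_eq_lintegral_rpow_enorm_toReal (by simpa using hp) ENNReal.ofReal_ne_top,
    ENNReal.toReal_ofReal hp.le, ← ENNReal.rpow_mul, one_div_mul_cancel hp.ne', ENNReal.rpow_one]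

/-! ### Bounds in L^{1+q} for the block expansion. -/

section LpBound

variable {I Ω : Type*} {mΩ : MeasurableSpace Ω} {P : Measure Ω} [IsProbabilityMeasure P]
  {A : ℕ → I → Ω → ℝ} {ζ : Ω → ℝ} [MetricSpace I] [CompactSpace I]
  [MeasurableSpace I] [BorelSpace I]

omit [CompactSpace I] [MeasurableSpace I] [BorelSpace I] in
lemma ScaleBounds.sum_norm_sq_le {a : ℕ → ℝ} {c : ℕ → I → I → ℝ} {n : ℕ → ℕ} {δ B R : ℝ}
    (hs : ScaleBounds a c n δ B) {β : ℂ} (hβ : ‖β‖ ≤ R) (j : ℕ) :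
    ∑ k ∈ Finset.Ico (n j) (n (j + 1)), ‖β * (a k : ℂ)‖ ^ 2 ≤ R ^ 2 * B := by
  have e : ∀ k, ‖β * (a k : ℂ)‖ ^ 2 = ‖β‖ ^ 2 * a k ^ 2 := fun k => by
    rw [norm_mul, mul_pow, Complex.norm_real, Real.norm_eq_abs, sq_abs]
  simp_rw [e]
  rw [← Finset.mul_sum]
  exact mul_le_mul (pow_le_pow_left₀ (norm_nonneg _) hβ 2) (hs.block j)
    (Finset.sum_nonneg fun _ _ => sq_nonneg _) (sq_nonneg _)

omit [CompactSpace I] [MeasurableSpace I] [BorelSpace I] in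
-- As `a k` ≤ 1, fourth powers are dominated by cubes, whose partial sums are bounded.
lemma ScaleBounds.sum_norm_pow_four_le {a : ℕ → ℝ} {c : ℕ → I → I → ℝ} {n : ℕ → ℕ} {δ B R : ℝ}
    (hs : ScaleBounds a c n δ B) {β : ℂ} (hβ : ‖β‖ ≤ R) (s t : ℕ) :
    ∑ k ∈ Finset.Ico s t, ‖β * (a k : ℂ)‖ ^ 4 ≤ R ^ 4 * B := by
  have h4 : ∀ k, ‖β * (a k : ℂ)‖ ^ 4 ≤ R ^ 4 * a k ^ 3 := fun k => by
    have h0 := hs.nonneg k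
    have h1 := hs.le_one k
    rw [norm_mul, mul_pow, Complex.norm_real, Real.norm_of_nonneg h0]
    refine mul_le_mul (pow_le_pow_left₀ (norm_nonneg _) hβ 4) ?_ (by positivity) (by positivity)
    calc a k ^ 4 = a k ^ 3 * a k := by ring
      _ ≤ a k ^ 3 := mul_le_of_le_one_right (by positivity) h1
  calc _ ≤ ∑ k ∈ Finset.Ico s t, R ^ 4 * a k ^ 3 := Finset.sum_le_sum fun k _ => h4 k
    _ ≤ ∑ k ∈ Finset.range t, R ^ 4 * a k ^ 3 := by
        refine Finset.sum_le_sum_of_subset_of_nonneg (fun k hk => ?_) fun k _ _ => ?_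
        · simp only [Finset.mem_Ico, Finset.mem_range] at hk ⊢; omega
        · have := hs.nonneg k; positivity
    _ = R ^ 4 * ∑ k ∈ Finset.range t, a k ^ 3 := by rw [Finset.mul_sum]
    _ ≤ _ := mul_le_mul_of_nonneg_left (hs.cube t) (by positivity)

namespace IsSiteField

omit [IsProbabilityMeasure P] in
lemma aestronglyMeasurable_integral (h : IsSiteField P A ζ) (ν : Measure I) [IsFiniteMeasure ν]
    {S : Set ℕ} {u : I → Ω → ℂ} (hu : ∀ x, L2On (siteSigma A) P S (u x))
    (huc : ∀ ω, Continuous fun x => u x ω) :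
    AEStronglyMeasurable (fun ω => ∫ x, u x ω ∂ν) P := by
  have : Measurable (Function.uncurry u) :=
    measurable_uncurry_of_continuous_of_measurable huc fun x =>
      (hu x).meas.mono (sigmaOn_le h.siteSigma_le S) le_rfl
  exact (StronglyMeasurable.integral_prod_left (f := u) this.stronglyMeasurable).aestronglyMeasurable

omit [IsProbabilityMeasure P] [CompactSpace I] [MeasurableSpace I] [BorelSpace I] in
lemma l2On_continuousMap_mul {S : Set ℕ} {u : I → Ω → ℂ} (hu : ∀ x, L2On (siteSigma A) P S (u x))
    (g : C(I, ℂ)) (x : I) : L2On (siteSigma A) P S (fun ω => g x * u x ω) :=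
  ⟨(hu x).meas.const_mul (g x), (hu x).memLp.const_mul (g x)⟩

/-- The first term of the block expansion is bounded in `L²`. -/
lemma exists_eLpNorm_resProd_le (h : IsSiteField P A ζ) (ν : Measure I) [IsFiniteMeasure ν]
    {D : Set ℂ} {Cb : ℝ} (hb : SiteBounds ζ P D Cb) {q : ℝ} (hq1 : q < 1)
    (δ B R : ℝ) :
    ∃ C : ℝ, 0 ≤ C ∧ ∀ (a : ℕ → ℝ) (n : ℕ → ℕ), ScaleBounds a (siteCov P A) n δ B → ∀ β : ℂ,
      ‖β‖ ≤ R → (∀ k, β * a k ∈ D) → ∀ (g : C(I, ℂ)) (J : ℕ),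
      eLpNorm (fun ω => ∫ x, g x * resProd (complexMGF ζ P) A (fun k => β * a k) n 0 J x ω ∂ν)
        (ENNReal.ofReal (1 + q)) P ≤ ENNReal.ofReal (C * ‖g‖) := by
  set E := Real.exp (Real.exp (Cb * (R ^ 2 * B)) * Cb * (R ^ 4 * B)) with hE
  have hE0 : 0 ≤ E := (Real.exp_pos _).le
  set N : ℝ := (ν Set.univ).toReal with hN
  have hNν : ν Set.univ = ENNReal.ofReal N := (ENNReal.ofReal_toReal (measure_ne_top _ _)).symm
  have hN0 : 0 ≤ N := ENNReal.toReal_nonneg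
  refine ⟨Real.sqrt E * N, by positivity, fun a n hs β hβ hD g J => ?_⟩
  have hL := fun x => (h.l2On_resProd hs.mono (complexMGF ζ P) (fun k => β * a k) 0 J x).1
  have hc := h.continuous_resProd (complexMGF ζ P) (fun k => β * a k) n 0 J
  have hsq : ∀ x, ∫ ω, ‖resProd (complexMGF ζ P) A (fun k => β * a k) n 0 J x ω‖ ^ 2 ∂P ≤ E :=
    fun x => h.integral_sq_norm_resProd_le hs.mono hb hD (hs.sum_norm_sq_le hβ)
      (hs.sum_norm_pow_four_le hβ) 0 J x
  have hmeas : AEStronglyMeasurable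
      (fun ω => ∫ x, g x * resProd (complexMGF ζ P) A (fun k => β * a k) n 0 J x ω ∂ν) P :=
    h.aestronglyMeasurable_integral ν (l2On_continuousMap_mul hL g)
      fun ω => g.continuous.mul (hc ω)
  have hum : Measurable
      (Function.uncurry (resProd (complexMGF ζ P) A (fun k => β * a k) n 0 J)) :=
    measurable_uncurry_of_continuous_of_measurable hc fun x =>
      (hL x).meas.mono (sigmaOn_le h.siteSigma_le _) le_rfl
  have key := lintegral_sq_enorm_integral_le (ν := ν) g.continuous.measurable
    (fun x => g.norm_coe_le_norm x) hum (fun x => (hL x).memLp) hsq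
    (κ := fun _ _ => ENNReal.ofReal E) fun x y => by
      rw [← ofReal_norm]
      exact ENNReal.ofReal_le_ofReal
        (norm_integral_mul_conj_le (hL x).memLp (hL y).memLp (hsq x) (hsq y))
  -- No spatial decorrelation is needed here: a constant kernel suffices in L², and 1 + q ≤ 2 on a
  -- probability space.
  have h2 : eLpNorm (fun ω => ∫ x, g x * resProd (complexMGF ζ P) A (fun k => β * a k) n 0 J x ω ∂ν)
      (ENNReal.ofReal 2) P ≤ ENNReal.ofReal (Real.sqrt E * N * ‖g‖) := by
    refine eLpNorm_ofReal_le two_pos (by positivity) ?_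
    calc _ = ∫⁻ ω, ‖∫ x, g x * resProd (complexMGF ζ P) A (fun k => β * a k) n 0 J x ω ∂ν‖ₑ ^ 2 ∂P := by
          refine lintegral_congr fun ω => ?_
          norm_cast
      _ ≤ _ := key
      _ ≤ ∫⁻ _x, ∫⁻ _y, ENNReal.ofReal (‖g‖ * ‖g‖ * E) ∂ν ∂ν := by
          refine lintegral_mono fun x => lintegral_mono fun y => ?_
          rw [ENNReal.ofReal_mul (by positivity), ENNReal.ofReal_mul (by positivity),
            ← ofReal_norm, ← ofReal_norm]
          gcongr <;> exact g.norm_coe_le_norm _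
      _ = ENNReal.ofReal ((Real.sqrt E * N * ‖g‖) ^ (2 : ℝ)) := by
          rw [lintegral_const, lintegral_const, hNν, ← ENNReal.ofReal_mul (by positivity),
            ← ENNReal.ofReal_mul (by positivity), Real.rpow_two, mul_pow, mul_pow,
            Real.sq_sqrt hE0]
          congr 1; ring
  refine (eLpNorm_le_eLpNorm_of_exponent_le ?_ hmeas).trans h2
  exact ENNReal.ofReal_le_ofReal (by linarith)

/-- Each term of the block expansion is exponentially small in `L^{1+q}`. -/
lemma exists_eLpNorm_blockTerm_le (h : IsSiteField P A ζ) (ν : Measure I) [IsFiniteMeasure ν]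
    {D : Set ℂ} {Cb : ℝ} (hb : SiteBounds ζ P D Cb) {Cν dd : ℝ} (hCν : 0 ≤ Cν)
    (hν : ∀ l j x, ν (shell l j x) ≤ ENNReal.ofReal (Cν * Real.exp (-(dd * l))))
    {t₁ q B δ R : ℝ} (ht₁ : 0 ≤ t₁) (hq0 : 0 < q) (hq1 : q < 1) (hδ : 0 < δ)
    (hB : 0 ≤ B) (hR : 0 ≤ R) (hκ : t₁ ^ 2 / (2 * (1 - q)) < dd) :
    ∃ C : ℝ, 0 ≤ C ∧ ∀ (a : ℕ → ℝ) (n : ℕ → ℕ), ScaleBounds a (siteCov P A) n δ B → ∀ β : ℂ,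
      0 ≤ β.re → β.re ≤ t₁ → ‖β‖ ≤ R → β.im ^ 2 ≤ blockRate dd t₁ q δ / 2 → (∀ k, β * a k ∈ D) →
      (∀ k, ((β.re * a k : ℝ) : ℂ) ∈ D) → ∀ (g : C(I, ℂ)) (j J : ℕ),
      eLpNorm (fun ω => ∫ x, g x * (weight (complexMGF ζ P) A (fun k => β * a k) 0 (n j) x ω *
        blockTerm (complexMGF ζ P) A (fun k => β * a k) n j J x ω) ∂ν)
        (ENNReal.ofReal (1 + q)) P ≤
      ENNReal.ofReal (C * ‖g‖ * Real.exp (-(blockRate dd t₁ q δ / (2 * (1 + q)) * j))) := by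
  set E₁ := Real.exp (Cb * (R ^ 2 * B)) * Real.exp (Real.exp (Cb * (R ^ 2 * B)) * Cb * (R ^ 4 * B))
    with hE₁
  set η := blockRate dd t₁ q δ with hη
  have hη0 : 0 ≤ η := by
    have h1 : 0 < q * (dd - t₁ ^ 2 / (2 * (1 - q))) := mul_pos hq0 (by linarith)
    have h2 : 0 < min (δ * q) (q * (dd - t₁ ^ 2 / (2 * (1 - q)))) := lt_min (mul_pos hδ hq0) h1
    rw [hη, blockRate]; positivity
  obtain ⟨E₂, hE₂, H₂⟩ := h.std.exists_enorm_weight_le (A := A) hb B hR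
  obtain ⟨C, hC, H⟩ := h.exists_quadratic_moment_le ν hb hCν hν (B := B) (δ := δ)
    (Bk := E₁ * (R ^ 2 * B)) ht₁ hq0 hq1 hδ (by positivity) hκ
  have hp : 0 < 1 + q := by linarith
  refine ⟨Real.exp E₂ * C ^ (1 / (1 + q)), by positivity,
    fun a n hs β hre hret hβ him hD hDr g j J => ?_⟩
  set z : ℕ → ℂ := fun k => β * a k with hz
  set φ := complexMGF ζ P with hφ
  set w := rweight ζ P A (fun k => β.re * a k) 0 (n j) with hw
  have hu := fun x => h.l2On_weight φ z 0 (n j) x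
  have huc := h.continuous_weight φ z 0 (n j)
  have hΘ := fun x => h.l2On_blockTerm hs.mono φ z j J x
  have hΘc := h.continuous_blockTerm φ z n j J
  set cv : I → I → ℝ := fun x y =>
    ∑ k ∈ Finset.Ico (n j) (n (j + 1)), a k ^ 2 * |siteCov P A k x y| with hcv
  have hcor : ∀ x y, ‖∫ ω, blockTerm φ A z n j J x ω *
      starRingEnd ℂ (blockTerm φ A z n j J y ω) ∂P‖ ≤ E₁ * (R ^ 2 * cv x y) := fun x y => by
    refine (h.norm_integral_blockTerm_le hs.mono hb hD (hs.sum_norm_sq_le hβ)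
      (hs.sum_norm_pow_four_le hβ) j J x y).trans ?_
    refine mul_le_mul_of_nonneg_left ?_ (by positivity)
    rw [hcv, Finset.mul_sum]
    refine Finset.sum_le_sum fun k _ => ?_
    have e : ‖z k‖ ^ 2 = ‖β‖ ^ 2 * a k ^ 2 := by
      rw [hz, norm_mul, mul_pow, Complex.norm_real, Real.norm_eq_abs, sq_abs]
    rw [e, mul_assoc]
    refine mul_le_mul_of_nonneg_right (pow_le_pow_left₀ (norm_nonneg _) hβ 2) ?_
    exact mul_nonneg (sq_nonneg _) (abs_nonneg _)
  have hnear : ∀ l ≤ j, ∀ x, ∀ y ∈ shell l j x, E₁ * (R ^ 2 * cv x y) ≤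
      E₁ * (R ^ 2 * B) * Real.exp (-(δ * (j - l))) := fun l hl x y hy => by
    have := hs.near l j hl x y hy.1
    calc E₁ * (R ^ 2 * cv x y) ≤ E₁ * (R ^ 2 * (B * Real.exp (-(δ * (j - l))))) := by gcongr
      _ = _ := by ring
  -- The diagonal case of the correlation bound: x itself lies in the finest shell l = j around x.
  have hB2 : ∀ x, ∫ ω, ‖blockTerm φ A z n j J x ω‖ ^ 2 ∂P ≤ E₁ * (R ^ 2 * B) := fun x => by
    have h1 := (hcor x x).trans (hnear j le_rfl x x
      ⟨fun h => absurd h (lt_irrefl _), fun _ => by rw [dist_self]; positivity⟩)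
    rw [sub_self, mul_zero, neg_zero, Real.exp_zero, mul_one] at h1
    refine le_trans ?_ h1
    refine le_trans (le_of_eq ?_) (Complex.re_le_norm _)
    have e : ∀ ω, blockTerm φ A z n j J x ω * starRingEnd ℂ (blockTerm φ A z n j J x ω) =
        ((‖blockTerm φ A z n j J x ω‖ ^ 2 : ℝ) : ℂ) := fun ω => by
      rw [Complex.mul_conj, Complex.normSq_eq_norm_sq]
    rw [integral_congr_ae (ae_of_all _ e), integral_complex_ofReal, Complex.ofReal_re]
  have hdec := h.lintegral_enorm_integral_mul_rpow_le ν (S := Set.Ico 0 (n j))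
    (T := Set.Ici (n j)) (Set.disjoint_left.2 fun k hk hk' => absurd hk.2 (not_lt.2 hk'))
    (l2On_continuousMap_mul hu g) (fun ω => g.continuous.mul (huc ω)) hΘ hΘc hB2
    (κ := fun x y => ENNReal.ofReal (E₁ * (R ^ 2 * cv x y))) (fun x y => by
      rw [← ofReal_norm]; exact ENNReal.ofReal_le_ofReal (hcor x y)) hp.le (by linarith)
  have hW : ∀ x ω, ‖g x * weight φ A z 0 (n j) x ω‖ₑ ≤
      ENNReal.ofReal (‖g‖ * Real.exp (β.im ^ 2 / 2 * j + E₂)) * w x ω := fun x ω => by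
    rw [enorm_mul, ENNReal.ofReal_mul (norm_nonneg _), mul_assoc]
    refine mul_le_mul' ?_ (H₂ a (n j) j hs.nonneg hs.le_one (hs.var j) (hs.cube _) β hβ hD x ω)
    rw [← ofReal_norm]
    exact ENNReal.ofReal_le_ofReal (g.norm_coe_le_norm x)
  set G : ℝ := ‖g‖ * Real.exp (β.im ^ 2 / 2 * j + E₂) with hG
  have hG0 : 0 ≤ G := by positivity
  have hquad := H a n hs β.re hre hret hDr j (fun x y => ENNReal.ofReal (E₁ * (R ^ 2 * cv x y)))
    fun l hl x y hy => ENNReal.ofReal_le_ofReal (hnear l hl x y hy)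
  have hassoc : ∀ ω x, g x * (weight φ A z 0 (n j) x ω * blockTerm φ A z n j J x ω) =
      g x * weight φ A z 0 (n j) x ω * blockTerm φ A z n j J x ω := fun ω x =>
    (mul_assoc _ _ _).symm
  simp_rw [hassoc]
  refine eLpNorm_ofReal_le hp (by positivity) (hdec.trans ?_)
  calc _ ≤ ∫⁻ ω, ENNReal.ofReal (G ^ (1 + q)) * (∫⁻ x, ∫⁻ y, w x ω * w y ω *
        ENNReal.ofReal (E₁ * (R ^ 2 * cv x y)) ∂ν ∂ν) ^ ((1 + q) / 2) ∂P := by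
        refine lintegral_mono fun ω => ?_
        have e1 : ENNReal.ofReal (G ^ (1 + q)) = (ENNReal.ofReal (G * G)) ^ ((1 + q) / 2) := by
          rw [ENNReal.ofReal_rpow_of_nonneg (by positivity) (by positivity), ← sq,
            ← Real.rpow_two, ← Real.rpow_mul hG0]
          congr 2; ring
        rw [e1, ← ENNReal.mul_rpow_of_nonneg _ _ (by positivity)]
        refine ENNReal.rpow_le_rpow ?_ (by positivity)
        rw [← lintegral_const_mul' _ _ ENNReal.ofReal_ne_top]
        refine lintegral_mono fun x => ?_
        simp only
        rw [← lintegral_const_mul' _ _ ENNReal.ofReal_ne_top]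
        refine lintegral_mono fun y => ?_
        calc _ ≤ ENNReal.ofReal G * w x ω * (ENNReal.ofReal G * w y ω) *
              ENNReal.ofReal (E₁ * (R ^ 2 * cv x y)) := by
              gcongr
              · exact hW x ω
              · exact hW y ω
          _ = _ := by rw [ENNReal.ofReal_mul hG0]; ring
    _ = ENNReal.ofReal (G ^ (1 + q)) * ∫⁻ ω, (∫⁻ x, ∫⁻ y, w x ω * w y ω *
        ENNReal.ofReal (E₁ * (R ^ 2 * cv x y)) ∂ν ∂ν) ^ ((1 + q) / 2) ∂P :=
        lintegral_const_mul' _ _ ENNReal.ofReal_ne_top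
    _ ≤ ENNReal.ofReal (G ^ (1 + q)) * ENNReal.ofReal (C * Real.exp (-(η * j))) := by
        gcongr
    _ = ENNReal.ofReal (G ^ (1 + q) * (C * Real.exp (-(η * j)))) :=
        (ENNReal.ofReal_mul (by positivity)).symm
    _ ≤ _ := by
        refine ENNReal.ofReal_le_ofReal ?_
        have eR : (Real.exp E₂ * C ^ (1 / (1 + q)) * ‖g‖ *
            Real.exp (-(η / (2 * (1 + q)) * j))) ^ (1 + q) = Real.exp (E₂ * (1 + q)) * C *
            ‖g‖ ^ (1 + q) * Real.exp (-(η / (2 * (1 + q)) * j) * (1 + q)) := by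
          rw [Real.mul_rpow (by positivity) (by positivity), Real.mul_rpow (by positivity)
            (by positivity), Real.mul_rpow (by positivity) (by positivity), ← Real.rpow_mul hC,
            one_div_mul_cancel hp.ne', Real.rpow_one, ← Real.exp_mul, ← Real.exp_mul]
        have eL : G ^ (1 + q) = ‖g‖ ^ (1 + q) *
            Real.exp ((β.im ^ 2 / 2 * j + E₂) * (1 + q)) := by
          rw [hG, Real.mul_rpow (by positivity) (by positivity), ← Real.exp_mul]
        rw [eR, eL]
        have e2 : Real.exp ((β.im ^ 2 / 2 * j + E₂) * (1 + q)) * Real.exp (-(η * j)) ≤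
            Real.exp (E₂ * (1 + q)) * Real.exp (-(η / (2 * (1 + q)) * j) * (1 + q)) := by
          rw [← Real.exp_add, ← Real.exp_add]
          refine Real.exp_le_exp.2 ?_
          have e3 : -(η / (2 * (1 + q)) * j) * (1 + q) = -(η / 2 * j) := by field_simp
          -- The price of a complex β is at most half of the decay rate η; the other half, divided
          -- by 1 + q on taking the root, is the rate in the statement.
          have e4 : β.im ^ 2 / 2 * (1 + q) ≤ η / 2 := by nlinarith [sq_nonneg β.im]
          have e5 := mul_le_mul_of_nonneg_right e4 (Nat.cast_nonneg (α := ℝ) j)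
          rw [e3]; nlinarith
        calc _ = ‖g‖ ^ (1 + q) * C * (Real.exp ((β.im ^ 2 / 2 * j + E₂) * (1 + q)) *
              Real.exp (-(η * j))) := by ring
          _ ≤ ‖g‖ ^ (1 + q) * C * (Real.exp (E₂ * (1 + q)) *
              Real.exp (-(η / (2 * (1 + q)) * j) * (1 + q))) :=
            mul_le_mul_of_nonneg_left e2 (by positivity)
          _ = _ := by ring

end IsSiteField

end LpBound


lemma blockRate_pos {dd t₁ q δ : ℝ} (hq0 : 0 < q) (hδ : 0 < δ)
    (hκ : t₁ ^ 2 / (2 * (1 - q)) < dd) : 0 < blockRate dd t₁ q δ := by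
  have h1 : 0 < q * (dd - t₁ ^ 2 / (2 * (1 - q))) := mul_pos hq0 (by linarith)
  have h2 : 0 < min (δ * q) (q * (dd - t₁ ^ 2 / (2 * (1 - q)))) := lt_min (mul_pos hδ hq0) h1
  rw [blockRate]; positivity

/-- All bounds concern sums of nonnegative terms, which shrink when the checkpoints are cut at `N`.
The block expansion can then stop exactly at an arbitrary index with the same constants. -/
lemma ScaleBounds.min {I : Type*} [PseudoMetricSpace I] {a : ℕ → ℝ} {c : ℕ → I → I → ℝ}
    {n : ℕ → ℕ} {δ B : ℝ} (h : ScaleBounds a c n δ B) (N : ℕ) :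
    ScaleBounds a c (fun l => min (n l) N) δ B where
  mono := h.mono.min monotone_const
  zero := by simp [h.zero]
  nonneg := h.nonneg
  le_one := h.le_one
  var l := (Finset.sum_le_sum_of_subset_of_nonneg (Finset.range_mono (min_le_left _ _))
    fun k _ _ => sq_nonneg _).trans (h.var l)
  cube := h.cube
  block j := (Finset.sum_le_sum_of_subset_of_nonneg (fun k hk => by
    simp only [Finset.mem_Ico] at hk ⊢; omega) fun k _ _ => sq_nonneg _).trans (h.block j)
  far l j hlj x y hxy := (Finset.sum_le_sum_of_subset_of_nonneg (fun k hk => by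
    simp only [Finset.mem_Ico] at hk ⊢; omega) fun k _ _ =>
      mul_nonneg (sq_nonneg _) (abs_nonneg _)).trans (h.far l j hlj x y hxy)
  near l j hlj x y hxy := (Finset.sum_le_sum_of_subset_of_nonneg (fun k hk => by
    simp only [Finset.mem_Ico] at hk ⊢; omega) fun k _ _ =>
      mul_nonneg (sq_nonneg _) (abs_nonneg _)).trans (h.near l j hlj x y hxy)

section LpBound

variable {I Ω : Type*} {mΩ : MeasurableSpace Ω} {P : Measure Ω} [IsProbabilityMeasure P]
  {A : ℕ → I → Ω → ℝ} {ζ : Ω → ℝ} [MetricSpace I] [CompactSpace I]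
  [MeasurableSpace I] [BorelSpace I]

/-- The integrals of the complex weights are bounded in `L^{1+q}`. -/
theorem IsSiteField.exists_eLpNorm_integral_weight_le (h : IsSiteField P A ζ) (ν : Measure I)
    [IsFiniteMeasure ν] {D : Set ℂ} {Cb : ℝ} (hb : SiteBounds ζ P D Cb) {Cν dd : ℝ} (hCν : 0 ≤ Cν)
    (hν : ∀ l j x, ν (shell l j x) ≤ ENNReal.ofReal (Cν * Real.exp (-(dd * l))))
    {t₁ q B δ R : ℝ} (ht₁ : 0 ≤ t₁) (hq0 : 0 < q) (hq1 : q < 1) (hδ : 0 < δ)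
    (hB : 0 ≤ B) (hR : 0 ≤ R) (hκ : t₁ ^ 2 / (2 * (1 - q)) < dd) {a : ℕ → ℝ} {n : ℕ → ℕ}
    (hs : ScaleBounds a (siteCov P A) n δ B) (hn : Tendsto n atTop atTop) :
    ∃ C : ℝ, 0 ≤ C ∧ ∀ β : ℂ,
      0 ≤ β.re → β.re ≤ t₁ → ‖β‖ ≤ R → β.im ^ 2 ≤ blockRate dd t₁ q δ / 2 → (∀ k, β * a k ∈ D) →
      (∀ k, ((β.re * a k : ℝ) : ℂ) ∈ D) → ∀ (g : C(I, ℂ)) (N : ℕ),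
      eLpNorm (fun ω => ∫ x, g x * weight (complexMGF ζ P) A (fun k => β * a k) 0 N x ω ∂ν)
        (ENNReal.ofReal (1 + q)) P ≤ ENNReal.ofReal (C * ‖g‖) := by
  obtain ⟨C₁, hC₁, H₁⟩ := h.exists_eLpNorm_resProd_le ν hb hq1 δ B R
  obtain ⟨C₂, hC₂, H₂⟩ := h.exists_eLpNorm_blockTerm_le ν hb hCν hν ht₁ hq0 hq1 hδ hB hR hκ
  set ρ := blockRate dd t₁ q δ / (2 * (1 + q)) with hρ
  have hρ0 : 0 < ρ := by have := blockRate_pos hq0 hδ hκ; positivity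
  have hG1 : Real.exp (-ρ) < 1 := Real.exp_lt_one_iff.2 (by linarith)
  set G : ℝ := ∑' l : ℕ, Real.exp (-ρ) ^ l with hG
  have hG0 : 0 ≤ G := tsum_nonneg fun l => by positivity
  refine ⟨C₁ + C₂ * G, by positivity, fun β hre hret hβ him hD hDr g N => ?_⟩
  -- With checkpoints truncated at N and n J ≥ N, the expansion over J blocks is that of the weight
  -- up to N. Its terms are summed by a geometric series that does not depend on J.
  obtain ⟨J, hJ⟩ := (hn.eventually_ge_atTop N).exists
  have hs' := hs.min N
  set m : ℕ → ℕ := fun l => min (n l) N with hm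
  have hmJ : m J = N := min_eq_right hJ
  set z : ℕ → ℂ := fun k => β * a k with hz
  set φ := complexMGF ζ P with hφ
  have hL := fun x => (h.l2On_resProd hs'.mono φ z 0 J x).1
  have hT := fun j x => L2On.mul h.siteSigma_le h.indep (S := Set.Ico 0 (m j)) (T := Set.Ici (m j))
    (Set.disjoint_left.2 fun k hk hk' => absurd hk.2 (not_lt.2 hk'))
    (h.l2On_weight φ z 0 (m j) x) (h.l2On_blockTerm hs'.mono φ z j J x)
  have hcL := h.continuous_resProd φ z m 0 J
  have hcT := fun j ω => (h.continuous_weight φ z 0 (m j) ω).mul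
    (h.continuous_blockTerm φ z m j J ω)
  set T : ℕ → Ω → ℂ := fun j ω => ∫ x, g x * (weight φ A z 0 (m j) x ω *
    blockTerm φ A z m j J x ω) ∂ν with hTd
  have key : (fun ω => ∫ x, g x * weight φ A z 0 N x ω ∂ν) =
      (fun ω => ∫ x, g x * resProd φ A z m 0 J x ω ∂ν) + ∑ j ∈ Finset.range J, T j := by
    funext ω
    have e : ∀ x, g x * weight φ A z 0 N x ω = g x * resProd φ A z m 0 J x ω +
        ∑ j ∈ Finset.range J, g x * (weight φ A z 0 (m j) x ω * blockTerm φ A z m j J x ω) :=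
      fun x => by
        rw [← hmJ, weight_eq_sum_blockTerm φ A z hs'.mono hs'.zero J x ω, mul_add, Finset.mul_sum]
    have i1 : Integrable (fun x => g x * resProd φ A z m 0 J x ω) ν :=
      continuous_integrable (g.continuous.mul (hcL ω))
    have i2 : ∀ j ∈ Finset.range J, Integrable (fun x => g x * (weight φ A z 0 (m j) x ω *
        blockTerm φ A z m j J x ω)) ν := fun j _ =>
      continuous_integrable (g.continuous.mul (hcT j ω))
    rw [integral_congr_ae (ae_of_all _ e), integral_add i1 (integrable_finsetSum _ i2),
      integral_finsetSum _ i2, Pi.add_apply, Finset.sum_apply]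
  have m1 : AEStronglyMeasurable (fun ω => ∫ x, g x * resProd φ A z m 0 J x ω ∂ν) P :=
    h.aestronglyMeasurable_integral ν (l2On_continuousMap_mul hL g)
      fun ω => g.continuous.mul (hcL ω)
  have m2 : ∀ j, AEStronglyMeasurable (T j) P := fun j =>
    h.aestronglyMeasurable_integral ν (l2On_continuousMap_mul (hT j) g)
      fun ω => g.continuous.mul (hcT j ω)
  have hp1 : (1 : ENNReal) ≤ ENNReal.ofReal (1 + q) := by
    rw [← ENNReal.ofReal_one]; exact ENNReal.ofReal_le_ofReal (by linarith)
  rw [key]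
  refine (eLpNorm_add_le m1 (Finset.aestronglyMeasurable_sum _ fun j _ => m2 j) hp1).trans ?_
  refine (add_le_add (H₁ a m hs' β hβ hD g J) ((eLpNorm_sum_le (fun j _ => m2 j) hp1).trans
    (Finset.sum_le_sum fun j _ => H₂ a m hs' β hre hret hβ him hD hDr g j J))).trans ?_
  rw [← ENNReal.ofReal_sum_of_nonneg fun j _ => by positivity, ← Finset.mul_sum,
    ← ENNReal.ofReal_add (by positivity) (by positivity)]
  refine ENNReal.ofReal_le_ofReal ?_
  have e : ∀ l : ℕ, Real.exp (-(ρ * l)) = Real.exp (-ρ) ^ l := fun l => by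
    rw [← Real.exp_nat_mul]; congr 1; ring
  simp_rw [e]
  have := (summable_geometric_of_lt_one (Real.exp_pos _).le hG1).sum_le_tsum (Finset.range J)
    fun l _ => by positivity
  calc _ ≤ C₁ * ‖g‖ + C₂ * ‖g‖ * G := by gcongr
    _ = _ := by ring

end LpBound


/-! ### Maximal inequality and convergence of martingales bounded in L^p. -/

section MartingaleConvergence

variable {Ω : Type*} {mΩ : MeasurableSpace Ω} {P : Measure Ω} [IsProbabilityMeasure P]
  {ℱ : Filtration ℕ mΩ} {M : ℕ → Ω → ℂ}

/-- The tail integral of the layer cake formula for a variable with a weak moment of order `p`. -/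
def tailBound (s p c : ℝ) : ENNReal :=
  ENNReal.ofReal s * (1 + ∫⁻ t in Set.Ioi (1 : ℝ), ENNReal.ofReal (c * t ^ (s - 1 - p)))

lemma tailBound_ne_top {s p c : ℝ} (hsp : s < p) : tailBound s p c ≠ ⊤ := by
  refine ENNReal.mul_ne_top ENNReal.ofReal_ne_top (ENNReal.add_ne_top.2 ⟨ENNReal.one_ne_top, ?_⟩)
  have : IntegrableOn (fun t : ℝ => c * t ^ (s - 1 - p)) (Set.Ioi 1) :=
    (integrableOn_Ioi_rpow_of_lt (by linarith) one_pos).const_mul c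
  exact this.lintegral_lt_top.ne

/-- Layer cake formula: probabilities are bounded by 1 for levels t ≤ 1 and by the weak moment for t
> 1. -/
lemma lintegral_rpow_le_tailBound {f : Ω → ℝ} (hf0 : ∀ ω, 0 ≤ f ω) (hf : Measurable f)
    {s p c : ℝ} (hs : 1 ≤ s) (hc : 0 ≤ c)
    (hw : ∀ t : ℝ, 0 < t → ENNReal.ofReal (t ^ p) * P {ω | t ≤ f ω} ≤ ENNReal.ofReal c) :
    ∫⁻ ω, ENNReal.ofReal (f ω ^ s) ∂P ≤ tailBound s p c := by
  rw [lintegral_rpow_eq_lintegral_meas_le_mul P (ae_of_all _ hf0) hf.aemeasurable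
    (by linarith : 0 < s), tailBound]
  gcongr
  rw [← Set.Ioc_union_Ioi_eq_Ioi zero_le_one]
  refine (lintegral_union_le _ _ _).trans (add_le_add ?_ ?_)
  · calc _ ≤ ∫⁻ _t in Set.Ioc (0 : ℝ) 1, 1 := by
          refine setLIntegral_mono' measurableSet_Ioc fun t ht => ?_
          refine mul_le_one' prob_le_one ?_
          rw [← ENNReal.ofReal_one]
          exact ENNReal.ofReal_le_ofReal (Real.rpow_le_one ht.1.le ht.2 (by linarith))
      _ = 1 := by simp
  · refine setLIntegral_mono' measurableSet_Ioi fun t ht => ?_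
    have ht0 : (0 : ℝ) < t := zero_lt_one.trans ht
    have h1 : P {ω | t ≤ f ω} ≤ ENNReal.ofReal (c * t ^ (-p)) := by
      have h2 : ENNReal.ofReal (t ^ p) ≠ 0 := by
        simpa using Real.rpow_pos_of_pos ht0 p
      rw [← ENNReal.mul_le_mul_iff_right h2 ENNReal.ofReal_ne_top]
      refine (hw t ht0).trans (le_of_eq ?_)
      rw [← ENNReal.ofReal_mul (by positivity)]
      congr 1
      rw [Real.rpow_neg ht0.le]
      field_simp
    calc _ ≤ ENNReal.ofReal (c * t ^ (-p)) * ENNReal.ofReal (t ^ (s - 1)) := by gcongr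
      _ = _ := by
        rw [← ENNReal.ofReal_mul (by positivity), mul_assoc, ← Real.rpow_add ht0]
        congr 3; ring

omit [IsProbabilityMeasure P] in
lemma submartingale_norm_rpow (hM : Martingale M ℱ P) {p : ℝ} (hp : 1 ≤ p)
    (hL : ∀ n, MemLp (M n) (ENNReal.ofReal p) P) :
    Submartingale (fun n ω => ‖M n ω‖ ^ p) ℱ P := by
  have hp0 : 0 < p := by linarith
  have hi : ∀ n, Integrable (fun ω => ‖M n ω‖ ^ p) P := fun n => by
    have := (hL n).integrable_norm_rpow (by simpa using hp0) ENNReal.ofReal_ne_top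
    rwa [ENNReal.toReal_ofReal hp0.le] at this
  refine ⟨fun n => ?_, fun i j hij => ?_, hi⟩
  · exact ((hM.stronglyMeasurable n).norm.measurable.pow_const p).stronglyMeasurable
  · filter_upwards [Integrable.norm_condExp_rpow_le (m := ℱ i) hp (hi j), hM.condExp_ae_eq hij]
      with ω h1 h2
    rwa [← h2]

/-- Doob's weak inequality for the submartingale |M|^p. This weak type bound is enough, since
convergence is only claimed in L^s with s < p. -/
lemma maximal_norm_rpow_le (hM : Martingale M ℱ P) {p C : ℝ} (hp : 1 ≤ p) (hC : 0 ≤ C)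
    (hL : ∀ n, eLpNorm (M n) (ENNReal.ofReal p) P ≤ ENNReal.ofReal C) (N : ℕ) {t : ℝ}
    (ht : 0 < t) :
    ENNReal.ofReal (t ^ p) * P {ω | t ≤ (Finset.range (N + 1)).sup' Finset.nonempty_range_add_one
      fun k => ‖M k ω‖} ≤ ENNReal.ofReal (C ^ p) := by
  have hp0 : 0 < p := by linarith
  have hmeas : ∀ n, AEStronglyMeasurable (M n) P := fun n =>
    ((hM.stronglyMeasurable n).mono (ℱ.le n)).aestronglyMeasurable
  have hLp : ∀ n, MemLp (M n) (ENNReal.ofReal p) P := fun n =>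
    ⟨hmeas n, (hL n).trans_lt ENNReal.ofReal_lt_top⟩
  have hsub := submartingale_norm_rpow hM hp hLp
  have h1 := maximal_ineq hsub (fun n ω => by positivity) (ε := (t ^ p).toNNReal) N
  have htp : 0 ≤ t ^ p := by positivity
  rw [Real.coe_toNNReal _ htp] at h1
  have hset : {ω | t ≤ (Finset.range (N + 1)).sup' Finset.nonempty_range_add_one
      fun k => ‖M k ω‖} ⊆ {ω | t ^ p ≤ (Finset.range (N + 1)).sup'
        Finset.nonempty_range_add_one fun k => ‖M k ω‖ ^ p} := by
    intro ω hω
    obtain ⟨k, hk, hkt⟩ := (Finset.le_sup'_iff _).1 (Set.mem_ofPred_eq ▸ hω)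
    exact (Finset.le_sup'_iff (f := fun k => ‖M k ω‖ ^ p) _).2
      ⟨k, hk, Real.rpow_le_rpow ht.le hkt hp0.le⟩
  calc _ ≤ ENNReal.ofReal (t ^ p) * P {ω | t ^ p ≤ (Finset.range (N + 1)).sup'
        Finset.nonempty_range_add_one fun k => ‖M k ω‖ ^ p} := by gcongr
    _ ≤ _ := h1
    _ ≤ ENNReal.ofReal (∫ ω, ‖M N ω‖ ^ p ∂P) := by
        refine ENNReal.ofReal_le_ofReal (setIntegral_le_integral (hsub.integrable N)
          (ae_of_all _ fun ω => by positivity))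
    _ = ∫⁻ ω, ‖M N ω‖ₑ ^ p ∂P := by
        rw [ofReal_integral_eq_lintegral_ofReal (hsub.integrable N)
          (ae_of_all _ fun ω => by positivity)]
        refine lintegral_congr fun ω => ?_
        rw [← ENNReal.ofReal_rpow_of_nonneg (norm_nonneg _) hp0.le, ofReal_norm]
    _ = eLpNorm (M N) (ENNReal.ofReal p) P ^ p := lintegral_enorm_rpow_of_eLpNorm hp0
    _ ≤ ENNReal.ofReal C ^ p := by gcongr; exact hL N
    _ = _ := ENNReal.ofReal_rpow_of_nonneg hC hp0.le

/-- Doob's maximal inequality for the moment of order `s < p` of an `L^p` bounded martingale. -/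
lemma lintegral_iSup_enorm_rpow_le (hM : Martingale M ℱ P) {s p C : ℝ} (hs : 1 ≤ s) (hsp : s < p)
    (hC : 0 ≤ C) (hL : ∀ n, eLpNorm (M n) (ENNReal.ofReal p) P ≤ ENNReal.ofReal C) :
    ∫⁻ ω, (⨆ n, ‖M n ω‖ₑ) ^ s ∂P ≤ tailBound s p (C ^ p) := by
  have hmeas : ∀ n, Measurable (M n) := fun n =>
    ((hM.stronglyMeasurable n).mono (ℱ.le n)).measurable
  set F : ℕ → Ω → ℝ := fun N ω => (Finset.range (N + 1)).sup' Finset.nonempty_range_add_one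
    fun k => ‖M k ω‖ with hF
  have hFm : ∀ N, Measurable (F N) := fun N =>
    Finset.measurable_range_sup'' fun k _ => (hmeas k).norm
  have hF0 : ∀ N ω, 0 ≤ F N ω := fun N ω =>
    (norm_nonneg (M 0 ω)).trans (Finset.le_sup' (fun k => ‖M k ω‖) (by simp))
  have hFmono : ∀ ω, Monotone fun N => F N ω := fun ω N N' h =>
    Finset.sup'_mono _ (Finset.range_mono (by omega)) _
  have hle : ∀ ω, (⨆ n, ‖M n ω‖ₑ) ^ s ≤ ⨆ N, ENNReal.ofReal (F N ω ^ s) := by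
    intro ω
    have e : ∀ N, ENNReal.ofReal (F N ω ^ s) = ENNReal.ofReal (F N ω) ^ s := fun N =>
      (ENNReal.ofReal_rpow_of_nonneg (hF0 N ω) (by linarith)).symm
    simp_rw [e]
    have e2 := (ENNReal.orderIsoRpow s (by linarith)).map_iSup fun n => ‖M n ω‖ₑ
    simp only [ENNReal.orderIsoRpow_apply] at e2
    rw [e2]
    refine iSup_mono fun N => ?_
    gcongr
    rw [← ofReal_norm]
    exact ENNReal.ofReal_le_ofReal (Finset.le_sup' (fun k => ‖M k ω‖) (by simp))
  refine (lintegral_mono hle).trans ?_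
  rw [lintegral_iSup (fun N => ((hFm N).pow_const s).ennreal_ofReal)]
  · exact iSup_le fun N => lintegral_rpow_le_tailBound (hF0 N) (hFm N) hs (by positivity)
      fun t ht => maximal_norm_rpow_le hM (by linarith) hC hL N ht
  · intro N N' h ω
    exact ENNReal.ofReal_le_ofReal (Real.rpow_le_rpow (hF0 N ω) (hFmono ω h) (by linarith))

omit [IsProbabilityMeasure P] in
lemma martingale_comp (hM : Martingale M ℱ P) (T : ℂ →L[ℝ] ℝ) :
    Martingale (fun n ω => T (M n ω)) ℱ P := by
  refine ⟨fun n => T.continuous.comp_stronglyMeasurable (hM.stronglyMeasurable n),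
    fun i j hij => ?_⟩
  have h1 := T.comp_condExp_comm (m := ℱ i) (hM.integrable j)
  filter_upwards [h1, hM.condExp_ae_eq hij] with ω h1 h2
  change P[T ∘ M j | ℱ i] ω = _
  rw [← h1, Function.comp_apply, h2]

/-- Almost sure convergence of `L¹` bounded complex martingales. -/
lemma ae_exists_tendsto (hM : Martingale M ℱ P) {C : ℝ}
    (hL : ∀ n, eLpNorm (M n) 1 P ≤ ENNReal.ofReal C) :
    ∀ᵐ ω ∂P, ∃ l, Tendsto (fun n => M n ω) atTop (𝓝 l) := by
  have key : ∀ T : ℂ →L[ℝ] ℝ, (∀ z, ‖T z‖ ≤ ‖z‖) →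
      ∀ᵐ ω ∂P, ∃ l, Tendsto (fun n => T (M n ω)) atTop (𝓝 l) := fun T hT => by
    refine (martingale_comp hM T).submartingale.exists_ae_tendsto_of_bdd (R := C.toNNReal)
      fun n => ?_
    exact (eLpNorm_mono fun ω => hT _).trans (hL n)
  filter_upwards [key Complex.reCLM Complex.abs_re_le_norm,
    key Complex.imCLM Complex.abs_im_le_norm] with ω ⟨x, hx⟩ ⟨y, hy⟩
  refine ⟨x + y * Complex.I, ?_⟩
  have h1 := ((Complex.continuous_ofReal.tendsto x).comp hx).add
    (((Complex.continuous_ofReal.tendsto y).comp hy).mul_const Complex.I)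
  refine h1.congr fun n => ?_
  simp [Complex.re_add_im]

/-- An `L^p` bounded martingale converges in `L^s` for `s < p`. -/
theorem exists_tendsto_eLpNorm_sub (hM : Martingale M ℱ P) {s p C : ℝ} (hs : 1 ≤ s) (hsp : s < p)
    (hC : 0 ≤ C) (hL : ∀ n, eLpNorm (M n) (ENNReal.ofReal p) P ≤ ENNReal.ofReal C) :
    (∀ n, MemLp (M n) (ENNReal.ofReal s) P) ∧
    ∃ L : Ω → ℂ, MemLp L (ENNReal.ofReal s) P ∧
      Tendsto (fun n => eLpNorm (fun ω => M n ω - L ω) (ENNReal.ofReal s) P) atTop (𝓝 0) := by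
  have hs0 : 0 < s := by linarith
  have hmeas : ∀ n, StronglyMeasurable (M n) := fun n => (hM.stronglyMeasurable n).mono (ℱ.le n)
  have hle : ∀ {r : ℝ}, r ≤ p → ∀ n,
      eLpNorm (M n) (ENNReal.ofReal r) P ≤ ENNReal.ofReal C := fun hr n =>
    (eLpNorm_le_eLpNorm_of_exponent_le (ENNReal.ofReal_le_ofReal hr)
      (hmeas n).aestronglyMeasurable).trans (hL n)
  have h1 : ∀ n, eLpNorm (M n) 1 P ≤ ENNReal.ofReal C := fun n => by
    have := hle (r := 1) (by linarith) n
    rwa [ENNReal.ofReal_one] at this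
  have hMs : ∀ n, MemLp (M n) (ENNReal.ofReal s) P := fun n =>
    ⟨(hmeas n).aestronglyMeasurable, (hle hsp.le n).trans_lt ENNReal.ofReal_lt_top⟩
  refine ⟨hMs, ?_⟩
  obtain ⟨L, hLm, hLt⟩ := exists_stronglyMeasurable_limit_of_tendsto_ae
    (fun n => (hmeas n).aestronglyMeasurable) (ae_exists_tendsto hM h1)
  set S : Ω → ENNReal := fun ω => ⨆ n, ‖M n ω‖ₑ with hS
  have hSm : Measurable S := .iSup fun n => (hmeas n).measurable.enorm
  have hSL : ∀ᵐ ω ∂P, ‖L ω‖ₑ ≤ S ω := by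
    filter_upwards [hLt] with ω hω
    exact le_of_tendsto' (continuous_enorm.continuousAt.tendsto.comp hω) fun n =>
      le_iSup (fun n => ‖M n ω‖ₑ) n
  have hSfin : ∫⁻ ω, S ω ^ s ∂P ≠ ⊤ := ((lintegral_iSup_enorm_rpow_le hM hs hsp hC hL).trans_lt
    (tailBound_ne_top hsp).lt_top).ne
  have hsr : ENNReal.ofReal s ≠ 0 := by simpa using hs0
  refine ⟨L, ⟨hLm.aestronglyMeasurable, ?_⟩, ?_⟩
  · rw [eLpNorm_lt_top_iff_lintegral_rpow_enorm_lt_top hsr ENNReal.ofReal_ne_top,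
      ENNReal.toReal_ofReal hs0.le]
    refine lt_of_le_of_lt (lintegral_mono_ae ?_) hSfin.lt_top
    filter_upwards [hSL] with ω hω
    gcongr
  · have key : Tendsto (fun n => ∫⁻ ω, ‖M n ω - L ω‖ₑ ^ s ∂P) atTop (𝓝 (∫⁻ _ω, 0 ∂P)) := by
      refine tendsto_lintegral_of_dominated_convergence' (fun ω => (2 * S ω) ^ s)
        (fun n => (((hmeas n).sub hLm).measurable.enorm.pow_const s).aemeasurable) ?_ ?_ ?_
      · intro n
        filter_upwards [hSL] with ω hω
        gcongr
        calc ‖M n ω - L ω‖ₑ ≤ ‖M n ω‖ₑ + ‖L ω‖ₑ := enorm_sub_le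
          _ ≤ S ω + S ω := add_le_add (le_iSup (fun n => ‖M n ω‖ₑ) n) hω
          _ = 2 * S ω := (two_mul _).symm
      · simp_rw [ENNReal.mul_rpow_of_nonneg _ _ hs0.le]
        rw [lintegral_const_mul _ (hSm.pow_const s)]
        exact ENNReal.mul_ne_top (by finiteness) hSfin
      · filter_upwards [hLt] with ω hω
        have h2 : Tendsto (fun n => M n ω - L ω) atTop (𝓝 0) := by
          simpa using hω.sub_const (L ω)
        have h3 := (continuous_enorm.tendsto (0 : ℂ)).comp h2
        rw [enorm_zero] at h3
        have h4 := (ENNReal.continuous_rpow_const (y := s)).tendsto 0 |>.comp h3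
        rwa [ENNReal.zero_rpow_of_pos hs0] at h4
    rw [lintegral_zero] at key
    have e : ∀ n, eLpNorm (fun ω => M n ω - L ω) (ENNReal.ofReal s) P =
        (∫⁻ ω, ‖M n ω - L ω‖ₑ ^ s ∂P) ^ (1 / s) := fun n => by
      rw [eLpNorm_eq_lintegral_rpow_enorm_toReal hsr ENNReal.ofReal_ne_top,
        ENNReal.toReal_ofReal hs0.le]
    simp_rw [e]
    have h5 := (ENNReal.continuous_rpow_const (y := 1 / s)).tendsto 0 |>.comp key
    rwa [ENNReal.zero_rpow_of_pos (by positivity)] at h5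

end MartingaleConvergence


/-! ### Uniform convergence of analytic families of martingales. -/

/-- Cauchy's formula: in the disc of half the radius the kernel r/|ξ - β| is at most 2, and 2/(2π) ≤
1. -/
lemma enorm_le_lintegral_circleMap {g : ℂ → ℂ} {c β : ℂ} {r : ℝ} (hr : 0 < r)
    (hg : DiffContOnCl ℂ g (Metric.ball c r)) (hβ : β ∈ Metric.closedBall c (r / 2)) :
    ‖g β‖ₑ ≤ ∫⁻ θ in Set.Ioc 0 (2 * Real.pi), ‖g (circleMap c r θ)‖ₑ := by
  have hβ' : β ∈ Metric.ball c r := Metric.closedBall_subset_ball (by linarith) hβ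
  have h := hg.circleIntegral_sub_inv_smul hβ'
  rw [circleIntegral, intervalIntegral.integral_of_le Real.two_pi_pos.le] at h
  have h1 : ‖(2 * Real.pi * Complex.I : ℂ) • g β‖ₑ ≤
      2 * ∫⁻ θ in Set.Ioc 0 (2 * Real.pi), ‖g (circleMap c r θ)‖ₑ := by
    rw [← h]
    refine (enorm_integral_le_lintegral_enorm _).trans ?_
    rw [← lintegral_const_mul' _ _ (by finiteness)]
    refine lintegral_mono fun θ => ?_
    rw [smul_smul, enorm_smul]
    refine mul_le_mul_left ?_ _
    rw [← ofReal_norm, show (2 : ENNReal) = ENNReal.ofReal 2 by simp]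
    refine ENNReal.ofReal_le_ofReal ?_
    have h2 : r / 2 ≤ ‖circleMap c r θ - β‖ := by
      have h3 : ‖circleMap c r θ - c‖ = r := by simp [circleMap, abs_of_pos hr]
      have h4 : ‖β - c‖ ≤ r / 2 := by simpa [dist_eq_norm] using hβ
      have h5 := norm_sub_norm_le (circleMap c r θ - c) (β - c)
      rw [sub_sub_sub_cancel_right] at h5
      linarith
    rw [norm_mul, norm_inv, deriv_circleMap, norm_mul, Complex.norm_I, mul_one]
    have h6 : ‖circleMap 0 r θ‖ = r := by simp [circleMap, abs_of_pos hr]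
    rw [h6, ← div_eq_mul_inv, div_le_iff₀ (by linarith)]
    linarith
  rw [enorm_smul, ← ofReal_norm (2 * Real.pi * Complex.I : ℂ)] at h1
  have h2 : ENNReal.ofReal ‖(2 * Real.pi * Complex.I : ℂ)‖ = 2 * ENNReal.ofReal Real.pi := by
    simp [abs_of_pos Real.pi_pos, ENNReal.ofReal_mul]
  rw [h2, mul_assoc] at h1
  have h3 := (ENNReal.mul_le_mul_iff_right two_ne_zero (by finiteness)).1 h1
  refine le_trans ?_ h3
  refine le_mul_of_one_le_left zero_le ?_
  rw [← ENNReal.ofReal_one]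
  exact ENNReal.ofReal_le_ofReal (by linarith [Real.pi_gt_three])

lemma tendsto_lintegral_enorm_sub {α : Type*} [MeasurableSpace α] {μ : Measure α}
    {f : ℕ → α → ℂ} {L : α → ℂ} (hf : ∀ n, AEStronglyMeasurable (f n) μ)
    (hL : AEStronglyMeasurable L μ) (hS : ∫⁻ x, ⨆ n, ‖f n x‖ₑ ∂μ ≠ ⊤)
    (hlim : ∀ᵐ x ∂μ, Tendsto (fun n => f n x) atTop (𝓝 (L x))) :
    Tendsto (fun n => ∫⁻ x, ‖f n x - L x‖ₑ ∂μ) atTop (𝓝 0) := by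
  have key : Tendsto (fun n => ∫⁻ x, ‖f n x - L x‖ₑ ∂μ) atTop (𝓝 (∫⁻ _x, 0 ∂μ)) := by
    refine tendsto_lintegral_of_dominated_convergence' (fun x => 2 * ⨆ n, ‖f n x‖ₑ)
      (fun n => ((hf n).sub hL).enorm) ?_ ?_ ?_
    · intro n
      filter_upwards [hlim] with x hx
      have h1 : ‖L x‖ₑ ≤ ⨆ n, ‖f n x‖ₑ :=
        le_of_tendsto' (continuous_enorm.continuousAt.tendsto.comp hx) fun n =>
          le_iSup (fun n => ‖f n x‖ₑ) n
      calc ‖f n x - L x‖ₑ ≤ ‖f n x‖ₑ + ‖L x‖ₑ := enorm_sub_le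
        _ ≤ (⨆ n, ‖f n x‖ₑ) + ⨆ n, ‖f n x‖ₑ :=
          add_le_add (le_iSup (fun n => ‖f n x‖ₑ) n) h1
        _ = _ := (two_mul _).symm
    · rw [lintegral_const_mul' _ _ (by finiteness)]
      exact ENNReal.mul_ne_top (by finiteness) hS
    · filter_upwards [hlim] with x hx
      have h2 : Tendsto (fun n => f n x - L x) atTop (𝓝 0) := by
        simpa using hx.sub_const (L x)
      have h3 := (continuous_enorm.tendsto (0 : ℂ)).comp h2
      rwa [enorm_zero] at h3
  rwa [lintegral_zero] at key

/-- An integrable supremum and convergence almost everywhere on the circle give convergence in L¹ of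
the circle. By Cauchy's formula this controls differences uniformly in the half disc, so the
sequence is uniformly Cauchy there. -/
lemma exists_tendstoUniformlyOn_of_circle {f : ℕ → ℂ → ℂ} {c : ℂ} {r : ℝ} (hr : 0 < r)
    (hd : ∀ n, DiffContOnCl ℂ (f n) (Metric.ball c r))
    (hS : ∫⁻ θ in Set.Ioc 0 (2 * Real.pi), ⨆ n, ‖f n (circleMap c r θ)‖ₑ ≠ ⊤)
    (hlim : ∀ᵐ θ ∂(volume.restrict (Set.Ioc 0 (2 * Real.pi))),
      ∃ l, Tendsto (fun n => f n (circleMap c r θ)) atTop (𝓝 l)) :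
    ∃ G, TendstoUniformlyOn f G atTop (Metric.closedBall c (r / 2)) := by
  have hc : ∀ n, Continuous fun θ => f n (circleMap c r θ) := fun n =>
    (hd n).continuousOn_ball.comp_continuous (continuous_circleMap c r) fun θ =>
      Metric.sphere_subset_closedBall (circleMap_mem_sphere c hr.le θ)
  obtain ⟨L, hLm, hLt⟩ := exists_stronglyMeasurable_limit_of_tendsto_ae
    (fun n => (hc n).aestronglyMeasurable) hlim
  have h0 := tendsto_lintegral_enorm_sub (fun n => (hc n).aestronglyMeasurable)
    hLm.aestronglyMeasurable hS hLt
  set u : ℕ → ENNReal := fun n =>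
    ∫⁻ θ in Set.Ioc 0 (2 * Real.pi), ‖f n (circleMap c r θ) - L θ‖ₑ with hu
  have hnm : ∀ n m, ∀ β ∈ Metric.closedBall c (r / 2), ‖f n β - f m β‖ₑ ≤ u n + u m := by
    intro n m β hβ
    refine (enorm_le_lintegral_circleMap hr ((hd n).sub (hd m)) hβ).trans ?_
    have hmeas : Measurable fun θ => ‖f n (circleMap c r θ) - L θ‖ₑ :=
      ((hc n).measurable.sub hLm.measurable).enorm
    simp only [hu]
    rw [← lintegral_add_left hmeas]
    refine lintegral_mono fun θ => ?_
    simp only [Pi.sub_apply]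
    calc ‖f n (circleMap c r θ) - f m (circleMap c r θ)‖ₑ
        = ‖(f n (circleMap c r θ) - L θ) - (f m (circleMap c r θ) - L θ)‖ₑ := by ring_nf
      _ ≤ _ := enorm_sub_le
  have hcau : UniformCauchySeqOn f atTop (Metric.closedBall c (r / 2)) := by
    rw [Metric.uniformCauchySeqOn_iff]
    intro ε hε
    have hε' : (0 : ENNReal) < ENNReal.ofReal (ε / 2) := by simpa using hε
    obtain ⟨N, hN⟩ := eventually_atTop.1 (h0.eventually_lt_const hε')
    refine ⟨N, fun n hn m hm β hβ => ?_⟩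
    have h1 := (hnm n m β hβ).trans_lt (ENNReal.add_lt_add (hN n hn) (hN m hm))
    rw [← ENNReal.ofReal_add (by linarith) (by linarith), add_halves, ← ofReal_norm] at h1
    rw [dist_eq_norm]
    exact (ENNReal.ofReal_lt_ofReal_iff hε).1 h1
  have hpt : ∀ β ∈ Metric.closedBall c (r / 2), ∃ l, Tendsto (fun n => f n β) atTop (𝓝 l) :=
    fun β hβ => cauchySeq_tendsto_of_complete (hcau.cauchySeq hβ)
  choose! G hG using hpt
  exact ⟨G, hcau.tendstoUniformlyOn_of_tendsto hG⟩

section RandomAnalytic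

variable {Ω : Type*} {mΩ : MeasurableSpace Ω} {P : Measure Ω} [IsProbabilityMeasure P]
  {ℱ : Filtration ℕ mΩ} {M : ℕ → ℂ → Ω → ℂ}

/-- An analytic family of martingales that is bounded in `L^p` on a circle converges uniformly in
the concentric disc of half the radius. -/
theorem ae_exists_tendstoUniformlyOn {c : ℂ} {r p C : ℝ} (hr : 0 < r) (hp : 1 < p) (hC : 0 ≤ C)
    (hM : ∀ β ∈ Metric.sphere c r, Martingale (fun n => M n β) ℱ P)
    (hL : ∀ β ∈ Metric.sphere c r, ∀ n,
      eLpNorm (M n β) (ENNReal.ofReal p) P ≤ ENNReal.ofReal C)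
    (hd : ∀ n ω, DiffContOnCl ℂ (fun β => M n β ω) (Metric.ball c r)) :
    ∀ᵐ ω ∂P, ∃ G, TendstoUniformlyOn (fun n β => M n β ω) G atTop
      (Metric.closedBall c (r / 2)) := by
  have hsph : ∀ θ, circleMap c r θ ∈ Metric.sphere c r := circleMap_mem_sphere c hr.le
  have hc : ∀ n ω, Continuous fun θ => M n (circleMap c r θ) ω := fun n ω =>
    (hd n ω).continuousOn_ball.comp_continuous (continuous_circleMap c r) fun θ =>
      Metric.sphere_subset_closedBall (hsph θ)
  have hm : ∀ n, Measurable fun z : ℝ × Ω => M n (circleMap c r z.1) z.2 := fun n =>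
    measurable_uncurry_of_continuous_of_measurable (u := fun θ ω => M n (circleMap c r θ) ω)
      (hc n) fun θ => (((hM _ (hsph θ)).stronglyMeasurable n).mono (ℱ.le n)).measurable
  set ν : Measure ℝ := volume.restrict (Set.Ioc 0 (2 * Real.pi)) with hν
  have hsupm : Measurable fun z : ℝ × Ω => ⨆ n, ‖M n (circleMap c r z.1) z.2‖ₑ :=
    .iSup fun n => (hm n).enorm
  -- Any exponent in [1, p) would do: the moment of order s of the supremum is finite, and it
  -- dominates the first moment through x ≤ 1 + x^s.
  set s : ℝ := (1 + p) / 2 with hs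
  have hs1 : 1 ≤ s := by rw [hs]; linarith
  have hsp : s < p := by rw [hs]; linarith
  have hsup : ∀ θ, ∫⁻ ω, ⨆ n, ‖M n (circleMap c r θ) ω‖ₑ ∂P ≤ 1 + tailBound s p (C ^ p) := by
    intro θ
    calc _ ≤ ∫⁻ ω, 1 + (⨆ n, ‖M n (circleMap c r θ) ω‖ₑ) ^ s ∂P := by
          refine lintegral_mono fun ω => ?_
          rcases le_total (⨆ n, ‖M n (circleMap c r θ) ω‖ₑ) 1 with h | h
          · exact h.trans le_self_add
          · refine le_trans ?_ le_add_self
            simpa using ENNReal.rpow_le_rpow_of_exponent_le h hs1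
      _ = 1 + ∫⁻ ω, (⨆ n, ‖M n (circleMap c r θ) ω‖ₑ) ^ s ∂P := by
          rw [lintegral_add_left measurable_const]; simp
      _ ≤ _ := by
          gcongr
          exact lintegral_iSup_enorm_rpow_le (hM _ (hsph θ)) hs1 hsp hC (hL _ (hsph θ))
  have h1 : ∀ᵐ ω ∂P, ∫⁻ θ, ⨆ n, ‖M n (circleMap c r θ) ω‖ₑ ∂ν < ⊤ := by
    refine ae_lt_top hsupm.lintegral_prod_left' (ne_of_lt ?_)
    rw [lintegral_lintegral_swap (f := fun ω θ => ⨆ n, ‖M n (circleMap c r θ) ω‖ₑ)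
      (hsupm.comp measurable_swap).aemeasurable]
    refine lt_of_le_of_lt (lintegral_mono hsup) ?_
    rw [lintegral_const]
    exact ENNReal.mul_lt_top (ENNReal.add_lt_top.2 ⟨by finiteness,
      (tailBound_ne_top hsp).lt_top⟩) (measure_lt_top _ _)
  -- Martingale convergence holds almost surely at each fixed point of the circle. The set of
  -- convergence is jointly measurable, so Fubini exchanges the two quantifiers.
  have h2 : ∀ᵐ ω ∂P, ∀ᵐ θ ∂ν, ∃ l, Tendsto (fun n => M n (circleMap c r θ) ω) atTop (𝓝 l) := by
    have hset : MeasurableSet {z : ℝ × Ω | ∃ l, Tendsto (fun n => M n (circleMap c r z.1) z.2)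
        atTop (𝓝 l)} := measurableSet_exists_tendsto hm
    refine (Measure.ae_ae_comm (p := fun θ ω =>
      ∃ l, Tendsto (fun n => M n (circleMap c r θ) ω) atTop (𝓝 l)) hset).1
      (ae_of_all _ fun θ => ?_)
    refine ae_exists_tendsto (C := C) (hM _ (hsph θ)) fun n => ?_
    refine le_trans (eLpNorm_le_eLpNorm_of_exponent_le ?_
      (((hM _ (hsph θ)).stronglyMeasurable n).mono (ℱ.le n)).aestronglyMeasurable)
      (hL _ (hsph θ) n)
    rw [← ENNReal.ofReal_one]
    exact ENNReal.ofReal_le_ofReal hp.le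
  filter_upwards [h1, h2] with ω hω1 hω2
  exact exists_tendstoUniformlyOn_of_circle hr (fun n => hd n ω) hω1.ne hω2

end RandomAnalytic


/-! ### The martingale property. -/

section WeightMartingale

variable {I Ω : Type*} {mΩ : MeasurableSpace Ω} {P : Measure Ω} [IsProbabilityMeasure P]
  {A : ℕ → I → Ω → ℝ} {ζ : Ω → ℝ} [MetricSpace I] [CompactSpace I]
  [MeasurableSpace I] [BorelSpace I]

namespace IsSiteField

variable (h : IsSiteField P A ζ)

include h

lemma measurable_uncurry_weight (φ : ℂ → ℂ) (z : ℕ → ℂ) (a b : ℕ) :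
    Measurable (Function.uncurry (weight φ A z a b)) :=
  measurable_uncurry_of_continuous_of_measurable (h.continuous_weight φ z a b) fun x =>
    (h.l2On_weight φ z a b x).meas.mono (sigmaOn_le h.siteSigma_le _) le_rfl

lemma integrable_prod_weight (ν : Measure I) [IsFiniteMeasure ν] (φ : ℂ → ℂ) (z : ℕ → ℂ)
    (g : C(I, ℂ)) (a b : ℕ) :
    Integrable (fun p : Ω × I => g p.2 * weight φ A z a b p.2 p.1) (P.prod ν) := by
  have hm : Measurable fun p : Ω × I => g p.2 * weight φ A z a b p.2 p.1 :=
    (g.continuous.measurable.comp measurable_snd).mul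
      ((h.measurable_uncurry_weight φ z a b).comp measurable_swap)
  refine (integrable_prod_iff' hm.aestronglyMeasurable).2 ⟨ae_of_all _ fun x =>
    (h.l2On_weight φ z a b x).integrable.const_mul (g x), ?_⟩
  have hsq : ∀ x, ∫ ω, ‖weight φ A z a b x ω‖ ^ 2 ∂P =
      ∏ i ∈ Finset.Ico a b, ∫ ω, ‖site φ (z i) (ζ ω)‖ ^ 2 ∂P := fun x => by
    have := (L2On.prod_Ico h.siteSigma_le h.indep (fun i => h.l2On_site φ (z i) i x) a b).2
    simp only [weight]
    rw [this]
    exact Finset.prod_congr rfl fun i _ => h.integral_comp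
      (u := fun y => ‖site φ (z i) y‖ ^ 2) ((continuous_site φ (z i)).norm.pow 2).measurable i x
  refine Integrable.of_bound (C := ‖g‖ * (1 + ∏ i ∈ Finset.Ico a b,
    ∫ ω, ‖site φ (z i) (ζ ω)‖ ^ 2 ∂P)) ?_ (ae_of_all _ fun x => ?_)
  · exact (StronglyMeasurable.integral_prod_left'
      (f := fun p : Ω × I => ‖g p.2 * weight φ A z a b p.2 p.1‖)
      hm.norm.stronglyMeasurable).aestronglyMeasurable
  · have i1 : Integrable (fun ω => ‖weight φ A z a b x ω‖) P :=
      (h.l2On_weight φ z a b x).integrable.norm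
    have i2 : Integrable (fun ω => ‖weight φ A z a b x ω‖ ^ 2) P :=
      (h.l2On_weight φ z a b x).memLp.integrable_sq_norm
    have i3 : Integrable (fun ω => 1 + ‖weight φ A z a b x ω‖ ^ 2) P := (integrable_const 1).add i2
    rw [Real.norm_of_nonneg (integral_nonneg fun ω => norm_nonneg _)]
    simp_rw [norm_mul]
    rw [integral_const_mul]
    refine mul_le_mul (g.norm_coe_le_norm x) ?_ (integral_nonneg fun ω => norm_nonneg _)
      (norm_nonneg _)
    refine (integral_mono i1 i3 fun ω => ?_).trans (le_of_eq ?_)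
    · simp only
      nlinarith [sq_nonneg (‖weight φ A z a b x ω‖ - 1), norm_nonneg (weight φ A z a b x ω)]
    · rw [integral_add (integrable_const 1) i2, hsq]
      simp

omit [CompactSpace I] [MeasurableSpace I] [BorelSpace I] in
-- The new factor is independent of the event and of the earlier factors, and has mean one.
lemma setIntegral_weight_succ {z : ℕ → ℂ} (hz : ∀ k, complexMGF ζ P (z k) ≠ 0) (n : ℕ) (x : I)
    {s : Set Ω} (hs : MeasurableSet[sigmaOn (siteSigma A) (Set.Ico 0 n)] s) :
    ∫ ω in s, weight (complexMGF ζ P) A z 0 (n + 1) x ω ∂P =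
      ∫ ω in s, weight (complexMGF ζ P) A z 0 n x ω ∂P := by
  set φ := complexMGF ζ P with hφ
  have hs' : MeasurableSet s := sigmaOn_le h.siteSigma_le _ s hs
  rw [← integral_indicator hs', ← integral_indicator hs']
  have e : ∀ ω, s.indicator (weight φ A z 0 (n + 1) x) ω =
      s.indicator (weight φ A z 0 n x) ω * site φ (z n) (A n x ω) := fun ω => by
    by_cases hω : ω ∈ s
    · simp only [Set.indicator_of_mem hω, weight, Finset.prod_Ico_succ_top (Nat.zero_le n)]
    · simp [Set.indicator_of_notMem hω]
  have hdisj : Disjoint (Set.Ico 0 n) {n} := by simp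
  rw [integral_congr_ae (ae_of_all _ e), integral_mul_of_disjoint h.siteSigma_le h.indep hdisj
    ((h.l2On_weight φ z 0 n x).meas.indicator hs) (h.l2On_site φ (z n) n x).meas,
    h.integral_comp (continuous_site φ (z n)).measurable, IsStandardExp.integral_site (hz n), mul_one]

/-- The integrals of the weights form a martingale. -/
theorem martingale_integral_weight (ν : Measure I) [IsFiniteMeasure ν] {ℱ : Filtration ℕ mΩ}
    (hℱ : ∀ n, ℱ n ≤ sigmaOn (siteSigma A) (Set.Ico 0 n)) {z : ℕ → ℂ}
    (hW : ∀ n x, Measurable[ℱ n] (weight (complexMGF ζ P) A z 0 n x))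
    (hz : ∀ k, complexMGF ζ P (z k) ≠ 0) (g : C(I, ℂ)) :
    Martingale (fun n ω => ∫ x, g x * weight (complexMGF ζ P) A z 0 n x ω ∂ν) ℱ P := by
  set φ := complexMGF ζ P with hφ
  have hint := h.integrable_prod_weight ν φ z g
  refine martingale_of_setIntegral_eq_succ (fun n => ?_) (fun n => (hint 0 n).integral_prod_left)
    fun n s hs => ?_
  · have hm : @Measurable (I × Ω) ℂ (@Prod.instMeasurableSpace _ _ _ (ℱ n)) _
        (Function.uncurry fun x ω => g x * weight φ A z 0 n x ω) := by
      let _ : MeasurableSpace Ω := ℱ n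
      exact measurable_uncurry_of_continuous_of_measurable
        (fun ω => g.continuous.mul (h.continuous_weight φ z 0 n ω)) fun x =>
          (hW n x).const_mul (g x)
    let _ : MeasurableSpace Ω := ℱ n
    exact StronglyMeasurable.integral_prod_left (f := fun x ω => g x * weight φ A z 0 n x ω)
      hm.stronglyMeasurable
  · have hsw : ∀ m, ∫ ω in s, ∫ x, g x * weight φ A z 0 m x ω ∂ν ∂P =
        ∫ x, g x * ∫ ω in s, weight φ A z 0 m x ω ∂P ∂ν := fun m => by
      have hi : Integrable (fun p : Ω × I => g p.2 * weight φ A z 0 m p.2 p.1)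
          ((P.restrict s).prod ν) :=
        (hint 0 m).mono_measure (Measure.prod_mono Measure.restrict_le_self le_rfl)
      rw [integral_integral_swap (f := fun ω x => g x * weight φ A z 0 m x ω) hi]
      exact integral_congr_ae (ae_of_all _ fun x => integral_const_mul _ _)
    rw [hsw, hsw]
    refine integral_congr_ae (ae_of_all _ fun x => ?_)
    simp only
    rw [h.setIntegral_weight_succ hz n x (hℱ n s hs)]

end IsSiteField

end WeightMartingale


/-! ### Choice of the exponent and of the complex disc. -/

/-- On the real axis the generating function is at least 1. By compactness its modulus stays above
1/2 in a uniform neighbourhood of the segment, where the one-variable estimates then apply. -/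
lemma IsStandardExp.exists_thickening {Ω : Type*} {mΩ : MeasurableSpace Ω} {P : Measure Ω}
    [IsProbabilityMeasure P] {ζ : Ω → ℝ} (h : IsStandardExp ζ P) (t₁ : ℝ) :
    ∃ (ρ C : ℝ), 0 < ρ ∧
      SiteBounds ζ P (Metric.cthickening ρ ((fun t : ℝ => (t : ℂ)) '' Set.Icc 0 t₁)) C := by
  set K : Set ℂ := (fun t : ℝ => (t : ℂ)) '' Set.Icc 0 t₁ with hK
  have hKc : IsCompact K := isCompact_Icc.image Complex.continuous_ofReal
  have hV : IsOpen {z : ℂ | 1 / 2 < ‖complexMGF ζ P z‖} :=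
    isOpen_lt continuous_const h.continuous_complexMGF.norm
  have hKV : K ⊆ {z : ℂ | 1 / 2 < ‖complexMGF ζ P z‖} := by
    rintro _ ⟨t, -, rfl⟩
    have h1 := h.one_le_mgf t
    simp only [Set.mem_ofPred_eq, complexMGF_ofReal, Complex.norm_real]
    rw [Real.norm_of_nonneg (by linarith)]
    linarith
  obtain ⟨ρ, hρ, hsub⟩ := hKc.exists_cthickening_subset_open hV hKV
  obtain ⟨M, hM⟩ := (Bornology.IsBounded.cthickening (δ := ρ) hKc.isBounded).exists_norm_le
  obtain ⟨C, hC⟩ := h.exists_siteBounds (le_max_right M 0)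
    (fun z hz => (hM z hz).trans (le_max_left M 0)) one_half_pos fun z hz => (hsub hz).le
  exact ⟨ρ, C, hρ, hC⟩

section Radius

variable {I Ω : Type*} {mΩ : MeasurableSpace Ω} {P : Measure Ω} [IsProbabilityMeasure P]
  {A : ℕ → I → Ω → ℝ} {ζ : Ω → ℝ} [MetricSpace I] [CompactSpace I]
  [MeasurableSpace I] [BorelSpace I]

/-- In a complex neighbourhood of a subcritical real parameter the normalisations do not vanish
and the integrals of the weights are bounded in `L^p` for some `p > 1`. -/
theorem IsSiteField.exists_closedBall_eLpNorm_le (h : IsSiteField P A ζ) (ν : Measure I)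
    [IsFiniteMeasure ν] {Cν dd : ℝ} (hCν : 0 ≤ Cν)
    (hν : ∀ l j x, ν (shell l j x) ≤ ENNReal.ofReal (Cν * Real.exp (-(dd * l))))
    {B δ : ℝ} (hδ : 0 < δ) (hB : 0 ≤ B) {a : ℕ → ℝ} {n : ℕ → ℕ}
    (hs : ScaleBounds a (siteCov P A) n δ B) (hn : Tendsto n atTop atTop) {t₀ : ℝ} (ht₀ : 0 < t₀)
    (ht : t₀ < Real.sqrt (2 * dd)) :
    ∃ r p C : ℝ, 0 < r ∧ 1 < p ∧ 0 ≤ C ∧ ∀ β ∈ Metric.closedBall (t₀ : ℂ) r,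
      (∀ k, complexMGF ζ P (β * a k) ≠ 0) ∧ ∀ (g : C(I, ℂ)) (N : ℕ),
      eLpNorm (fun ω => ∫ x, g x * weight (complexMGF ζ P) A (fun k => β * a k) 0 N x ω ∂ν)
        (ENNReal.ofReal p) P ≤ ENNReal.ofReal (C * ‖g‖) := by
  -- A parameter strictly between t₀ and the critical value leaves room for a whole disc around t₀;
  -- t₁ bounds both the real part and the modulus of β on it.
  obtain ⟨t₁, ht01, ht1⟩ := exists_between ht
  have ht₁ : 0 < t₁ := ht₀.trans ht01
  have hdd : t₁ ^ 2 < 2 * dd := by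
    rwa [Real.lt_sqrt ht₁.le] at ht1
  have hdd0 : 0 < dd := by nlinarith [sq_nonneg t₁]
  -- Half of the critical value: t₁²/(2(1-q)) < dd means q < 1 - t₁²/(2 dd).
  set q : ℝ := (1 - t₁ ^ 2 / (2 * dd)) / 2 with hq
  have hfrac : t₁ ^ 2 / (2 * dd) < 1 := (div_lt_one (by positivity)).2 hdd
  have hfrac0 : 0 < t₁ ^ 2 / (2 * dd) := by positivity
  have hq0 : 0 < q := by rw [hq]; linarith
  have hq1 : q < 1 := by rw [hq]; linarith
  have hκ : t₁ ^ 2 / (2 * (1 - q)) < dd := by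
    rw [div_lt_iff₀ (by linarith)]
    have e : dd * (2 * (1 - q)) = dd + t₁ ^ 2 / 2 := by rw [hq]; field_simp; ring
    rw [e]; linarith
  obtain ⟨ρ, Cb, hρ, hb⟩ := h.std.exists_thickening t₁
  set D := Metric.cthickening ρ ((fun t : ℝ => (t : ℂ)) '' Set.Icc 0 t₁) with hD
  obtain ⟨C, hC, H⟩ := h.exists_eLpNorm_integral_weight_le ν hb hCν hν ht₁.le hq0 hq1 hδ hB
    ht₁.le hκ hs hn
  have hη := blockRate_pos hq0 hδ hκ
  set η := blockRate dd t₁ q δ with hηd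
  -- The four constraints keep β a_k in the thickening, ‖β‖ and Re β at most t₁, Re β nonnegative,
  -- and (Im β)² at most η/2.
  set r : ℝ := min (min ρ (t₁ - t₀)) (min t₀ (Real.sqrt (η / 2))) with hr
  have hr0 : 0 < r := lt_min (lt_min hρ (by linarith)) (lt_min ht₀ (Real.sqrt_pos.2 (by linarith)))
  have hr1 : r ≤ ρ := (min_le_left _ _).trans (min_le_left _ _)
  have hr2 : r ≤ t₁ - t₀ := (min_le_left _ _).trans (min_le_right _ _)
  have hr3 : r ≤ t₀ := (min_le_right _ _).trans (min_le_left _ _)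
  have hr4 : r ≤ Real.sqrt (η / 2) := (min_le_right _ _).trans (min_le_right _ _)
  refine ⟨r, 1 + q, C, hr0, by linarith, hC, fun β hβ => ?_⟩
  have hβ' : ‖β - t₀‖ ≤ r := by simpa [dist_eq_norm] using hβ
  have hre : |β.re - t₀| ≤ r := by
    have := Complex.abs_re_le_norm (β - t₀)
    simp only [Complex.sub_re, Complex.ofReal_re] at this
    exact this.trans hβ'
  have him : |β.im| ≤ r := by
    have := Complex.abs_im_le_norm (β - t₀)
    simp only [Complex.sub_im, Complex.ofReal_im, sub_zero] at this
    exact this.trans hβ'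
  have hre' := abs_le.1 hre
  have hre0 : 0 ≤ β.re := by linarith
  have hre1 : β.re ≤ t₁ := by linarith
  have hnorm : ‖β‖ ≤ t₁ := by
    have : ‖β‖ ≤ ‖β - t₀‖ + ‖(t₀ : ℂ)‖ := by
      simpa using norm_add_le (β - t₀) (t₀ : ℂ)
    rw [Complex.norm_real, Real.norm_of_nonneg ht₀.le] at this
    linarith
  have him2 : β.im ^ 2 ≤ η / 2 := by
    rw [← Real.sq_sqrt (show 0 ≤ η / 2 by linarith), ← sq_abs]
    exact pow_le_pow_left₀ (abs_nonneg _) (him.trans hr4) 2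
  have hmem : ∀ s : ℝ, 0 ≤ s → s ≤ t₁ → (s : ℂ) ∈ D := fun s h0 h1 =>
    Metric.self_subset_cthickening _ ⟨s, ⟨h0, h1⟩, rfl⟩
  have hDr : ∀ k, ((β.re * a k : ℝ) : ℂ) ∈ D := fun k =>
    hmem _ (mul_nonneg hre0 (hs.nonneg k))
      ((mul_le_of_le_one_right hre0 (hs.le_one k)).trans hre1)
  have hDβ : ∀ k, β * a k ∈ D := fun k => by
    have ha0 := hs.nonneg k
    have ha1 := hs.le_one k
    refine Metric.mem_cthickening_of_dist_le _ ((t₀ * a k : ℝ) : ℂ) _ _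
      ⟨t₀ * a k, ⟨by positivity, ?_⟩, rfl⟩ ?_
    · exact (mul_le_of_le_one_right ht₀.le ha1).trans ht01.le
    · rw [dist_eq_norm]
      push_cast
      rw [← sub_mul, norm_mul, Complex.norm_real, Real.norm_of_nonneg ha0]
      calc ‖β - t₀‖ * a k ≤ ‖β - t₀‖ * 1 := by gcongr
        _ ≤ ρ := by linarith
  exact ⟨fun k => hb.ne_zero _ (hDβ k), fun g N => H β hre0 hre1 hnorm him2 hDβ hDr g N⟩

end Radius


lemma differentiable_integral_cexp {I : Type*} [TopologicalSpace I] [CompactSpace I]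
    [MeasurableSpace I] [OpensMeasurableSpace I] (ν : Measure I) [IsFiniteMeasure ν] (g : C(I, ℂ))
    {S : I → ℝ} (hS : Continuous S) :
    Differentiable ℂ fun β : ℂ => ∫ x, g x * Complex.exp (β * S x) ∂ν := by
  intro β₀
  obtain ⟨m, hm⟩ := (isCompact_range hS.norm).bddAbove
  have hm' : ∀ x, |S x| ≤ max m 0 := fun x => (hm ⟨x, rfl⟩).trans (le_max_left _ _)
  set m' := max m 0 with hmd
  have hm0 : 0 ≤ m' := le_max_right _ _
  have hc : ∀ β : ℂ, Continuous fun x => g x * Complex.exp (β * S x) := fun β => by fun_prop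
  have hc' : Continuous fun x => g x * (Complex.exp (β₀ * S x) * S x) := by fun_prop
  have hint : ∀ {f : I → ℂ}, Continuous f → Integrable f ν := fun hf =>
    hf.integrable_of_hasCompactSupport (HasCompactSupport.of_compactSpace _)
  refine (hasDerivAt_integral_of_dominated_loc_of_deriv_le (μ := ν)
    (F := fun β x => g x * Complex.exp (β * S x))
    (F' := fun β x => g x * (Complex.exp (β * S x) * S x)) (s := Metric.ball β₀ 1)
    (bound := fun _ => ‖g‖ * (Real.exp ((‖β₀‖ + 1) * m') * m')) (Metric.ball_mem_nhds _ one_pos)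
    (Eventually.of_forall fun β => (hint (hc β)).aestronglyMeasurable) (hint (hc β₀))
    (hint hc').aestronglyMeasurable (ae_of_all _ fun x β hβ => ?_) (integrable_const _)
    (ae_of_all _ fun x β _ => ?_)).2.differentiableAt
  · have hβ1 : ‖β‖ ≤ ‖β₀‖ + 1 := by
      have h1 : ‖β - β₀‖ < 1 := by simpa [dist_eq_norm] using hβ
      have h2 := norm_add_le (β - β₀) β₀
      rw [sub_add_cancel] at h2
      linarith
    rw [norm_mul, norm_mul, Complex.norm_exp, Complex.norm_real]
    refine mul_le_mul (g.norm_coe_le_norm x) ?_ (by positivity) (norm_nonneg _)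
    refine mul_le_mul (Real.exp_le_exp.2 ?_) (hm' x) (norm_nonneg _) (Real.exp_pos _).le
    refine (Complex.re_le_norm _).trans ?_
    rw [norm_mul, Complex.norm_real]
    exact mul_le_mul hβ1 (hm' x) (norm_nonneg _) (by positivity)
  · have h1 : HasDerivAt (fun β : ℂ => β * (S x : ℂ)) (S x : ℂ) β := by
      simpa using (hasDerivAt_id β).mul_const (S x : ℂ)
    exact (h1.cexp).const_mul (g x)

/-! ### The unit cube, and the chaos as an integral of weights. -/

section Cube

variable {d : ℕ}

instance : CompactSpace (unitCube d) := by
  have h : IsClosed (unitCube d) := by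
    have : unitCube d = ⋂ i, {x | x i ∈ Set.Icc (0 : ℝ) 1} := by
      ext x; simp [unitCube]
    rw [this]
    refine isClosed_iInter fun i => isClosed_Icc.preimage ?_
    fun_prop
  refine isCompact_iff_compactSpace.1 (Metric.isCompact_of_isClosed_isBounded h ?_)
  refine (Metric.isBounded_iff_subset_closedBall 0).2 ⟨Real.sqrt d, fun x hx => ?_⟩
  rw [mem_closedBall_zero_iff, EuclideanSpace.norm_eq]
  refine Real.sqrt_le_sqrt ?_
  calc ∑ i, ‖x i‖ ^ 2 ≤ ∑ _i : Fin d, (1 : ℝ) := by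
        refine Finset.sum_le_sum fun i _ => ?_
        have := hx i
        rw [Real.norm_of_nonneg this.1]
        exact pow_le_one₀ this.1 this.2
    _ = d := by simp

/-- Lebesgue measure on the unit cube. -/
def cubeMeasure (d : ℕ) : Measure (unitCube d) := Measure.comap Subtype.val volume

lemma measurableSet_unitCube : MeasurableSet (unitCube d) :=
  (isCompact_iff_compactSpace.2 inferInstance : IsCompact (unitCube d)).isClosed.measurableSet

lemma cubeMeasure_apply (s : Set (unitCube d)) :
    cubeMeasure d s = volume ((↑) '' s : Set (EuclideanSpace ℝ (Fin d))) :=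
  (MeasurableEmbedding.subtype_coe measurableSet_unitCube).comap_apply _ s

instance : IsFiniteMeasure (cubeMeasure d) := by
  refine ⟨?_⟩
  rw [cubeMeasure_apply]
  refine (measure_mono ?_).trans_lt
    (isCompact_iff_compactSpace.2 inferInstance : IsCompact (unitCube d)).measure_lt_top
  rintro _ ⟨x, -, rfl⟩
  exact x.2

lemma exists_cubeMeasure_shell_le (d : ℕ) : ∃ C : ℝ, 0 ≤ C ∧ ∀ l j (x : unitCube d),
    cubeMeasure d (shell l j x) ≤ ENNReal.ofReal (C * Real.exp (-((d : ℝ) * l))) := by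
  set v : ℝ := (volume (Metric.ball (0 : EuclideanSpace ℝ (Fin d)) 1)).toReal with hv
  set N : ℝ := (cubeMeasure d Set.univ).toReal with hN
  have hv0 : 0 ≤ v := ENNReal.toReal_nonneg
  have hN0 : 0 ≤ N := ENNReal.toReal_nonneg
  have hvv : volume (Metric.ball (0 : EuclideanSpace ℝ (Fin d)) 1) = ENNReal.ofReal v :=
    (ENNReal.ofReal_toReal measure_ball_lt_top.ne).symm
  refine ⟨v + N, by positivity, fun l j x => ?_⟩
  -- The shell l = 0 has no upper bound on the distance, so it gets the total mass; the others lie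
  -- in balls of radius e^{-l}.
  rcases Nat.eq_zero_or_pos l with rfl | hl
  · calc _ ≤ cubeMeasure d Set.univ := measure_mono (Set.subset_univ _)
      _ = ENNReal.ofReal N := (ENNReal.ofReal_toReal (measure_ne_top _ _)).symm
      _ ≤ _ := by
        refine ENNReal.ofReal_le_ofReal ?_
        simp [hv0]
  · rw [cubeMeasure_apply]
    calc _ ≤ volume (Metric.closedBall (x : EuclideanSpace ℝ (Fin d)) (Real.exp (-l))) := by
          refine measure_mono ?_
          rintro _ ⟨y, hy, rfl⟩
          rw [Metric.mem_closedBall, dist_comm]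
          exact hy.2 hl
      _ = ENNReal.ofReal (Real.exp (-(l : ℝ)) ^ d * v) := by
          rw [Measure.addHaar_closedBall _ _ (Real.exp_pos _).le, hvv, finrank_euclideanSpace,
            Fintype.card_fin, ENNReal.ofReal_mul (by positivity)]
      _ ≤ _ := by
          refine ENNReal.ofReal_le_ofReal ?_
          rw [← Real.exp_nat_mul, mul_comm, show (d : ℝ) * -(l : ℝ) = -((d : ℝ) * l) by ring]
          refine mul_le_mul_of_nonneg_right (by linarith) (Real.exp_pos _).le

variable {Ω : Type*} {mΩ : MeasurableSpace Ω} {P : Measure Ω} [IsProbabilityMeasure P]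
  {X A : ℕ → unitCube d → Ω → ℝ} {ζ : Ω → ℝ} {a : ℕ → ℝ}

omit [IsProbabilityMeasure P] in
lemma partialSum_eq (hX : ∀ k x ω, X (k + 1) x ω = a k * A k x ω) (n : ℕ) (x : unitCube d) (ω : Ω) :
    partialSum X n x ω = ∑ k ∈ Finset.Ico 0 n, a k * A k x ω := by
  rw [partialSum, Finset.sum_congr rfl fun k _ => (hX k x ω).symm,
    Finset.sum_Ico_add' (fun k => X k x ω) 0 n 1]
  rfl

omit [IsProbabilityMeasure P] in
lemma cexp_partialSum (hX : ∀ k x ω, X (k + 1) x ω = a k * A k x ω) (n : ℕ) (β : ℂ)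
    (x : unitCube d) (ω : Ω) : Complex.exp (β * (partialSum X n x ω : ℂ)) =
      ∏ k ∈ Finset.Ico 0 n, Complex.exp (β * a k * A k x ω) := by
  rw [partialSum_eq hX, ← Complex.exp_sum]
  push_cast
  rw [Finset.mul_sum]
  simp only [mul_assoc]

lemma IsSiteField.normalizer_eq (h : IsSiteField P A ζ)
    (hX : ∀ k x ω, X (k + 1) x ω = a k * A k x ω) (n : ℕ) (β : ℂ) (x : unitCube d) :
    normalizer P X n β x = ∏ k ∈ Finset.Ico 0 n, complexMGF ζ P (β * a k) := by
  have hc : ∀ k, Continuous fun y : ℝ => Complex.exp (β * a k * y) := fun k => by fun_prop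
  simp only [normalizer]
  simp_rw [cexp_partialSum hX]
  rw [integral_finset_prod_of_iIndep h.siteSigma_le h.indep
    (F := fun k ω => Complex.exp (β * a k * A k x ω)) fun k =>
      (hc k).measurable.comp (measurable_siteSigma A k x)]
  exact Finset.prod_congr rfl fun k _ => h.integral_comp (hc k).measurable k x

lemma IsSiteField.cexp_div_normalizer (h : IsSiteField P A ζ)
    (hX : ∀ k x ω, X (k + 1) x ω = a k * A k x ω) (n : ℕ) (β : ℂ) (x : unitCube d) (ω : Ω) :
    Complex.exp (β * (partialSum X n x ω : ℂ)) / normalizer P X n β x =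
      weight (complexMGF ζ P) A (fun k => β * a k) 0 n x ω := by
  rw [h.normalizer_eq hX, cexp_partialSum hX, ← Finset.prod_div_distrib]
  rfl

lemma IsSiteField.chaos_eq (h : IsSiteField P A ζ)
    (hX : ∀ k x ω, X (k + 1) x ω = a k * A k x ω) (n : ℕ) (f : C(unitCube d, ℂ)) (β : ℂ) :
    chaos P X n f β = fun ω => ∫ x, f x * weight (complexMGF ζ P) A (fun k => β * a k) 0 n x ω
      ∂(cubeMeasure d) := by
  funext ω
  simp only [chaos, h.cexp_div_normalizer hX]
  rfl

/-- The normaliser does not depend on x by stationarity, so the chaos is an entire function of β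
divided by a finite product of nonvanishing entire functions. -/
lemma IsSiteField.differentiableAt_chaos (h : IsSiteField P A ζ)
    (hX : ∀ k x ω, X (k + 1) x ω = a k * A k x ω) (n : ℕ) (f : C(unitCube d, ℂ)) (ω : Ω) {β : ℂ}
    (hβ : ∀ k, complexMGF ζ P (β * a k) ≠ 0) :
    DifferentiableAt ℂ (fun β => chaos P X n f β ω) β := by
  have hS : Continuous fun x => partialSum X n x ω := by
    simp_rw [partialSum_eq hX]
    exact continuous_finsetSum _ fun k _ => continuous_const.mul (h.continuous k ω)
  have e : ∀ β, chaos P X n f β ω =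
      (∫ x, f x * Complex.exp (β * (partialSum X n x ω : ℂ)) ∂(cubeMeasure d)) /
        ∏ k ∈ Finset.Ico 0 n, complexMGF ζ P (β * a k) := fun β => by
    rw [← integral_div]
    simp only [chaos, h.normalizer_eq hX, mul_div_assoc]
    rfl
  simp_rw [e]
  refine (differentiable_integral_cexp (cubeMeasure d) f hS β).div ?_
    (Finset.prod_ne_zero_iff.2 fun k _ => hβ k)
  refine DifferentiableAt.fun_finsetProd fun k _ => ?_
  exact (h.std.differentiable_complexMGF _).comp β (differentiableAt_id.mul_const _)

/-- The filtration generated by the fields `X_k`. -/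
def IsSiteField.filtration (h : IsSiteField P A ζ)
    (hX : ∀ k x ω, X (k + 1) x ω = a k * A k x ω) : Filtration ℕ mΩ where
  seq n := fieldSigma X n
  mono' n m hnm := biSup_mono fun k hk => by
    simp only [Finset.mem_Icc] at hk ⊢; omega
  le' n := iSup₂_le fun k hk => iSup_le fun x => by
    obtain ⟨k, rfl⟩ := Nat.exists_eq_succ_of_ne_zero (show k ≠ 0 by
      simp only [Finset.mem_Icc] at hk; omega)
    have e : X (k + 1) x = fun ω => a k * A k x ω := funext (hX k x)
    rw [Nat.succ_eq_add_one, e]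
    exact ((h.measurable k x).const_mul (a k)).comap_le

omit [IsProbabilityMeasure P] in
-- Only an inclusion holds in general: a field with coefficient zero leaves no trace in the
-- σ-algebra of X, as happens for the first field in the logarithmic case.
lemma fieldSigma_le_sigmaOn (hX : ∀ k x ω, X (k + 1) x ω = a k * A k x ω) (n : ℕ) :
    fieldSigma X n ≤ sigmaOn (siteSigma A) (Set.Ico 0 n) := by
  refine iSup₂_le fun k hk => iSup_le fun x => ?_
  simp only [Finset.mem_Icc] at hk
  obtain ⟨k, rfl⟩ := Nat.exists_eq_succ_of_ne_zero (show k ≠ 0 by omega)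
  have e : X (k + 1) x = fun ω => a k * A k x ω := funext (hX k x)
  rw [Nat.succ_eq_add_one, e]
  refine Measurable.comap_le ?_
  have : Measurable[sigmaOn (siteSigma A) (Set.Ico 0 n)] (A k x) :=
    (measurable_siteSigma A k x).mono (le_sigmaOn _ ⟨Nat.zero_le _, by omega⟩) le_rfl
  exact this.const_mul (a k)

omit [IsProbabilityMeasure P] in
-- The field A enters a weight only through the product a k * A k, which is X. Hence the weights are
-- adapted to the possibly smaller filtration of X.
lemma measurable_fieldSigma_weight (hX : ∀ k x ω, X (k + 1) x ω = a k * A k x ω) (φ : ℂ → ℂ)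
    (β : ℂ) (n : ℕ) (x : unitCube d) :
    Measurable[fieldSigma X n] (weight φ A (fun k => β * a k) 0 n x) := by
  refine Finset.measurable_prod _ fun k hk => ?_
  have hk' : k + 1 ∈ Finset.Icc 1 n := by
    simp only [Finset.mem_Ico, Finset.mem_Icc] at hk ⊢; omega
  have hXm : Measurable[fieldSigma X n] (X (k + 1) x) := by
    refine Measurable.of_comap_le ?_
    refine le_trans ?_ (le_biSup (fun k => ⨆ x : unitCube d,
      MeasurableSpace.comap (X k x) inferInstance) hk')
    exact le_iSup (fun x : unitCube d => MeasurableSpace.comap (X (k + 1) x) inferInstance) x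
  have e : (fun ω => site φ (β * a k) (A k x ω)) =
      fun ω => Complex.exp (β * (X (k + 1) x ω : ℂ)) / φ (β * a k) := by
    funext ω
    rw [site, hX]
    push_cast
    rw [mul_assoc]
  rw [e]
  have hc : Continuous fun y : ℝ => Complex.exp (β * (y : ℂ)) / φ (β * a k) := by fun_prop
  exact hc.measurable.comp hXm

end Cube


/-! ### From local bounds to the theorem on the whole neighbourhood. -/

section Main

variable {d : ℕ} {Ω : Type*} {mΩ : MeasurableSpace Ω} {P : Measure Ω} [IsProbabilityMeasure P]
  {X A : ℕ → unitCube d → Ω → ℝ} {ζ : Ω → ℝ} {a : ℕ → ℝ}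

/-- If locally uniform `L^p` bounds hold on discs covering `U`, then some `p > 1` works on every
compact subset of `U`. -/
lemma exists_uniform_exponent {ι : Type*} {c : ι → ℂ} {r p : ι → ℝ} (hp : ∀ i, 1 < p i)
    {K : Set ℂ} (hK : IsCompact K) (hKU : K ⊆ ⋃ i, Metric.ball (c i) (r i)) :
    ∃ s : ℝ, 1 < s ∧ ∀ β ∈ K, ∃ i, β ∈ Metric.ball (c i) (r i) ∧ s < p i := by
  refine hK.induction_on (p := fun K => ∃ s : ℝ, 1 < s ∧ ∀ β ∈ K, ∃ i,
    β ∈ Metric.ball (c i) (r i) ∧ s < p i) ⟨2, one_lt_two, by simp⟩ ?_ ?_ ?_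
  · rintro s t hst ⟨u, hu, h⟩
    exact ⟨u, hu, fun β hβ => h β (hst hβ)⟩
  · rintro s t ⟨u, hu, h⟩ ⟨v, hv, h'⟩
    refine ⟨min u v, lt_min hu hv, ?_⟩
    rintro β (hβ | hβ)
    · obtain ⟨i, hi, hi'⟩ := h β hβ
      exact ⟨i, hi, (min_le_left _ _).trans_lt hi'⟩
    · obtain ⟨i, hi, hi'⟩ := h' β hβ
      exact ⟨i, hi, (min_le_right _ _).trans_lt hi'⟩
  · intro β hβ
    obtain ⟨i, hi⟩ := Set.mem_iUnion.1 (hKU hβ)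
    exact ⟨_, mem_nhdsWithin_of_mem_nhds (Metric.isOpen_ball.mem_nhds hi), (1 + p i) / 2,
      by linarith [hp i], fun γ hγ => ⟨i, hγ, by linarith [hp i]⟩⟩

/-- The neighbourhood is a union of discs around the real subcritical parameters, each with its own
exponent p > 1. Compactness gives one exponent on a compact set, and on each disc the L^p bound
yields uniform almost sure convergence. -/
theorem IsSiteField.hasAnalyticSubcriticalChaos (h : IsSiteField P A ζ)
    (hX : ∀ k x ω, X (k + 1) x ω = a k * A k x ω) {δ B : ℝ} (hδ : 0 < δ) (hB : 0 ≤ B) {n : ℕ → ℕ}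
    (hs : ScaleBounds a (siteCov P A) n δ B) (hn : Tendsto n atTop atTop) :
    HasAnalyticSubcriticalChaos P X := by
  obtain ⟨Cν, hCν, hν⟩ := exists_cubeMeasure_shell_le d
  have H := fun t : Set.Ioo (0 : ℝ) (Real.sqrt (2 * d)) =>
    h.exists_closedBall_eLpNorm_le (cubeMeasure d) hCν hν hδ hB hs hn t.2.1 t.2.2
  choose r p C hr hp hC Hb using H
  have Hz := fun t β hβ => (Hb t β hβ).1
  have HL : ∀ t : Set.Ioo (0 : ℝ) (Real.sqrt (2 * d)), ∀ β ∈ Metric.closedBall ((t : ℝ) : ℂ) (r t), ∀ (f : C(unitCube d, ℂ)) (N : ℕ),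
      eLpNorm (chaos P X N f β) (ENNReal.ofReal (p t)) P ≤ ENNReal.ofReal (C t * ‖f‖) :=
    fun t β hβ f N => by
      rw [h.chaos_eq hX]
      exact (Hb t β hβ).2 f N
  have hball : ∀ t : Set.Ioo (0 : ℝ) (Real.sqrt (2 * d)),
      Metric.ball ((t : ℝ) : ℂ) (r t / 2) ⊆ Metric.closedBall ((t : ℝ) : ℂ) (r t) := fun t =>
    Metric.ball_subset_closedBall.trans (Metric.closedBall_subset_closedBall (by linarith [hr t]))
  -- Half the radius, since the L^p bound on a circle gives uniform convergence only in the
  -- concentric disc of half the radius.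
  set U : Set ℂ := ⋃ t : Set.Ioo (0 : ℝ) (Real.sqrt (2 * d)),
    Metric.ball ((t : ℝ) : ℂ) (r t / 2) with hU
  have hUo : IsOpen U := isOpen_iUnion fun t => Metric.isOpen_ball
  have hUz : ∀ β ∈ U, ∀ k, complexMGF ζ P (β * a k) ≠ 0 := fun β hβ => by
    obtain ⟨t, ht⟩ := Set.mem_iUnion.1 hβ
    exact Hz t β (hball t ht)
  have hmart : ∀ β : ℂ, (∀ k, complexMGF ζ P (β * a k) ≠ 0) → ∀ f : C(unitCube d, ℂ),
      Martingale (fun n => chaos P X n f β) (h.filtration hX) P := fun β hβ f => by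
    have e : (fun n => chaos P X n f β) = fun n ω => ∫ x, f x *
        weight (complexMGF ζ P) A (fun k => β * a k) 0 n x ω ∂(cubeMeasure d) :=
      funext fun n => h.chaos_eq hX n f β
    rw [e]
    exact h.martingale_integral_weight (cubeMeasure d) (fieldSigma_le_sigmaOn hX)
      (measurable_fieldSigma_weight hX _ β) hβ f
  refine ⟨U, hUo, fun t ht => ?_, fun β hβ n x => ?_, ⟨h.filtration hX, fun n => rfl,
    fun β hβ f => hmart β (hUz β hβ) f⟩, fun K hK hKU => ?_, fun f => ?_⟩
  · exact Set.mem_iUnion.2 ⟨⟨t, ht⟩, Metric.mem_ball_self (by linarith [hr ⟨t, ht⟩])⟩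
  · rw [h.normalizer_eq hX]
    exact Finset.prod_ne_zero_iff.2 fun k _ => hUz β hβ k
  · obtain ⟨s, hs1, hsK⟩ := exists_uniform_exponent hp hK hKU
    refine ⟨s, hs1, fun β hβ f => ?_⟩
    obtain ⟨t, ht, hst⟩ := hsK β hβ
    exact exists_tendsto_eLpNorm_sub (hmart β (hUz β (hKU hβ)) f) hs1.le hst
      (mul_nonneg (hC t) (norm_nonneg f)) (HL t β (hball t ht) f)
  -- Countably many discs already cover the neighbourhood (Lindelöf), so their exceptional events
  -- have a null union.
  · obtain ⟨T, hT, hTU⟩ := TopologicalSpace.isOpen_iUnion_countable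
      (fun t : Set.Ioo (0 : ℝ) (Real.sqrt (2 * d)) => Metric.ball ((t : ℝ) : ℂ) (r t / 2))
      fun t => Metric.isOpen_ball
    have hae : ∀ t : Set.Ioo (0 : ℝ) (Real.sqrt (2 * d)), ∀ᵐ ω ∂P, ∃ G, TendstoUniformlyOn (fun n β => chaos P X n f β ω) G atTop
        (Metric.closedBall ((t : ℝ) : ℂ) (r t / 2)) := fun t => by
      refine ae_exists_tendstoUniformlyOn (ℱ := h.filtration hX)
        (M := fun n β => chaos P X n f β) (hr t) (hp t) (mul_nonneg (hC t) (norm_nonneg f))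
        (fun β hβ => hmart β (Hz t β (Metric.sphere_subset_closedBall hβ)) f)
        (fun β hβ => HL t β (Metric.sphere_subset_closedBall hβ) f) fun n ω => ?_
      refine DifferentiableOn.diffContOnCl fun β hβ => ?_
      exact (h.differentiableAt_chaos hX n f ω
        (Hz t β (Metric.closure_ball_subset_closedBall hβ))).differentiableWithinAt
    -- The pointwise limit does not refer to any disc, so the limits found on overlapping discs
    -- agree automatically.
    refine ⟨fun ω β => limUnder atTop fun n => chaos P X n f β ω, ?_⟩
    filter_upwards [(ae_ball_iff hT).2 fun t _ => hae t] with ω hω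
    have hloc : TendstoLocallyUniformlyOn (fun n β => chaos P X n f β ω)
        (fun β => limUnder atTop fun n => chaos P X n f β ω) atTop U := by
      rw [hU, ← hTU]
      refine tendstoLocallyUniformlyOn_biUnion (fun t _ => Metric.isOpen_ball) fun t ht => ?_
      obtain ⟨G, hG⟩ := hω t ht
      refine ((hG.mono Metric.ball_subset_closedBall).congr_right fun β hβ => ?_).tendstoLocallyUniformlyOn
      exact ((hG.tendsto_at (Metric.ball_subset_closedBall hβ)).limUnder_eq).symm
    have hdiff : ∀ n, DifferentiableOn ℂ (fun β => chaos P X n f β ω) U := fun n β hβ =>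
      (h.differentiableAt_chaos hX n f ω (hUz β hβ)).differentiableWithinAt
    refine ⟨(hloc.differentiableOn (Eventually.of_forall hdiff) hUo).analyticOnNhd hUo,
      fun K hK hKU => ?_⟩
    exact (tendstoLocallyUniformlyOn_iff_forall_isCompact hUo).1 hloc K hKU hK

end Main


/-! ### Construction of the checkpoints and of the covariance bounds. -/

section Checkpoints

variable {a : ℕ → ℝ}

/-- The partial variances. -/
def partialVar (a : ℕ → ℝ) (n : ℕ) : ℝ := ∑ k ∈ Finset.range n, a k ^ 2

lemma partialVar_succ (n : ℕ) : partialVar a (n + 1) = partialVar a n + a n ^ 2 :=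
  Finset.sum_range_succ _ _

lemma partialVar_mono : Monotone (partialVar a) :=
  monotone_nat_of_le_succ fun n => by rw [partialVar_succ]; linarith [sq_nonneg (a n)]

lemma sum_Ico_sq (m n : ℕ) (hmn : m ≤ n) :
    ∑ k ∈ Finset.Ico m n, a k ^ 2 = partialVar a n - partialVar a m :=
  Finset.sum_Ico_eq_sub _ hmn

/-- For l > 0, take the last index at which the partial variance is still at most l. One more term
exceeds l and adds at most 1, so at least l - 1 has been reached. -/
lemma exists_checkpoints (ha : ∀ k, |a k| ≤ 1) (hV : Tendsto (partialVar a) atTop atTop) :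
    ∃ n : ℕ → ℕ, Monotone n ∧ n 0 = 0 ∧ (∀ l : ℕ, partialVar a (n l) ≤ l) ∧
      (∀ l : ℕ, (l : ℝ) - 1 ≤ partialVar a (n l)) ∧ Tendsto n atTop atTop := by
  classical
  have ha2 : ∀ k, a k ^ 2 ≤ 1 := fun k => (sq_le_one_iff_abs_le_one _).2 (ha k)
  have hex : ∀ l : ℕ, ∃ m, (l : ℝ) < partialVar a (m + 1) := fun l =>
    ((hV.comp (tendsto_add_atTop_nat 1)).eventually_gt_atTop (l : ℝ)).exists
  -- The value at 0 is imposed: if the first coefficients vanish, the search for l = 0 would return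
  -- a positive index.
  set n : ℕ → ℕ := fun l => if l = 0 then 0 else Nat.find (hex l) with hn
  have h0 : n 0 = 0 := by simp [hn]
  have hs : ∀ l, l ≠ 0 → n l = Nat.find (hex l) := fun l hl => by simp [hn, hl]
  have hle : ∀ l : ℕ, partialVar a (n l) ≤ l := fun l => by
    rcases eq_or_ne l 0 with rfl | hl
    · simp [h0, partialVar]
    · rw [hs l hl]
      rcases Nat.eq_zero_or_pos (Nat.find (hex l)) with h | h
      · rw [h]; simp [partialVar]
      · have := Nat.find_min (hex l) (m := Nat.find (hex l) - 1) (by omega)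
        rw [Nat.sub_add_cancel h] at this
        exact not_lt.1 this
  have hge : ∀ l : ℕ, (l : ℝ) - 1 ≤ partialVar a (n l) := fun l => by
    rcases eq_or_ne l 0 with rfl | hl
    · simp [h0, partialVar]
    · rw [hs l hl]
      have := Nat.find_spec (hex l)
      rw [partialVar_succ] at this
      linarith [ha2 (Nat.find (hex l))]
  refine ⟨n, fun l l' hll => ?_, h0, hle, hge, ?_⟩
  · rcases eq_or_ne l 0 with rfl | hl
    · simp [h0]
    · rw [hs l hl, hs l' (by omega)]
      refine Nat.find_min' _ (lt_of_le_of_lt ?_ (Nat.find_spec (hex l')))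
      exact_mod_cast hll
  · have hVn : ∀ m : ℕ, partialVar a m ≤ m := fun m => by
      calc partialVar a m ≤ ∑ _k ∈ Finset.range m, (1 : ℝ) := Finset.sum_le_sum fun k _ => ha2 k
        _ = m := by simp
    refine tendsto_atTop_mono (f := fun l => l - 1) (fun l => ?_) (tendsto_sub_atTop_nat 1)
    have h1 := (hge l).trans (hVn (n l))
    have h2 : (l : ℝ) ≤ ((n l + 1 : ℕ) : ℝ) := by push_cast; linarith
    have h3 : l ≤ n l + 1 := by exact_mod_cast h2
    omega

/-- A lower Riemann sum for the integral of e^{-δv} over the partial variance v; each term is a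
telescoping difference by 1 + x ≤ e^x. -/
lemma sum_sq_mul_exp_le {δ : ℝ} (hδ : 0 < δ) {m n : ℕ} (hmn : m ≤ n) :
    ∑ k ∈ Finset.Ico m n, a k ^ 2 * Real.exp (-(δ * partialVar a (k + 1))) ≤
      Real.exp (-(δ * partialVar a m)) / δ := by
  have key : ∀ k, a k ^ 2 * Real.exp (-(δ * partialVar a (k + 1))) ≤
      Real.exp (-(δ * partialVar a k)) / δ - Real.exp (-(δ * partialVar a (k + 1))) / δ := fun k => by
    have h1 : Real.exp (-(δ * partialVar a k)) =
        Real.exp (-(δ * partialVar a (k + 1))) * Real.exp (δ * a k ^ 2) := by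
      rw [← Real.exp_add, partialVar_succ]; congr 1; ring
    have h2 := Real.add_one_le_exp (δ * a k ^ 2)
    rw [← sub_div, le_div_iff₀ hδ, h1]
    nlinarith [Real.exp_pos (-(δ * partialVar a (k + 1)))]
  calc _ ≤ ∑ k ∈ Finset.Ico m n, (Real.exp (-(δ * partialVar a k)) / δ -
        Real.exp (-(δ * partialVar a (k + 1))) / δ) := Finset.sum_le_sum fun k _ => key k
    _ = Real.exp (-(δ * partialVar a m)) / δ - Real.exp (-(δ * partialVar a n)) / δ :=
        by
          rw [Finset.sum_Ico_eq_sub _ hmn, Finset.sum_range_sub', Finset.sum_range_sub']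
          ring
    _ ≤ _ := by
        have := div_nonneg (Real.exp_pos (-(δ * partialVar a n))).le hδ.le
        linarith

/-- As `b k` is comparable to the exponential of the partial variance V, the covariance at distance
e^{-l} is O(e^{-δ(V-l)}). Summed from scale l on it is bounded, and over the block j it is
O(e^{-δ(j-l)}). -/
theorem exists_scaleBounds {I : Type*} [PseudoMetricSpace I] {b : ℕ → ℝ} {c : ℕ → I → I → ℝ}
    {δ B₀ C₀ C₁ : ℝ} (hδ : 0 < δ) (hC₁ : 0 ≤ C₁) (ha0 : ∀ k, 0 ≤ a k) (ha1 : ∀ k, a k ≤ 1)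
    (hcube : ∀ m, ∑ k ∈ Finset.range m, a k ^ 3 ≤ B₀) (hV : Tendsto (partialVar a) atTop atTop)
    (hb : ∀ k, a k ≠ 0 → 0 < b k ∧ |partialVar a (k + 1) - Real.log (b k)| ≤ C₀)
    (hc1 : ∀ k x y, |c k x y| ≤ 1)
    (hc : ∀ k x y, 0 < b k → 0 < dist x y → |c k x y| ≤ C₁ * (b k * dist x y) ^ (-δ)) :
    ∃ (n : ℕ → ℕ) (B : ℝ), 0 ≤ B ∧ ScaleBounds a c n δ B ∧ Tendsto n atTop atTop := by
  obtain ⟨n, hmono, h0, hle, hge, htend⟩ := exists_checkpoints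
    (fun k => by rw [abs_of_nonneg (ha0 k)]; exact ha1 k) hV
  -- The exponent δ(C₀ + l + 1) arises from b_k ≥ e^{V-C₀} and dist > e^{-(l+1)}. It is written as
  -- δ(C₀ + 2) + δ(l - 1) because l - 1 is the guaranteed variance at the checkpoint l.
  set E : ℝ := C₁ * Real.exp (δ * (C₀ + 2)) with hE
  have hE0 : 0 ≤ E := by positivity
  have hE1 : 0 ≤ E / δ := by positivity
  have hB0 : 0 ≤ max B₀ 0 := le_max_right _ _
  have hterm : ∀ (l k : ℕ) (x y : I), Real.exp (-(l + 1)) < dist x y →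
      a k ^ 2 * |c k x y| ≤ E * Real.exp (δ * (l - 1)) *
        (a k ^ 2 * Real.exp (-(δ * partialVar a (k + 1)))) := fun l k x y hxy => by
    rcases eq_or_ne (a k) 0 with h | h
    · simp [h]
    · obtain ⟨hb0, hbV⟩ := hb k h
      have hd : 0 < dist x y := (Real.exp_pos _).trans hxy
      have h1 : Real.exp (partialVar a (k + 1) - C₀ - (l + 1)) ≤ b k * dist x y := by
        rw [sub_eq_add_neg _ ((l : ℝ) + 1), Real.exp_add]
        refine mul_le_mul ?_ hxy.le (Real.exp_pos _).le hb0.le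
        rw [← Real.le_log_iff_exp_le hb0]
        linarith [(abs_le.1 hbV).2]
      have h2 : (b k * dist x y) ^ (-δ) ≤
          Real.exp (partialVar a (k + 1) - C₀ - (l + 1)) ^ (-δ) :=
        Real.rpow_le_rpow_of_nonpos (Real.exp_pos _) h1 (by linarith)
      rw [← Real.exp_mul] at h2
      have h3 := (hc k x y hb0 hd).trans (mul_le_mul_of_nonneg_left h2 hC₁)
      refine (mul_le_mul_of_nonneg_left h3 (sq_nonneg _)).trans (le_of_eq ?_)
      have e : (partialVar a (k + 1) - C₀ - (l + 1)) * -δ =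
          δ * (C₀ + 2) + δ * (l - 1) + -(δ * partialVar a (k + 1)) := by ring
      rw [e, Real.exp_add, Real.exp_add, hE]
      ring
  have hblock : ∀ j, ∑ k ∈ Finset.Ico (n j) (n (j + 1)), a k ^ 2 ≤ 2 := fun j => by
    rw [sum_Ico_sq _ _ (hmono (Nat.le_succ j))]
    have h1 := hle (j + 1)
    have h2 := hge j
    push_cast at h1
    linarith
  refine ⟨n, max B₀ 0 + 2 + 2 * E + E / δ, by positivity, ⟨hmono, h0, ha0, ha1, hle,
    fun m => ?_, fun j => ?_, fun l j hlj x y hxy => ?_, fun l j hlj x y hxy => ?_⟩, htend⟩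
  · linarith [hcube m, le_max_left B₀ 0]
  · linarith [hblock j]
  · calc _ ≤ ∑ k ∈ Finset.Ico (n l) (n j), E * Real.exp (δ * (l - 1)) *
          (a k ^ 2 * Real.exp (-(δ * partialVar a (k + 1)))) :=
          Finset.sum_le_sum fun k _ => hterm l k x y hxy
      _ ≤ E * Real.exp (δ * (l - 1)) * (Real.exp (-(δ * partialVar a (n l))) / δ) := by
          rw [← Finset.mul_sum]
          exact mul_le_mul_of_nonneg_left (sum_sq_mul_exp_le hδ (hmono hlj)) (by positivity)
      _ ≤ E * Real.exp (δ * (l - 1)) * (Real.exp (-(δ * (l - 1))) / δ) := by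
          gcongr
          exact hge l
      _ = E / δ := by rw [Real.exp_neg]; field_simp
      _ ≤ _ := by linarith
  -- For l = j nothing separates the points; |c| ≤ 1 and the bounded variance of a block suffice.
  · rcases hlj.eq_or_lt with rfl | hlt
    · rw [sub_self, mul_zero, neg_zero, Real.exp_zero, mul_one]
      calc _ ≤ ∑ k ∈ Finset.Ico (n l) (n (l + 1)), a k ^ 2 := Finset.sum_le_sum fun k _ =>
            mul_le_of_le_one_right (sq_nonneg _) (hc1 k x y)
        _ ≤ _ := by linarith [hblock l]
    · have hxy' := hxy hlt
      calc _ ≤ ∑ k ∈ Finset.Ico (n j) (n (j + 1)), E * Real.exp (δ * (l - 1)) *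
            (a k ^ 2 * Real.exp (-(δ * (j - 1)))) := by
            refine Finset.sum_le_sum fun k hk => (hterm l k x y hxy').trans ?_
            have h1 : (j : ℝ) - 1 ≤ partialVar a (k + 1) := (hge j).trans (partialVar_mono
              ((Finset.mem_Ico.1 hk).1.trans (Nat.le_succ k)))
            gcongr
        _ = E * (∑ k ∈ Finset.Ico (n j) (n (j + 1)), a k ^ 2) *
            (Real.exp (δ * (l - 1)) * Real.exp (-(δ * (j - 1)))) := by
            rw [← Finset.mul_sum, ← Finset.sum_mul]; ring
        _ = E * (∑ k ∈ Finset.Ico (n j) (n (j + 1)), a k ^ 2) * Real.exp (-(δ * (j - l))) := by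
            rw [← Real.exp_add]; congr 2; ring
        _ ≤ E * 2 * Real.exp (-(δ * (j - l))) := by gcongr; exact hblock j
        _ ≤ _ := by
            refine mul_le_mul_of_nonneg_right ?_ (Real.exp_pos _).le
            linarith

end Checkpoints


lemma iIndep_mono {Ω ι : Type*} {mΩ : MeasurableSpace Ω} {P : Measure Ω}
    {m m' : ι → MeasurableSpace Ω} (h : iIndep m P) (hm : ∀ i, m' i ≤ m i) : iIndep m' P := by
  rw [iIndep_iff] at h ⊢
  exact fun s f hf => h s fun i hi => hm i _ (hf i hi)

/-- Below the threshold of the asymptotic bound, |f| ≤ 1 and t^{-δ} is bounded below, so enlarging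
the constant is enough. -/
lemma exists_abs_le_rpow {f : ℝ → ℝ} {δ : ℝ} (hδ : 0 < δ) (h1 : ∀ t, 0 < t → |f t| ≤ 1)
    (hf : f =O[atTop] fun t => t ^ (-δ)) :
    ∃ C, 0 ≤ C ∧ ∀ t, 0 < t → |f t| ≤ C * t ^ (-δ) := by
  obtain ⟨C, hC, hCf⟩ := hf.exists_nonneg
  obtain ⟨T, hT⟩ := eventually_atTop.1 hCf.bound
  set T' := max T 1 with hT'
  have hT0 : 0 < T' := zero_lt_one.trans_le (le_max_right _ _)
  refine ⟨C + T' ^ δ, by positivity, fun t ht => ?_⟩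
  have ht' : 0 < t ^ (-δ) := Real.rpow_pos_of_pos ht _
  rw [add_mul]
  rcases le_total T' t with h | h
  · have h2 := hT t ((le_max_left _ _).trans h)
    rw [Real.norm_eq_abs, Real.norm_of_nonneg ht'.le] at h2
    have : 0 ≤ T' ^ δ * t ^ (-δ) := by positivity
    linarith
  · have h2 : 1 ≤ T' ^ δ * t ^ (-δ) := by
      rw [Real.rpow_neg ht.le, ← div_eq_mul_inv, one_le_div (by positivity)]
      exact Real.rpow_le_rpow ht.le h hδ.le
    have : 0 ≤ C * t ^ (-δ) := by positivity
    linarith [h1 t ht]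

/-! ### Dilated stationary fields as site fields. -/

namespace IsStationarySequence

variable {d : ℕ} {Ω : Type*} {mΩ : MeasurableSpace Ω} {P : Measure Ω}
  {Y : ℕ → EuclideanSpace ℝ (Fin d) → Ω → ℝ} (hY : IsStationarySequence P Y)

include hY

lemma integral_sq (k : ℕ) (hk : 1 ≤ k) (x : EuclideanSpace ℝ (Fin d)) :
    ∫ ω, Y k x ω ^ 2 ∂P = 1 := by
  obtain ⟨f, δ, -, hcov, h0, -⟩ := hY.covariance
  -- The neighbourhood in the asymptotic hypothesis includes 0 itself, where the bound C|t|
  -- vanishes.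
  have h1 : f 0 = 1 := by
    obtain ⟨C, hC⟩ := h0.bound
    have := hC.self_of_nhdsWithin (Set.mem_Ici.2 le_rfl)
    simp only [norm_zero, mul_zero, norm_le_zero_iff] at this
    linarith
  have := hcov k hk x x
  rw [sub_self, norm_zero, h1] at this
  simpa only [sq] using this

lemma isStandardExp : IsStandardExp (Y 1 0) P where
  measurable := hY.measurable 1 le_rfl 0
  exp := hY.exp_moments 1 le_rfl
  mean := hY.centered 1 le_rfl 0
  var := hY.integral_sq 1 le_rfl 0

lemma identDistrib_zero (k : ℕ) (hk : 1 ≤ k) (x : EuclideanSpace ℝ (Fin d)) :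
    IdentDistrib (Y k x) (Y 1 0) P P := by
  have e : Measurable fun y : EuclideanSpace ℝ (Fin d) → ℝ => y 0 := measurable_pi_apply 0
  have h1 : IdentDistrib (fun ω => Y k (0 + x) ω) (fun ω => Y k 0 ω) P P :=
    (hY.stationary k hk x).comp e
  have h2 : IdentDistrib (fun ω => Y k 0 ω) (fun ω => Y 1 0 ω) P P :=
    (hY.identDistrib k hk).comp e
  rw [zero_add] at h1
  exact h1.trans h2

/-- The dilated fields, re-indexed from `0`, are site fields. -/
lemma isSiteField (b : ℕ → ℝ) : IsSiteField P (fun (k : ℕ) (x : unitCube d) ω =>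
    Y (k + 1) (b (k + 1) • (x : EuclideanSpace ℝ (Fin d))) ω) (Y 1 0) where
  std := hY.isStandardExp
  measurable k x := hY.measurable (k + 1) (by omega) _
  continuous k ω := (hY.continuous (k + 1) (by omega) ω).comp
    (continuous_subtype_val.const_smul (b (k + 1)))
  indep := by
    have h1 : iIndep (fun k : ℕ+ => MeasurableSpace.comap
        (fun (ω : Ω) (x : EuclideanSpace ℝ (Fin d)) => Y k x ω) inferInstance) P :=
      hY.independent
    -- Independence is given over indices from 1; the field of index k here is Y of index k + 1.
    have h2 := h1.precomp (g := Nat.succPNat) Nat.succPNat_injective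
    refine iIndep_mono h2 fun k => iSup_le fun x => ?_
    rw [← measurable_iff_comap_le]
    exact (measurable_pi_apply (b (k + 1) • (x : EuclideanSpace ℝ (Fin d)))).comp
      (comap_measurable fun (ω : Ω) (x : EuclideanSpace ℝ (Fin d)) => Y (k + 1) x ω)
  ident k x := hY.identDistrib_zero (k + 1) (by omega) _

lemma abs_covariance_le (k : ℕ) (hk : 1 ≤ k) (x y : EuclideanSpace ℝ (Fin d)) :
    |∫ ω, Y k x ω * Y k y ω ∂P| ≤ 1 := by
  have hL : ∀ x, MemLp (Y k x) 2 P := fun x =>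
    (hY.identDistrib_zero k hk x).memLp_iff.2 hY.isStandardExp.memLp_two
  have i1 : ∀ x, Integrable (fun ω => Y k x ω ^ 2) P := fun x => (hL x).integrable_sq
  have i2 : Integrable (fun ω => (Y k x ω ^ 2 + Y k y ω ^ 2) / 2) P :=
    ((i1 x).add (i1 y)).div_const 2
  refine abs_integral_le_integral_abs.trans ?_
  refine (integral_mono_of_nonneg (ae_of_all _ fun ω => abs_nonneg _) i2
    (ae_of_all _ fun ω => ?_)).trans (le_of_eq ?_)
  · simp only
    rw [abs_mul]
    nlinarith [sq_nonneg (|Y k x ω| - |Y k y ω|), sq_abs (Y k x ω), sq_abs (Y k y ω)]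
  · rw [integral_div, integral_add (i1 x) (i1 y), hY.integral_sq k hk, hY.integral_sq k hk]
    norm_num

/-- The chaos of dilated fields exists as soon as the dilations match the partial variances. -/
theorem hasAnalyticSubcriticalChaos [IsProbabilityMeasure P] (hd : 1 ≤ d) {a b : ℕ → ℝ} {B₀ C₀ : ℝ}
    (ha0 : ∀ k, 0 ≤ a (k + 1)) (ha1 : ∀ k, a (k + 1) ≤ 1)
    (hcube : ∀ m, ∑ k ∈ Finset.range m, a (k + 1) ^ 3 ≤ B₀)
    (hV : Tendsto (partialVar fun k => a (k + 1)) atTop atTop)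
    (hb : ∀ k, a (k + 1) ≠ 0 → 0 < b (k + 1) ∧
      |partialVar (fun k => a (k + 1)) (k + 1) - Real.log (b (k + 1))| ≤ C₀) :
    HasAnalyticSubcriticalChaos P (dilatedField a b Y) := by
  obtain ⟨f, δ, hδ, hcov, -, hf⟩ := hY.covariance
  -- As d ≥ 1, every t > 0 is the norm of a vector, so f t is a covariance of two variables of
  -- variance one.
  have hf1 : ∀ t, 0 < t → |f t| ≤ 1 := fun t ht => by
    set e : EuclideanSpace ℝ (Fin d) := EuclideanSpace.single ⟨0, hd⟩ t with he
    have h1 := hY.abs_covariance_le 1 le_rfl e 0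
    rwa [hcov 1 le_rfl, sub_zero, he, PiLp.norm_single, Real.norm_of_nonneg ht.le] at h1
  obtain ⟨C₁, hC₁, hfC⟩ := exists_abs_le_rpow hδ hf1 hf
  have h := hY.isSiteField b
  obtain ⟨n, B, hB, hs, hn⟩ := exists_scaleBounds (I := unitCube d) (a := fun k => a (k + 1))
    (b := fun k => b (k + 1)) (c := siteCov P fun (k : ℕ) (x : unitCube d) ω =>
      Y (k + 1) (b (k + 1) • (x : EuclideanSpace ℝ (Fin d))) ω) hδ hC₁ ha0 ha1 hcube hV hb
    (fun k x y => hY.abs_covariance_le (k + 1) (by omega) _ _) fun k x y hbk hxy => by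
      rw [siteCov, hcov (k + 1) (by omega), ← smul_sub, norm_smul, Real.norm_of_nonneg hbk.le,
        ← dist_eq_norm]
      exact hfC _ (mul_pos hbk hxy)
  exact h.hasAnalyticSubcriticalChaos (X := dilatedField a b Y) (fun k x ω => rfl) hδ hB hs hn

end IsStationarySequence


/-- Comparison of a sum of squares with a primitive. -/
lemma exists_abs_partialVar_sub_le {a : ℕ → ℝ} {F F' : ℝ → ℝ} {m : ℕ}
    (hF : ∀ x, (m : ℝ) ≤ x → HasDerivAt F (F' x) x) (hanti : AntitoneOn F' (Set.Ici m))
    (ha : ∀ k, m ≤ k → a k ^ 2 = F' k) :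
    ∃ C, ∀ n, m ≤ n → |partialVar (fun k => a (k + 1)) n - F n| ≤ C := by
  set V := partialVar fun k => a (k + 1) with hV
  have step : ∀ n : ℕ, m ≤ n → F' (n + 1 : ℕ) ≤ F (n + 1 : ℕ) - F n ∧
      F (n + 1 : ℕ) - F n ≤ F' n := fun n hn => by
    have hmn : (m : ℝ) ≤ n := by exact_mod_cast hn
    have hlt : (n : ℝ) < (n + 1 : ℕ) := by push_cast; linarith
    obtain ⟨c, ⟨hc1, hc2⟩, hc⟩ := exists_hasDerivAt_eq_slope F F' hlt
      (fun x hx => (hF x (hmn.trans hx.1)).continuousAt.continuousWithinAt)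
      fun x hx => hF x (hmn.trans hx.1.le)
    have h1 : ((n + 1 : ℕ) : ℝ) - n = 1 := by push_cast; ring
    rw [h1, div_one] at hc
    rw [← hc]
    have hcm : (m : ℝ) ≤ c := hmn.trans hc1.le
    exact ⟨hanti hcm (hcm.trans hc2.le) hc2.le, hanti hmn hcm hc1.le⟩
  refine ⟨|V m - F m| + F' m, fun n hn => abs_le.2 ?_⟩
  -- Integral comparison: since F' decreases, V - F is nonincreasing and V - F - F' is
  -- nondecreasing, which confines V - F to an interval of length F'(m).
  have key : V n - F n ≤ V m - F m ∧ V m - F m - F' m ≤ V n - F n - F' n := by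
    induction n, hn using Nat.le_induction with
    | base => exact ⟨le_rfl, le_rfl⟩
    | succ n hn ih =>
      obtain ⟨h1, h2⟩ := step n hn
      have h3 : V (n + 1) = V n + F' (n + 1 : ℕ) := by
        rw [hV, partialVar_succ, ha (n + 1) (by omega)]
      rw [h3]
      constructor <;> linarith [ih.1, ih.2]
  have h0 : 0 ≤ F' m := (sq_nonneg _).trans_eq (ha m le_rfl)
  have hn0 : 0 ≤ F' n := (sq_nonneg _).trans_eq (ha n hn)
  constructor <;> linarith [key.1, key.2, le_abs_self (V m - F m), neg_abs_le (V m - F m)]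

/-! ### The three families of coefficients and dilations. -/

namespace IsStationarySequence

variable {d : ℕ} {Ω : Type*} [mΩ : MeasurableSpace Ω] {P : Measure Ω} [IsProbabilityMeasure P]
  {Y : ℕ → EuclideanSpace ℝ (Fin d) → Ω → ℝ} (hY : IsStationarySequence P Y)

include hY

/-- The chaos exists when `a_k² = F'(k)` and `b_k = exp F(k)` for large `k`. -/
theorem hasAnalyticSubcriticalChaos_of_hasDerivAt (hd : 1 ≤ d) {a b : ℕ → ℝ} {F F' : ℝ → ℝ} {m : ℕ}
    (hF : ∀ x, (m : ℝ) ≤ x → HasDerivAt F (F' x) x) (hanti : AntitoneOn F' (Set.Ici m))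
    (hFtop : Tendsto F atTop atTop) (ha : ∀ k, m ≤ k → a k ^ 2 = F' k)
    (ha0 : ∀ k, m ≤ k → 0 ≤ a k) (ha1 : ∀ k, m ≤ k → a k ≤ 1)
    (ham : ∀ k, 1 ≤ k → k < m → a k = 0) (hcube : Summable fun k => a k ^ 3)
    (hb : ∀ k, m ≤ k → 0 < b k ∧ Real.log (b k) = F k) :
    HasAnalyticSubcriticalChaos P (dilatedField a b Y) := by
  obtain ⟨C, hC⟩ := exists_abs_partialVar_sub_le hF hanti ha
  have hpos : ∀ k, 0 ≤ a (k + 1) := fun k => by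
    by_cases h : m ≤ k + 1
    · exact ha0 _ h
    · rw [ham _ (by omega) (by omega)]
  refine hY.hasAnalyticSubcriticalChaos hd (B₀ := ∑' k, a (k + 1) ^ 3) (C₀ := C) hpos (fun k => ?_)
    (fun n => ((summable_nat_add_iff 1).2 hcube).sum_le_tsum _ fun k _ => pow_nonneg (hpos k) 3)
    ?_ fun k hk => ?_
  · by_cases h : m ≤ k + 1
    · exact ha1 _ h
    · rw [ham _ (by omega) (by omega)]; exact zero_le_one
  · refine tendsto_atTop_mono' atTop ?_
      (tendsto_atTop_add_const_right _ (-C) (hFtop.comp tendsto_natCast_atTop_atTop))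
    filter_upwards [eventually_ge_atTop m] with n hn
    have := (abs_le.1 (hC n hn)).1
    simp only [Function.comp_apply]
    linarith
  · have hm : m ≤ k + 1 := by
      by_contra h
      exact hk (ham _ (by omega) (by omega))
    rw [(hb _ hm).2]
    exact ⟨(hb _ hm).1, hC _ hm⟩

theorem hasAnalyticSubcriticalChaos_rpow (hd : 1 ≤ d) {α : ℝ} (h1 : 1 / 3 < α) (h2 : α < 1 / 2) :
    HasAnalyticSubcriticalChaos P (dilatedField (fun k => (k : ℝ) ^ (-α))
      (fun k => Real.exp ((k : ℝ) ^ (1 - 2 * α) / (1 - 2 * α))) Y) := by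
  have h3 : 0 < 1 - 2 * α := by linarith
  refine hY.hasAnalyticSubcriticalChaos_of_hasDerivAt hd (m := 1)
    (F := fun x => x ^ (1 - 2 * α) / (1 - 2 * α)) (F' := fun x => x ^ (-(2 * α)))
    (fun x hx => ?_) (fun x hx y _ hxy => ?_) ((tendsto_rpow_atTop h3).atTop_div_const h3)
    (fun k hk => ?_) (fun k _ => by positivity) (fun k hk => ?_) (fun k hk hk' => by omega) ?_
    fun k _ => ⟨Real.exp_pos _, Real.log_exp _⟩
  · have hx0 : x ≠ 0 := by
      rintro rfl
      norm_num at hx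
    refine ((Real.hasDerivAt_rpow_const (p := 1 - 2 * α) (Or.inl hx0)).div_const
      (1 - 2 * α)).congr_deriv ?_
    rw [mul_div_cancel_left₀ _ h3.ne']
    congr 1
    ring
  · rw [Set.mem_Ici, Nat.cast_one] at hx
    exact Real.rpow_le_rpow_of_nonpos (by linarith) hxy (by linarith)
  · rw [← Real.rpow_natCast, ← Real.rpow_mul (Nat.cast_nonneg k)]
    congr 1
    push_cast
    ring
  · exact Real.rpow_le_one_of_one_le_of_nonpos (by exact_mod_cast hk) (by linarith)
  -- The value 1/3 is the threshold for summability of the cubes, while α < 1/2 makes the variance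
  -- diverge.
  · refine (Real.summable_nat_rpow.2 (by linarith : -(3 * α) < -1)).congr fun k => ?_
    rw [← Real.rpow_natCast, ← Real.rpow_mul (Nat.cast_nonneg k)]
    congr 1
    push_cast
    ring

theorem hasAnalyticSubcriticalChaos_rpow_half (hd : 1 ≤ d) :
    HasAnalyticSubcriticalChaos P (dilatedField (fun k => (k : ℝ) ^ (-(1 / 2) : ℝ))
      (fun k => (k : ℝ)) Y) := by
  refine hY.hasAnalyticSubcriticalChaos_of_hasDerivAt hd (m := 1)
    (F := Real.log) (F' := fun x => x⁻¹)
    (fun x hx => ?_) (fun x hx y _ hxy => ?_) Real.tendsto_log_atTop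
    (fun k hk => ?_) (fun k _ => by positivity) (fun k hk => ?_) (fun k hk hk' => by omega) ?_
    fun k hk => ⟨by exact_mod_cast hk, rfl⟩
  · refine Real.hasDerivAt_log ?_
    rintro rfl
    norm_num at hx
  · rw [Set.mem_Ici, Nat.cast_one] at hx
    exact inv_anti₀ (by linarith) hxy
  · rw [← Real.rpow_natCast, ← Real.rpow_mul (Nat.cast_nonneg k), ← Real.rpow_neg_one]
    norm_num
  · exact Real.rpow_le_one_of_one_le_of_nonpos (by exact_mod_cast hk) (by norm_num)
  · refine (Real.summable_nat_rpow.2 (by norm_num : (-(3 / 2) : ℝ) < -1)).congr fun k => ?_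
    rw [← Real.rpow_natCast, ← Real.rpow_mul (Nat.cast_nonneg k)]
    norm_num

theorem hasAnalyticSubcriticalChaos_log (hd : 1 ≤ d) :
    HasAnalyticSubcriticalChaos P (dilatedField
      (fun k => if 2 ≤ k then ((k : ℝ) * Real.log k) ^ (-(1 / 2) : ℝ) else 0)
      (fun k => if 2 ≤ k then Real.log k else 0) Y) := by
  -- Gives k log k ≥ 1 from k = 2 on, hence coefficients at most 1, and k log k ≥ k/2, which
  -- compares their cubes with k^{-3/2}.
  have hlog2 : 1 / 2 < Real.log 2 := by linarith [Real.log_two_gt_d9]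
  have hlog : ∀ x : ℝ, 2 ≤ x → 1 / 2 < Real.log x := fun x hx =>
    hlog2.trans_le (Real.log_le_log two_pos hx)
  have hmul : ∀ k : ℕ, 2 ≤ k → 1 ≤ (k : ℝ) * Real.log k := fun k hk => by
    have h2 : (2 : ℝ) ≤ k := by exact_mod_cast hk
    nlinarith [hlog k h2]
  have hcast : ∀ k : ℕ, 2 ≤ k → (2 : ℝ) ≤ k := fun k hk => by exact_mod_cast hk
  have hcube : ∀ k : ℕ, 2 ≤ k → (((k : ℝ) * Real.log k) ^ (-(1 / 2) : ℝ)) ^ 3 ≤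
      (1 / 2) ^ (-(3 / 2) : ℝ) * (k : ℝ) ^ (-(3 / 2) : ℝ) := fun k hk => by
    have h2 := hcast k hk
    rw [← Real.rpow_natCast, ← Real.rpow_mul (by linarith [hmul k hk]),
      ← Real.mul_rpow (by norm_num) (by linarith)]
    norm_num only
    refine Real.rpow_le_rpow_of_nonpos (by linarith) ?_ (by norm_num)
    nlinarith [hlog k h2]
  refine hY.hasAnalyticSubcriticalChaos_of_hasDerivAt hd (m := 2)
    (F := fun x => Real.log (Real.log x)) (F' := fun x => (x * Real.log x)⁻¹)
    (fun x hx => ?_) (fun x hx y hy hxy => ?_)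
    (Real.tendsto_log_atTop.comp Real.tendsto_log_atTop)
    (fun k hk => ?_) (fun k hk => ?_) (fun k hk => ?_) (fun k _ hk => if_neg (by omega)) ?_
    fun k hk => ?_
  · have hx2 : (2 : ℝ) ≤ x := hx
    refine ((Real.hasDerivAt_log (by linarith : x ≠ 0)).log
      (by linarith [hlog x hx2])).congr_deriv ?_
    rw [mul_inv, div_eq_mul_inv]
  · have hx2 : (2 : ℝ) ≤ x := hx
    have := hlog x hx2
    have := hlog y (hx2.trans hxy)
    have := Real.log_le_log (by linarith) hxy
    exact inv_anti₀ (by nlinarith) (by nlinarith)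
  · rw [if_pos hk, ← Real.rpow_natCast, ← Real.rpow_mul (by linarith [hmul k hk]),
      ← Real.rpow_neg_one]
    norm_num
  · rw [if_pos hk]
    exact Real.rpow_nonneg (by linarith [hmul k hk]) _
  · rw [if_pos hk]
    exact Real.rpow_le_one_of_one_le_of_nonpos (hmul k hk) (by norm_num)
  · refine Summable.of_nonneg_of_le (fun k => ?_) (fun k => ?_)
      ((Real.summable_nat_rpow.2 (by norm_num : (-(3 / 2) : ℝ) < -1)).mul_left
        ((1 / 2) ^ (-(3 / 2) : ℝ)))
    · split_ifs with hk
      · exact pow_nonneg (Real.rpow_nonneg (by linarith [hmul k hk]) _) 3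
      · norm_num
    · split_ifs with hk
      · exact hcube k hk
      · rw [zero_pow three_ne_zero]
        positivity
  · simp only [if_pos hk]
    exact ⟨by linarith [hlog k (hcast k hk)], trivial⟩

end IsStationarySequence

end LogChaos

theorem mainTheorem4 {d : ℕ} (hd : 1 ≤ d) {Ω : Type*} [MeasurableSpace Ω]
    (P : Measure Ω) [IsProbabilityMeasure P]
    (Y : ℕ → EuclideanSpace ℝ (Fin d) → Ω → ℝ)
    (hY : LogChaos.IsStationarySequence P Y) :
    (∀ α : ℝ, 1 / 3 < α → α < 1 / 2 →
      LogChaos.HasAnalyticSubcriticalChaos P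
        (LogChaos.dilatedField
          (fun k => (k : ℝ) ^ (-α))
          (fun k => Real.exp ((k : ℝ) ^ (1 - 2 * α) / (1 - 2 * α))) Y)) ∧
    LogChaos.HasAnalyticSubcriticalChaos P
      (LogChaos.dilatedField
        (fun k => (k : ℝ) ^ (-(1 / 2) : ℝ))
        (fun k => (k : ℝ)) Y) ∧
    LogChaos.HasAnalyticSubcriticalChaos P
      (LogChaos.dilatedField
        (fun k => if 2 ≤ k then ((k : ℝ) * Real.log k) ^ (-(1 / 2) : ℝ) else 0)
        (fun k => if 2 ≤ k then Real.log k else 0) Y) := by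
  exact ⟨fun _ h1 h2 => hY.hasAnalyticSubcriticalChaos_rpow hd h1 h2,
    hY.hasAnalyticSubcriticalChaos_rpow_half hd, hY.hasAnalyticSubcriticalChaos_log hd⟩

end
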